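/- Let $\Omega\subseteq B_1(0)\subset\mathbb{R}^3$ be a domain with $C^\infty$ boundary, $0\in\Omega$, such that $\mathbb{R}^3\setminus\overline\Omega$ is connected. For $0<\varepsilon<1$ put $\Omega^\varepsilon=\varepsilon\Omega$, $\Gamma^\varepsilon=\partial\Omega^\varepsilon$ and $\Omega^{\varepsilon,c}=\mathbb{R}^3\setminus\overline{\Omega^\varepsilon}$. All function spaces are complex-valued. Let $\mathbb{C}^+=\{s\in\mathbb{C}:\Re s>0\}$ and, for $s,z\in\mathbb{C}^+$, let - $\mathcal{R}_D^\varepsilon(s)=(s^2-\Delta_D^\varepsilon)^{-1}$ on $L^2(\Omega^{\varepsilon,c})$, where $\Delta_D^\varepsilon$ is the Dirichlet Laplacian, with domain $\{u\in H^1_0(\Omega^{\varepsilon,c}):\Delta u\in L^2(\Omega^{\varepsilon,c})\}$; - $\mathcal{R}_0(s)=(s^2-\Delta_0)^{-1}$ on $L^2(\mathbb{R}^3)$, where $\Delta_0$ is the Laplacian with domain $H^2(\mathbb{R}^3)$; functions on $\Omega^{\varepsilon,c}$ are extended by zero before $\mathcal{R}_0(s)$ is applied to them, and $\mathcal{R}_0^\varepsilon(s)f=(\mathcal{R}_0(s)f)|_{\Omega^{\varepsilon,c}}$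 for $f\in L^2(\Omega^{\varepsilon,c})$; - $\gamma_0^\varepsilon$ be the trace on $\Gamma^\varepsilon$ of $H^1$ functions on $\Omega^{\varepsilon,c}$, with range $H^{1/2}(\Gamma^\varepsilon)$; - $\mathcal{N}_D^\varepsilon(z):H^{1/2}(\Gamma^\varepsilon)\to H^1(\Omega^{\varepsilon,c})$ map $g$ to the unique $v\in H^1(\Omega^{\varepsilon,c})$ with $(z^2-\Delta)v=0$ in $\Omega^{\varepsilon,c}$ and $\gamma_0^\varepsilon v=g$; - $\mathcal{D}_D^\varepsilon(s)=\mathcal{R}_D^\varepsilon(s)-\mathcal{R}_0^\varepsilon(s)$. Fix $\chi\in C^\infty(\mathbb{R}^3;[0,1])$ with $\chi(x)=1$ for $|x|<1$ and $\chi(x)=0$ for $|x|\ge2$, and put $\chi_a(x)=\chi(x/a)$ for $a>0$. Write $[\Delta,\chi_a]u=(\Delta\chi_a)u+2\nabla\chi_a\cdot\nabla u$. Then these operators are well defined: the solutions that define $\mathcal{R}_D^\varepsilon(s)f$, $\mathcal{R}_0(s)f$ and $\mathcal{N}_D^\varepsilon(z)g$ and the trace $\gamma_0^\varepsilon\mathcal{R}_0(s)f$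 exist and are unique. Moreover, for all $s,z\in\mathbb{C}^+$, all $0<\varepsilon<1$ and every integer $m\ge2$, as operators on $L^2(\Omega^{\varepsilon,c})$, $$\mathcal{D}_D^\varepsilon(s)=-\bigl(\chi_{m\varepsilon}+Q_\varepsilon(s,z)\bigr)\,\mathcal{N}_D^\varepsilon(z)\,\gamma_0^\varepsilon\,\mathcal{R}_0(s),$$ where $$Q_\varepsilon(s,z)=\bigl(\mathcal{R}_0^\varepsilon(s)[\Delta,\chi_{2m\varepsilon}]+\chi_{2m\varepsilon}\bigr)\chi_{4m\varepsilon}\mathcal{R}_D^\varepsilon(s)\chi_{2m\varepsilon}L_{m\varepsilon}(s,z),\qquad L_{m\varepsilon}(s,z)=[\Delta,\chi_{m\varepsilon}]-(s^2-z^2)\chi_{m\varepsilon}.$$ -/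

import Mathlib

open MeasureTheory TopologicalSpace
open scoped ContDiff Distributions SchwartzMap LineDeriv Laplacian ENNReal Pointwise

noncomputable section

namespace KreinFormula

/-- Three-dimensional Euclidean space. -/
abbrev E3 : Type := EuclideanSpace ℝ (Fin 3)

/-- The standard basis vectors of `ℝ³`. -/
def e (i : Fin 3) : E3 := EuclideanSpace.single i 1

/-! ### Geometry -/

/-- The boundary of `Ω` is smooth: near each boundary point `Ω` is a sublevel set
of a smooth function with nonvanishing differential at that point. -/
def HasSmoothBoundary (Ω : Set E3) : Prop :=
  ∀ x ∈ frontier Ω, ∃ (V : Set E3) (ρ : E3 → ℝ),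
    IsOpen V ∧ x ∈ V ∧ ContDiffOn ℝ ∞ ρ V ∧ fderiv ℝ ρ x ≠ 0 ∧ Ω ∩ V = {y ∈ V | ρ y < 0}

/-- The reference obstacle: a smooth domain inside the unit ball, containing the origin,
with connected exterior. -/
structure IsObstacle (Ω : Set E3) : Prop where
  isOpen : IsOpen Ω
  isConnected : IsConnected Ω
  subset_ball : Ω ⊆ Metric.ball 0 1
  zero_mem : (0 : E3) ∈ Ω
  exterior_isConnected : IsConnected (closure Ω)ᶜ
  smooth : HasSmoothBoundary Ω

/-- The exterior `ℝ³ \ closure Ω`. -/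
def exterior (Ω : Set E3) : Opens E3 := ⟨(closure Ω)ᶜ, isClosed_closure.isOpen_compl⟩

/-- The surface measure on `∂Ω` (two-dimensional Hausdorff measure). -/
def surfaceMeasure (Ω : Set E3) : Measure E3 := (Measure.hausdorffMeasure 2).restrict (frontier Ω)

/-! ### Lebesgue spaces, extension, restriction, multiplication -/

/-- `L²(U; ℂ)`. -/
abbrev L2 (U : Opens E3) : Type := Lp ℂ 2 ((volume : Measure E3).restrict (U : Set E3))

/-- `L²(ℝ³; ℂ)`. -/
abbrev L2Space : Type := Lp ℂ 2 (volume : Measure E3)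

/-- `L²(∂Ω; ℂ)`. -/
abbrev L2Boundary (Ω : Set E3) : Type := Lp ℂ 2 (surfaceMeasure Ω)

/-- Extension by zero `L²(U) → L²(ℝ³)`. -/
def extendZero {U : Opens E3} (u : L2 U) : L2Space :=
  ((memLp_indicator_iff_restrict U.isOpen.measurableSet).2 (Lp.memLp u)).toLp
    ((U : Set E3).indicator u)

/-- Restriction `L²(ℝ³) → L²(U)`. -/
def restrictTo (U : Opens E3) (u : L2Space) : L2 U :=
  ((Lp.memLp u).restrict (U : Set E3)).toLp u

open Classical in
/-- Multiplication of `u ∈ L²(U)` by the real function `a`. (It is only used for continuous `a` with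
compact support, for which the product is in `L²(U)`, see `memLp_smul` below.) -/
def mulBy {U : Opens E3} (a : E3 → ℝ) (u : L2 U) : L2 U :=
  if h : MemLp (fun x => a x • u x) 2 ((volume : Measure E3).restrict (U : Set E3))
  then h.toLp _ else 0

theorem memLp_smul {U : Opens E3} {a : E3 → ℝ} (ha : Continuous a) (hc : HasCompactSupport a)
    (u : L2 U) : MemLp (fun x => a x • u x) 2 ((volume : Measure E3).restrict (U : Set E3)) := by
  obtain ⟨C, hC⟩ := hc.exists_bound_of_continuous ha
  refine (Lp.memLp u).of_le_mul (c := C)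
    (ha.aestronglyMeasurable.smul (Lp.memLp u).aestronglyMeasurable) ?_
  filter_upwards with x
  rw [norm_smul]
  gcongr
  exact hC x

/-! ### Weak derivatives and Sobolev spaces on an open set -/

/-- `g` is the weak partial derivative `∂ᵢ u` in `U`. -/
def HasWeakPartial {U : Opens E3} (i : Fin 3) (u g : L2 U) : Prop :=
  ∀ φ : 𝓓(U, ℂ), ∫ x in (U : Set E3), u x * (∂_{e i} φ) x = -∫ x in (U : Set E3), g x * φ x

/-- `g` is the weak (distributional) Laplacian `Δ u` in `U`. -/
def HasWeakLaplacian {U : Opens E3} (u g : L2 U) : Prop :=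
  ∀ φ : 𝓓(U, ℂ),
    ∫ x in (U : Set E3), u x * (∑ i, (∂_{e i} (∂_{e i} φ)) x) = ∫ x in (U : Set E3), g x * φ x

/-- `u ∈ H¹(U)`. -/
def MemH1 {U : Opens E3} (u : L2 U) : Prop := ∀ i, ∃ g : L2 U, HasWeakPartial i u g

open Classical in
/-- The weak partial derivative `∂ᵢ u ∈ L²(U)` of `u ∈ H¹(U)`. -/
def weakPartial {U : Opens E3} (i : Fin 3) (u : L2 U) : L2 U :=
  if h : ∃ g : L2 U, HasWeakPartial i u g then h.choose else 0

/-- Weak partial derivatives are unique, so that `weakPartial` is the weak derivative. -/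
theorem HasWeakPartial.unique {U : Opens E3} {i : Fin 3} {u g h : L2 U}
    (hg : HasWeakPartial i u g) (hh : HasWeakPartial i u h) : g = h := by
  have hli (k : L2 U) : LocallyIntegrable k ((volume : Measure E3).restrict (U : Set E3)) :=
    (Lp.memLp k).locallyIntegrable (by norm_num)
  have key : ∀ᵐ x ∂((volume : Measure E3).restrict (U : Set E3)), x ∈ (U : Set E3) → (g - h) x = 0 := by
    refine U.isOpen.ae_eq_zero_of_integral_contDiff_smul_eq_zero
      ((hli (g - h)).locallyIntegrableOn _) ?_
    intro ψ h1 h2 h3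
    let φ : 𝓓(U, ℂ) := ⟨fun x => (ψ x : ℂ), Complex.ofRealCLM.contDiff.comp h1,
      h2.comp_left Complex.ofReal_zero, (closure_mono (by
        intro x hx; simpa using hx)).trans h3⟩
    have e1 := hg φ
    have e2 := hh φ
    have e3 := neg_injective (e1.symm.trans e2)
    have int (k : L2 U) : Integrable (fun x => k x * φ x)
        ((volume : Measure E3).restrict (U : Set E3)) := by
      have := (hli k).integrable_smul_left_of_hasCompactSupport h1.continuous h2
      refine this.congr (.of_forall fun x => ?_)
      change ψ x • k x = k x * (ψ x : ℂ)
      rw [Complex.real_smul, mul_comm]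
    rw [← sub_eq_zero, ← integral_sub (int g) (int h)] at e3
    rw [← e3]
    refine integral_congr_ae ?_
    filter_upwards [Lp.coeFn_sub g h] with x hx
    change ψ x • (g - h) x = g x * (ψ x : ℂ) - h x * (ψ x : ℂ)
    rw [hx, Complex.real_smul]; simp; ring
  rw [← sub_eq_zero]
  ext1
  filter_upwards [key, ae_restrict_mem U.isOpen.measurableSet, Lp.coeFn_zero ℂ 2 ((volume : Measure E3).restrict (U : Set E3))] with x hx hxU h0
  rw [hx hxU, h0]; rfl

/-- `‖u - φ‖ ≤ δ` in `L²(U)`, together with all the first order derivatives. -/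
def H1Close {U : Opens E3} (u : L2 U) {V : Opens E3} (φ : 𝓓(V, ℂ)) (δ : ℝ≥0∞) : Prop :=
  eLpNorm (fun x => u x - φ x) 2 ((volume : Measure E3).restrict (U : Set E3)) ≤ δ ∧
  ∀ i, eLpNorm (fun x => weakPartial i u x - (∂_{e i} φ) x) 2
    ((volume : Measure E3).restrict (U : Set E3)) ≤ δ

/-- `u ∈ H¹₀(U)`, the closure of `C_c^∞(U)` in `H¹(U)`. -/
def MemH10 {U : Opens E3} (u : L2 U) : Prop :=
  MemH1 u ∧ ∀ δ : ℝ≥0∞, 0 < δ → ∃ φ : 𝓓(U, ℂ), H1Close u φ δ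

/-! ### The Dirichlet trace on `∂Ω` of functions on the exterior of `Ω` -/

/-- `g` is the trace on `∂Ω` of `u ∈ H¹(exterior Ω)`: the pair `(u, g)` is in the closure of the
pairs `(φ|_{exterior Ω}, φ|_{∂Ω})`, `φ ∈ C_c^∞(ℝ³)`, in `H¹(exterior Ω) × L²(∂Ω)`. -/
def IsTrace (Ω : Set E3) (u : L2 (exterior Ω)) (g : L2Boundary Ω) : Prop :=
  MemH1 u ∧ ∀ δ : ℝ≥0∞, 0 < δ → ∃ φ : 𝓓((⊤ : Opens E3), ℂ), H1Close u φ δ ∧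
    eLpNorm (fun x => g x - φ x) 2 (surfaceMeasure Ω) ≤ δ

open Classical in
/-- The trace operator `γ₀`. -/
def trace (Ω : Set E3) (u : L2 (exterior Ω)) : L2Boundary Ω :=
  if h : ∃ g, IsTrace Ω u g then h.choose else 0

/-- `H^{1/2}(∂Ω)`, the space of the traces of `H¹` functions. -/
def HHalf (Ω : Set E3) : Set (L2Boundary Ω) := {g | ∃ u, IsTrace Ω u g}

/-! ### Resolvents and the exterior Dirichlet problem -/

/-- `u ∈ D(Δ_D) = H¹₀(Δ; exterior Ω) = {u ∈ H¹₀ | Δ u ∈ L²}` and `(s² - Δ_D) u = f`. -/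
def IsDirichletResolvent (Ω : Set E3) (s : ℂ) (f u : L2 (exterior Ω)) : Prop :=
  MemH10 u ∧ HasWeakLaplacian u (s ^ 2 • u - f)

open Classical in
/-- `R_D(s) = (s² - Δ_D)⁻¹`. -/
def dirichletResolvent (Ω : Set E3) (s : ℂ) (f : L2 (exterior Ω)) : L2 (exterior Ω) :=
  if h : ∃ u, IsDirichletResolvent Ω s f u then h.choose else 0

/-- `u ∈ D(Δ_0) = H²(ℝ³)` and `(s² - Δ_0) u = f`. -/
def IsFreeResolvent (s : ℂ) (f u : L2Space) : Prop :=
  TemperedDistribution.MemSobolev 2 2 (u : 𝓢'(E3, ℂ)) ∧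
    s ^ 2 • (u : 𝓢'(E3, ℂ)) - Δ (u : 𝓢'(E3, ℂ)) = (f : 𝓢'(E3, ℂ))

open Classical in
/-- `R_0(s) = (s² - Δ_0)⁻¹` on `L²(ℝ³)`. -/
def freeResolvent (s : ℂ) (f : L2Space) : L2Space :=
  if h : ∃ u, IsFreeResolvent s f u then h.choose else 0

/-- The free resolvent between functions on the exterior: extend by zero, apply `R_0(s)`,
restrict. -/
def freeResolventExt (Ω : Set E3) (s : ℂ) (f : L2 (exterior Ω)) : L2 (exterior Ω) :=
  restrictTo (exterior Ω) (freeResolvent s (extendZero f))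

/-- `v ∈ H¹(exterior Ω)` solves `(z² - Δ) v = 0` in the exterior, `γ₀ v = g`. -/
def IsDirichletSolution (Ω : Set E3) (z : ℂ) (g : L2Boundary Ω) (v : L2 (exterior Ω)) : Prop :=
  MemH1 v ∧ HasWeakLaplacian v (z ^ 2 • v) ∧ IsTrace Ω v g

open Classical in
/-- The solution operator `N_D(z) : H^{1/2}(∂Ω) → H¹(exterior Ω)`. -/
def dirichletSolution (Ω : Set E3) (z : ℂ) (g : L2Boundary Ω) : L2 (exterior Ω) :=
  if h : ∃ v, IsDirichletSolution Ω z g v then h.choose else 0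

/-- `D_D(s) = R_D(s) - R_0(s)` on `L²(exterior Ω)`. -/
def resolventDifference (Ω : Set E3) (s : ℂ) (f : L2 (exterior Ω)) : L2 (exterior Ω) :=
  dirichletResolvent Ω s f - freeResolventExt Ω s f

/-! ### Cut-off functions and commutators -/

/-- `χ ∈ C^∞(ℝ³; [0,1])`, `χ = 1` for `|x| < 1`, `χ = 0` for `|x| ≥ 2`. -/
structure IsCutoff (χ : E3 → ℝ) : Prop where
  smooth : ContDiff ℝ ∞ χ
  mem_Icc : ∀ x, χ x ∈ Set.Icc (0 : ℝ) 1
  eq_one : ∀ x, ‖x‖ < 1 → χ x = 1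
  eq_zero : ∀ x, 2 ≤ ‖x‖ → χ x = 0

/-- `χ_a(x) = χ(x / a)`. -/
def scaled (χ : E3 → ℝ) (a : ℝ) : E3 → ℝ := fun x => χ (a⁻¹ • x)

/-- The commutator `[Δ, a] u = (Δ a) u + 2 ∇a · ∇u`, for `u ∈ H¹(U)`. -/
def commLaplacian {U : Opens E3} (a : E3 → ℝ) (u : L2 U) : L2 U :=
  mulBy (Δ a) u + (2 : ℂ) • ∑ i, mulBy (fun x => fderiv ℝ a x (e i)) (weakPartial i u)

/-- `L(s,z) = [Δ, a] - (s² - z²) a`. -/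
def opL {U : Opens E3} (a : E3 → ℝ) (s z : ℂ) (u : L2 U) : L2 U :=
  commLaplacian a u - (s ^ 2 - z ^ 2) • mulBy a u

/-- `Q(s,z) = (R_0(s) [Δ, χ_{2δ}] + χ_{2δ}) χ_{4δ} R_D(s) χ_{2δ} L_δ(s,z)`, acting on
`H¹(exterior Ω)`. -/
def opQ (Ω : Set E3) (χ : E3 → ℝ) (δ : ℝ) (s z : ℂ) (v : L2 (exterior Ω)) : L2 (exterior Ω) :=
  let w := mulBy (scaled χ (4 * δ)) (dirichletResolvent Ω s
    (mulBy (scaled χ (2 * δ)) (opL (scaled χ δ) s z v)))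
  freeResolventExt Ω s (commLaplacian (scaled χ (2 * δ)) w) + mulBy (scaled χ (2 * δ)) w

end KreinFormula

end

noncomputable section

namespace KreinFormula

/-! ### Test functions as plain functions -/

/-! Put δ = mε, v = N_D(z) γ₀ R_0(s) f and w = R_0(s) f - χ_δ v - R_D(s) f. Since χ_δ = 1 on the
boundary, the traces of R_0(s) f and χ_δ v cancel, so w has trace zero and lies in H¹₀. Since (z² -
Δ) v = 0, the Leibniz rule gives (s² - Δ)(χ_δ v) = -L_δ v. Hence (s² - Δ) w = L_δ v, and w = R_D(s)
L_δ v by uniqueness. Thus D_D(s) f = -(χ_δ v + w), and it remains to recognise w as Q v. The source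
L_δ v vanishes for |x| ≥ 2δ, so (1 - χ_{2δ}) w, extended by zero, solves the free equation on ℝ³
with source [Δ, χ_{2δ}] w. Therefore R_0(s) [Δ, χ_{2δ}] w = (1 - χ_{2δ}) w
(`freeResolventExt_commLaplacian`), and the other cut-offs in Q equal one wherever they act.
`IsRegular.krein` assembles this.

The rest shows that the operators exist. The Dirichlet problem in H¹₀ is Lax–Milgram
(`existsUnique_dirichlet`): after multiplication by the conjugate of s the quadratic form s²‖u‖² +
‖∇u‖² has real part Re s (|s|²‖u‖² + ‖∇u‖²), so it is coercive for every s in the half-plane. The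
free resolvent is a Fourier multiplier; its uniqueness is Dirichlet uniqueness in the open set ℝ³,
because H¹(ℝ³) = H¹₀(ℝ³).

Traces are defined by closure, and three facts make them usable. The trace inequality
`exists_trace_le` gives existence and uniqueness. The flux inequality `exists_flux_le`, a weak form
of the divergence theorem, shows that a function of trace zero extends by zero to H¹(ℝ³). Small
outward translations followed by mollification then put it into H¹₀
(`IsRegular.memH10_of_isTrace_zero`). All three rest on `IsTransversal`: near a boundary point,
lines in an outward direction leave Ω for good, and the boundary is a Lipschitz graph over a plane
transversal to that direction. Surface and Lebesgue measure are compared only up to constants, so no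
area formula is involved. -/

/-- `φ ∈ C_c^∞(U; ℂ)`. -/
structure IsTest (U : Set E3) (φ : E3 → ℂ) : Prop where
  contDiff : ContDiff ℝ ∞ φ
  hasCompactSupport : HasCompactSupport φ
  tsupport_subset : tsupport φ ⊆ U

/-- The classical partial derivative `∂ᵢ f`. -/
def pd {F : Type*} [NormedAddCommGroup F] [NormedSpace ℝ F] (i : Fin 3) (f : E3 → F) (x : E3) : F :=
  fderiv ℝ f x (e i)

section Pd

variable {F : Type*} [NormedAddCommGroup F] [NormedSpace ℝ F]

theorem contDiff_pd {f : E3 → F} (hf : ContDiff ℝ ∞ f) (i : Fin 3) : ContDiff ℝ ∞ (pd i f) :=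
  (hf.fderiv_right (m := ∞) (by simp)).clm_apply contDiff_const

theorem tsupport_pd_subset (f : E3 → F) (i : Fin 3) : tsupport (pd i f) ⊆ tsupport f :=
  tsupport_fderiv_apply_subset ℝ (e i)

theorem differentiable_of_smooth {f : E3 → F} (hf : ContDiff ℝ ∞ f) : Differentiable ℝ f :=
  hf.differentiable (by simp)

theorem pd_add {f g : E3 → F} (hf : ContDiff ℝ ∞ f) (hg : ContDiff ℝ ∞ g) (i : Fin 3) (x : E3) :
    pd i (fun y => f y + g y) x = pd i f x + pd i g x := by
  simp only [pd]
  rw [fderiv_fun_add (differentiable_of_smooth hf x) (differentiable_of_smooth hg x)]; rfl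

theorem pd_sub {f g : E3 → F} (hf : ContDiff ℝ ∞ f) (hg : ContDiff ℝ ∞ g) (i : Fin 3) (x : E3) :
    pd i (fun y => f y - g y) x = pd i f x - pd i g x := by
  simp only [pd]
  rw [fderiv_fun_sub (differentiable_of_smooth hf x) (differentiable_of_smooth hg x)]; rfl

theorem pd_smul {a : E3 → ℝ} {f : E3 → F} (ha : ContDiff ℝ ∞ a) (hf : ContDiff ℝ ∞ f) (i : Fin 3)
    (x : E3) : pd i (fun y => a y • f y) x = a x • pd i f x + pd i a x • f x := by
  simp only [pd]
  rw [fderiv_fun_smul (differentiable_of_smooth ha x) (differentiable_of_smooth hf x)]; rfl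

theorem pd_mul {f g : E3 → ℂ} (hf : ContDiff ℝ ∞ f) (hg : ContDiff ℝ ∞ g) (i : Fin 3)
    (x : E3) : pd i (fun y => f y * g y) x = f x * pd i g x + pd i f x * g x := by
  simp only [pd]
  rw [fderiv_fun_mul (differentiable_of_smooth hf x) (differentiable_of_smooth hg x)]
  simp [mul_comm]

theorem pd_const_mul {f : E3 → ℂ} (hf : ContDiff ℝ ∞ f) (c : ℂ) (i : Fin 3)
    (x : E3) : pd i (fun y => c * f y) x = c * pd i f x := by
  simp only [pd]
  rw [fderiv_const_mul (differentiable_of_smooth hf x)]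
  simp

theorem pd_sum {ι : Type*} (s : Finset ι) {f : ι → E3 → F} (hf : ∀ j ∈ s, ContDiff ℝ ∞ (f j))
    (i : Fin 3) (x : E3) : pd i (fun y => ∑ j ∈ s, f j y) x = ∑ j ∈ s, pd i (f j) x := by
  simp only [pd]
  rw [fderiv_fun_sum fun j hj => differentiable_of_smooth (hf j hj) x]
  simp

theorem laplacian_eq_sum_pd {f : E3 → F} (hf : ContDiff ℝ ∞ f) (x : E3) :
    (Δ f) x = ∑ i, pd i (pd i f) x := by
  rw [InnerProductSpace.laplacian_eq_iteratedFDeriv_orthonormalBasis f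
    (EuclideanSpace.basisFun (Fin 3) ℝ)]
  refine Finset.sum_congr rfl fun i _ => ?_
  change _ = fderiv ℝ (fun y => (fderiv ℝ f y) ((fun _ => e i) y)) x (e i)
  rw [fderiv_clm_apply ((hf.fderiv_right (m := ∞) (by simp)).differentiable (by simp) x)
    (differentiableAt_const _)]
  simp [iteratedFDeriv_two_apply, e]

end Pd

namespace IsTest

variable {U V : Set E3} {φ ψ : E3 → ℂ}

theorem mono (h : IsTest U φ) (hUV : U ⊆ V) : IsTest V φ :=
  ⟨h.1, h.2, h.3.trans hUV⟩

theorem pd (h : IsTest U φ) (i : Fin 3) : IsTest U (pd i φ) :=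
  ⟨contDiff_pd h.1 i, h.2.mono' ((subset_tsupport _).trans (tsupport_pd_subset φ i)),
    (tsupport_pd_subset φ i).trans h.3⟩

theorem add (h : IsTest U φ) (h' : IsTest U ψ) : IsTest U (fun x => φ x + ψ x) :=
  ⟨h.1.add h'.1, h.2.add h'.2, (tsupport_add φ ψ).trans (Set.union_subset h.3 h'.3)⟩

theorem zero : IsTest U (fun _ => 0) :=
  ⟨contDiff_const, HasCompactSupport.zero, by simp [tsupport]⟩

theorem sum {ι : Type*} {s : Finset ι} {f : ι → E3 → ℂ} (h : ∀ j ∈ s, IsTest U (f j)) :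
    IsTest U (fun x => ∑ j ∈ s, f j x) := by
  classical
  induction s using Finset.induction_on with
  | empty => simpa using zero
  | insert a s ha ih =>
    simp only [Finset.sum_insert ha]
    exact (h a (by simp)).add (ih fun j hj => h j (by simp [hj]))

theorem smul_of_subset {a : E3 → ℝ} (h : IsTest V φ) (ha : ContDiff ℝ ∞ a)
    (hU : tsupport a ∩ tsupport φ ⊆ U) : IsTest U (fun x => a x • φ x) := by
  have h1 : tsupport (fun x => a x • φ x) ⊆ tsupport a :=
    closure_mono fun x hx hx' => hx (by simp [hx'])
  have h2 : tsupport (fun x => a x • φ x) ⊆ tsupport φ :=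
    closure_mono fun x hx hx' => hx (by simp [hx'])
  exact ⟨ha.smul h.1, h.2.mono' ((subset_tsupport _).trans h2), (Set.subset_inter h1 h2).trans hU⟩

theorem smul {a : E3 → ℝ} (h : IsTest U φ) (ha : ContDiff ℝ ∞ a) : IsTest U (fun x => a x • φ x) :=
  h.smul_of_subset ha (Set.inter_subset_right.trans h.3)

theorem mul (h : IsTest U φ) (hψ : ContDiff ℝ ∞ ψ) : IsTest U (fun x => φ x * ψ x) :=
  ⟨h.1.mul hψ, h.2.mul_right, (closure_mono (Function.support_mul_subset_left _ _)).trans h.3⟩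

theorem const_mul (h : IsTest U φ) (c : ℂ) : IsTest U (fun x => c * φ x) := by
  simpa [mul_comm] using h.mul (contDiff_const (c := c))

theorem neg (h : IsTest U φ) : IsTest U (fun x => - φ x) := by
  simpa using h.const_mul (-1)

theorem conj (h : IsTest U φ) : IsTest U (fun x => (starRingEnd ℂ) (φ x)) :=
  ⟨Complex.conjCLE.contDiff.comp h.1, h.2.comp_left (map_zero _),
    (closure_mono (Function.support_comp_subset (map_zero (starRingEnd ℂ)) φ)).trans h.3⟩

theorem continuous (h : IsTest U φ) : Continuous φ := h.1.continuous

theorem memLp (h : IsTest U φ) (p : ℝ≥0∞) (μ : Measure E3) [IsFiniteMeasureOnCompacts μ] :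
    MemLp φ p μ := h.continuous.memLp_of_hasCompactSupport h.2

theorem eq_zero (h : IsTest U φ) {x : E3} (hx : x ∉ U) : φ x = 0 :=
  image_eq_zero_of_notMem_tsupport fun hx' => hx (h.3 hx')

/-- The bundled test function. -/
def bundle {U : Opens E3} {φ : E3 → ℂ} (h : IsTest U φ) : 𝓓(U, ℂ) := ⟨φ, h.1, h.2, h.3⟩

@[simp] theorem coe_bundle {U : Opens E3} {φ : E3 → ℂ} (h : IsTest U φ) : ⇑h.bundle = φ := rfl

end IsTest

theorem pd_conj {φ : E3 → ℂ} (h : ContDiff ℝ ∞ φ) (i : Fin 3) (x : E3) :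
    pd i (fun y => (starRingEnd ℂ) (φ y)) x = (starRingEnd ℂ) (pd i φ x) := by
  simp only [pd]
  have := (Complex.conjCLE.toContinuousLinearMap.hasFDerivAt (x := φ x)).comp x
    (differentiable_of_smooth h x).hasFDerivAt
  have h2 : HasFDerivAt (fun y => (starRingEnd ℂ) (φ y)) _ x := this
  rw [h2.fderiv]; rfl

theorem isTest_coe {U : Opens E3} (φ : 𝓓(U, ℂ)) : IsTest (U : Set E3) φ :=
  ⟨φ.contDiff, φ.hasCompactSupport, φ.tsupport_subset⟩

theorem coe_lineDeriv {U : Opens E3} (φ : 𝓓(U, ℂ)) (i : Fin 3) : ⇑(∂_{e i} φ : 𝓓(U, ℂ)) = pd i φ := by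
  ext x
  rw [TestFunction.lineDerivOp_eq_lineDerivCLM ℝ, TestFunction.lineDerivCLM_apply_of_le (by simp),
    (φ.contDiff.differentiable (by simp)).differentiableAt.lineDeriv_eq_fderiv]
  rfl

theorem hasWeakPartial_iff {U : Opens E3} {i : Fin 3} {u g : L2 U} :
    HasWeakPartial i u g ↔ ∀ φ : E3 → ℂ, IsTest (U : Set E3) φ →
      ∫ x in (U : Set E3), u x * pd i φ x = -∫ x in (U : Set E3), g x * φ x := by
  constructor
  · intro h φ hφ
    simpa [coe_lineDeriv] using h hφ.bundle
  · intro h φ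
    simpa [coe_lineDeriv] using h φ (isTest_coe φ)

theorem hasWeakLaplacian_iff {U : Opens E3} {u g : L2 U} :
    HasWeakLaplacian u g ↔ ∀ φ : E3 → ℂ, IsTest (U : Set E3) φ →
      ∫ x in (U : Set E3), u x * (∑ i, pd i (pd i φ) x) = ∫ x in (U : Set E3), g x * φ x := by
  constructor
  · intro h φ hφ
    simpa [coe_lineDeriv] using h hφ.bundle
  · intro h φ
    simpa [coe_lineDeriv] using h φ (isTest_coe φ)

/-! ### Sobolev functions on a set, together with their gradients -/

/-- The `H¹` norm of a function with gradient `g`. -/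
def h1norm (U : Set E3) (u : E3 → ℂ) (g : Fin 3 → E3 → ℂ) : ℝ≥0∞ :=
  eLpNorm u 2 (volume.restrict U) + ∑ i, eLpNorm (g i) 2 (volume.restrict U)

/-- `u ∈ H¹(U)` with weak gradient `g`. -/
structure IsW1 (U : Set E3) (u : E3 → ℂ) (g : Fin 3 → E3 → ℂ) : Prop where
  memLp : MemLp u 2 (volume.restrict U)
  memLp_grad : ∀ i, MemLp (g i) 2 (volume.restrict U)
  weak : ∀ i, ∀ φ : E3 → ℂ, IsTest U φ → ∫ x in U, u x * pd i φ x = -∫ x in U, g i x * φ x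

/-- `u ∈ H¹₀(U)` with weak gradient `g`. -/
structure IsW10 (U : Set E3) (u : E3 → ℂ) (g : Fin 3 → E3 → ℂ) : Prop extends IsW1 U u g where
  approx : ∀ δ : ℝ≥0∞, 0 < δ → ∃ φ, IsTest U φ ∧
    h1norm U (fun x => u x - φ x) (fun i x => g i x - pd i φ x) ≤ δ

theorem eLpNorm_le_h1norm (U : Set E3) (u : E3 → ℂ) (g : Fin 3 → E3 → ℂ) :
    eLpNorm u 2 (volume.restrict U) ≤ h1norm U u g := le_self_add

theorem eLpNorm_grad_le_h1norm (U : Set E3) (u : E3 → ℂ) (g : Fin 3 → E3 → ℂ) (i : Fin 3) :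
    eLpNorm (g i) 2 (volume.restrict U) ≤ h1norm U u g :=
  (Finset.single_le_sum (f := fun i => eLpNorm (g i) 2 (volume.restrict U))
    (fun _ _ => zero_le) (Finset.mem_univ i)).trans le_add_self

theorem h1norm_le {U : Set E3} {u : E3 → ℂ} {g : Fin 3 → E3 → ℂ} {δ : ℝ≥0∞}
    (h : eLpNorm u 2 (volume.restrict U) ≤ δ) (hg : ∀ i, eLpNorm (g i) 2 (volume.restrict U) ≤ δ) :
    h1norm U u g ≤ 4 * δ := by
  unfold h1norm
  calc _ ≤ δ + ∑ _i : Fin 3, δ := by gcongr with i; exact hg i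
    _ = 4 * δ := by simp; ring

theorem h1norm_mono_set {U V : Set E3} (h : U ⊆ V) (u : E3 → ℂ) (g : Fin 3 → E3 → ℂ) :
    h1norm U u g ≤ h1norm V u g := by
  unfold h1norm
  gcongr

theorem h1norm_congr {U : Set E3} {u v : E3 → ℂ} {g h : Fin 3 → E3 → ℂ}
    (huv : u =ᵐ[volume.restrict U] v) (hgh : ∀ i, g i =ᵐ[volume.restrict U] h i) :
    h1norm U u g = h1norm U v h := by
  unfold h1norm
  rw [eLpNorm_congr_ae huv]
  simp_rw [eLpNorm_congr_ae (hgh _)]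

theorem h1norm_add_le {U : Set E3} {u v : E3 → ℂ} {g h : Fin 3 → E3 → ℂ}
    (hu : AEStronglyMeasurable u (volume.restrict U)) (hv : AEStronglyMeasurable v (volume.restrict U))
    (hg : ∀ i, AEStronglyMeasurable (g i) (volume.restrict U))
    (hh : ∀ i, AEStronglyMeasurable (h i) (volume.restrict U)) :
    h1norm U (fun x => u x + v x) (fun i x => g i x + h i x) ≤ h1norm U u g + h1norm U v h := by
  unfold h1norm
  calc _ ≤ (eLpNorm u 2 (volume.restrict U) + eLpNorm v 2 (volume.restrict U)) +
        ∑ i, (eLpNorm (g i) 2 (volume.restrict U) + eLpNorm (h i) 2 (volume.restrict U)) := by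
        gcongr with i
        · exact eLpNorm_add_le hu hv (by norm_num)
        · exact eLpNorm_add_le (hg i) (hh i) (by norm_num)
    _ = _ := by rw [Finset.sum_add_distrib]; ring

theorem enorm_integral_mul_le {μ : Measure E3} {f g : E3 → ℂ} (hf : AEStronglyMeasurable f μ)
    (hg : AEStronglyMeasurable g μ) : ‖∫ x, f x * g x ∂μ‖ₑ ≤ eLpNorm f 2 μ * eLpNorm g 2 μ := by
  calc _ ≤ ∫⁻ x, ‖f x * g x‖ₑ ∂μ := enorm_integral_le_lintegral_enorm _
    _ = eLpNorm (f • g) 1 μ := by rw [eLpNorm_one_eq_lintegral_enorm]; rfl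
    _ ≤ _ := eLpNorm_smul_le_mul_eLpNorm (p := 2) (q := 2) (r := 1) hg hf

theorem memLp_smul_of_bound {μ : Measure E3} {a : E3 → ℝ} {u : E3 → ℂ} {C : ℝ} (ha : Continuous a)
    (hC : ∀ x, |a x| ≤ C) (hu : MemLp u 2 μ) : MemLp (fun x => a x • u x) 2 μ := by
  refine hu.of_le_mul (c := C) (ha.aestronglyMeasurable.smul hu.aestronglyMeasurable) ?_
  filter_upwards with x
  rw [norm_smul]
  gcongr
  exact hC x

theorem eLpNorm_smul_le_of_bound {μ : Measure E3} {a : E3 → ℝ} {u : E3 → ℂ} {C : ℝ}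
    (hC : ∀ x, |a x| ≤ C) :
    eLpNorm (fun x => a x • u x) 2 μ ≤ ENNReal.ofReal C * eLpNorm u 2 μ := by
  refine eLpNorm_le_mul_eLpNorm_of_ae_le_mul (.of_forall fun x => ?_) 2
  rw [norm_smul]
  gcongr
  exact hC x

theorem integrable_mul_test {U V : Set E3} {u φ : E3 → ℂ} (hu : MemLp u 2 (volume.restrict U))
    (hφ : IsTest V φ) : Integrable (fun x => u x * φ x) (volume.restrict U) :=
  hu.integrable_mul (hφ.memLp 2 _)

/-- One support inside `W` is enough: both products then vanish off `W`, so the integrals are over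
ℝ³ and there is no boundary term. -/
theorem integral_test_mul_pd {U V W : Set E3} {φ ψ : E3 → ℂ} (hφ : IsTest U φ) (hψ : IsTest V ψ)
    (hW : U ⊆ W ∨ V ⊆ W) (i : Fin 3) :
    ∫ x in W, φ x * pd i ψ x = -∫ x in W, pd i φ x * ψ x := by
  have h0 : ∀ x ∉ W, (φ x = 0 ∧ pd i φ x = 0) ∨ (ψ x = 0 ∧ pd i ψ x = 0) := by
    intro x hx
    rcases hW with h | h
    · exact .inl ⟨hφ.eq_zero fun h' => hx (h h'), (hφ.pd i).eq_zero fun h' => hx (h h')⟩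
    · exact .inr ⟨hψ.eq_zero fun h' => hx (h h'), (hψ.pd i).eq_zero fun h' => hx (h h')⟩
  rw [setIntegral_eq_integral_of_forall_compl_eq_zero, setIntegral_eq_integral_of_forall_compl_eq_zero]
  · exact integral_mul_fderiv_eq_neg_fderiv_mul_of_integrable
      (((hφ.pd i).memLp 2 _).integrable_mul (hψ.memLp 2 _))
      ((hφ.memLp 2 _).integrable_mul ((hψ.pd i).memLp 2 _))
      ((hφ.memLp 2 _).integrable_mul (hψ.memLp 2 _))
      (fun x _ => differentiable_of_smooth hφ.1 x) (fun x _ => differentiable_of_smooth hψ.1 x)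
  · intro x hx; rcases h0 x hx with h | h <;> simp [h]
  · intro x hx; rcases h0 x hx with h | h <;> simp [h]

theorem isW1_of_isTest {U V : Set E3} {φ : E3 → ℂ} (hφ : IsTest V φ) :
    IsW1 U φ (fun i => pd i φ) :=
  ⟨hφ.memLp 2 _, fun i => (hφ.pd i).memLp 2 _, fun i _ hψ =>
    integral_test_mul_pd hφ hψ (.inr subset_rfl) i⟩

/-- If `u` and `g` are limits of test functions and their derivatives, for which integration by parts
against `ψ` holds in the limit, then it holds for `u` and `g`. -/
theorem weak_of_approx {U : Set E3} {u g ψ : E3 → ℂ} {i : Fin 3} (hψ : IsTest Set.univ ψ)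
    (hu : MemLp u 2 (volume.restrict U)) (hg : MemLp g 2 (volume.restrict U)) {C : ℝ≥0∞} (hC : C ≠ ⊤)
    (h : ∀ δ : ℝ≥0∞, 0 < δ → ∃ φ, IsTest Set.univ φ ∧
      eLpNorm (fun x => u x - φ x) 2 (volume.restrict U) ≤ δ ∧
      eLpNorm (fun x => g x - pd i φ x) 2 (volume.restrict U) ≤ δ ∧
      ‖∫ x in U, (φ x * pd i ψ x + pd i φ x * ψ x)‖ₑ ≤ C * δ) :
    ∫ x in U, u x * pd i ψ x = -∫ x in U, g x * ψ x := by
  set μ := (volume : Measure E3).restrict U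
  -- `K * δ` bounds the defect in the integration by parts: two Cauchy–Schwarz errors and the defect
  -- `C * δ` of the approximating test function. As `K` is finite and `δ` arbitrary, the defect is
  -- zero.
  set K : ℝ≥0∞ := eLpNorm (pd i ψ) 2 μ + eLpNorm ψ 2 μ + C
  have hK : K ≠ ⊤ := by
    simp only [K, ne_eq, ENNReal.add_eq_top, not_or]
    exact ⟨⟨((hψ.pd i).memLp 2 μ).eLpNorm_ne_top, (hψ.memLp 2 μ).eLpNorm_ne_top⟩, hC⟩
  rw [← add_eq_zero_iff_eq_neg, ← integral_add (integrable_mul_test hu (hψ.pd i))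
    (integrable_mul_test hg hψ), ← enorm_eq_zero]
  suffices H : ∀ δ : ℝ≥0∞, 0 < δ → ‖∫ x, (u x * pd i ψ x + g x * ψ x) ∂μ‖ₑ ≤ K * δ by
    by_contra hne
    have hlt : 0 < ‖∫ x, (u x * pd i ψ x + g x * ψ x) ∂μ‖ₑ := pos_iff_ne_zero.2 hne
    obtain ⟨δ, hδ, hδ'⟩ : ∃ δ : ℝ≥0∞, 0 < δ ∧
        K * δ < ‖∫ x, (u x * pd i ψ x + g x * ψ x) ∂μ‖ₑ := by
      have ht : Filter.Tendsto (fun δ : ℝ≥0∞ => K * δ) (nhds 0) (nhds (K * 0)) :=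
        ENNReal.Tendsto.const_mul Filter.tendsto_id (.inr hK)
      rw [mul_zero] at ht
      have := (ht.eventually_lt_const hlt).filter_mono (nhdsWithin_le_nhds (s := Set.Ioi 0))
      obtain ⟨δ, h1, h2⟩ := (this.and self_mem_nhdsWithin).exists
      exact ⟨δ, h2, h1⟩
    exact absurd (H δ hδ) (not_le.2 hδ')
  intro δ hδ
  obtain ⟨φ, hφ, h1, h2, h3⟩ := h δ hδ
  have hu' : MemLp (fun x => u x - φ x) 2 μ := hu.sub (hφ.memLp 2 μ)
  have hg' : MemLp (fun x => g x - pd i φ x) 2 μ := hg.sub ((hφ.pd i).memLp 2 μ)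
  have i1 := integrable_mul_test hu' (hψ.pd i)
  have i2 := integrable_mul_test hg' hψ
  have i3 := (integrable_mul_test (hφ.memLp 2 μ) (hψ.pd i)).add
    (integrable_mul_test ((hφ.pd i).memLp 2 μ) hψ)
  have e1 : ∫ x, (u x * pd i ψ x + g x * ψ x) ∂μ =
      ∫ x, (u x - φ x) * pd i ψ x ∂μ + ∫ x, (g x - pd i φ x) * ψ x ∂μ +
      ∫ x, (φ x * pd i ψ x + pd i φ x * ψ x) ∂μ := by
    rw [← integral_add i1 i2]
    refine Eq.trans ?_ (integral_add (i1.add i2) i3)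
    congr 1; ext x; ring
  rw [e1]
  calc _ ≤ ‖∫ x, (u x - φ x) * pd i ψ x ∂μ‖ₑ + ‖∫ x, (g x - pd i φ x) * ψ x ∂μ‖ₑ +
      ‖∫ x, (φ x * pd i ψ x + pd i φ x * ψ x) ∂μ‖ₑ :=
        (enorm_add_le _ _).trans (by gcongr; exact enorm_add_le _ _)
    _ ≤ δ * eLpNorm (pd i ψ) 2 μ + δ * eLpNorm ψ 2 μ + C * δ := by
        gcongr
        · exact (enorm_integral_mul_le hu'.1 ((hψ.pd i).memLp 2 μ).1).trans (by gcongr)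
        · exact (enorm_integral_mul_le hg'.1 (hψ.memLp 2 μ).1).trans (by gcongr)
    _ = K * δ := by ring

/-! ### Calculus of Sobolev functions -/

section W1

variable {U V : Set E3} {u v : E3 → ℂ} {g h : Fin 3 → E3 → ℂ}

theorem integral_mul_congr {μ : Measure E3} (huv : u =ᵐ[μ] v) (φ : E3 → ℂ) :
    ∫ x, u x * φ x ∂μ = ∫ x, v x * φ x ∂μ :=
  integral_congr_ae (huv.mul (ae_eq_refl φ))

theorem IsW1.congr (hu : IsW1 U u g) (huv : u =ᵐ[volume.restrict U] v)
    (hgh : ∀ i, g i =ᵐ[volume.restrict U] h i) : IsW1 U v h := by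
  refine ⟨hu.1.ae_eq huv, fun i => (hu.2 i).ae_eq (hgh i), fun i φ hφ => ?_⟩
  rw [← integral_mul_congr huv, ← integral_mul_congr (hgh i), hu.3 i φ hφ]

theorem IsW10.congr (hu : IsW10 U u g) (huv : u =ᵐ[volume.restrict U] v)
    (hgh : ∀ i, g i =ᵐ[volume.restrict U] h i) : IsW10 U v h := by
  refine ⟨hu.toIsW1.congr huv hgh, fun δ hδ => ?_⟩
  obtain ⟨φ, hφ, h1⟩ := hu.approx δ hδ
  refine ⟨φ, hφ, ?_⟩
  exact (h1norm_congr (huv.sub (ae_eq_refl φ))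
    (fun i => (hgh i).sub (ae_eq_refl (pd i φ)))).ge.trans h1

theorem IsW1.add (hu : IsW1 U u g) (hv : IsW1 U v h) :
    IsW1 U (fun x => u x + v x) (fun i x => g i x + h i x) := by
  refine ⟨hu.1.add hv.1, fun i => (hu.2 i).add (hv.2 i), fun i φ hφ => ?_⟩
  simp_rw [add_mul]
  rw [integral_add (integrable_mul_test hu.1 (hφ.pd i)) (integrable_mul_test hv.1 (hφ.pd i)),
    integral_add (integrable_mul_test (hu.2 i) hφ) (integrable_mul_test (hv.2 i) hφ),
    hu.3 i φ hφ, hv.3 i φ hφ]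
  ring

theorem IsW1.const_mul (hu : IsW1 U u g) (c : ℂ) :
    IsW1 U (fun x => c * u x) (fun i x => c * g i x) := by
  refine ⟨hu.1.const_mul c, fun i => (hu.2 i).const_mul c, fun i φ hφ => ?_⟩
  simp_rw [mul_assoc]
  rw [integral_const_mul, integral_const_mul, hu.3 i φ hφ]
  ring

theorem IsW1.sub (hu : IsW1 U u g) (hv : IsW1 U v h) :
    IsW1 U (fun x => u x - v x) (fun i x => g i x - h i x) := by
  simpa [sub_eq_add_neg] using hu.add (hv.const_mul (-1))

theorem h1norm_const_mul (U : Set E3) (u : E3 → ℂ) (g : Fin 3 → E3 → ℂ) (c : ℂ) :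
    h1norm U (fun x => c * u x) (fun i x => c * g i x) = ‖c‖ₑ * h1norm U u g := by
  unfold h1norm
  have : ∀ w : E3 → ℂ, eLpNorm (fun x => c * w x) 2 (volume.restrict U) =
      ‖c‖ₑ * eLpNorm w 2 (volume.restrict U) := fun w => eLpNorm_const_smul c w 2 _
  simp_rw [this, mul_add, Finset.mul_sum]

/-- A function in `H¹` that is approximated by elements of `H¹₀` is in `H¹₀`. -/
theorem IsW10.of_approx (hu : IsW1 U u g)
    (H : ∀ δ : ℝ≥0∞, 0 < δ → ∃ v h, IsW10 U v h ∧
      h1norm U (fun x => u x - v x) (fun i x => g i x - h i x) ≤ δ) : IsW10 U u g := by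
  refine ⟨hu, fun δ hδ => ?_⟩
  obtain ⟨v, h, hv, h1⟩ := H (δ / 2) (ENNReal.half_pos hδ.ne')
  obtain ⟨φ, hφ, h2⟩ := hv.approx (δ / 2) (ENNReal.half_pos hδ.ne')
  refine ⟨φ, hφ, ?_⟩
  have hw := isW1_of_isTest (U := U) hφ
  have := h1norm_add_le (hu.sub hv.toIsW1).1.1 (hv.toIsW1.sub hw).1.1
    (fun i => ((hu.sub hv.toIsW1).2 i).1) (fun i => ((hv.toIsW1.sub hw).2 i).1)
  simp only [sub_add_sub_cancel] at this
  exact this.trans ((add_le_add h1 h2).trans_eq (ENNReal.add_halves δ))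

theorem isW10_of_isTest {φ : E3 → ℂ} (hφ : IsTest U φ) : IsW10 U φ (fun i => pd i φ) :=
  ⟨isW1_of_isTest hφ, fun δ _ => ⟨φ, hφ, by simp [h1norm]⟩⟩

theorem IsW10.add (hu : IsW10 U u g) (hv : IsW10 U v h) :
    IsW10 U (fun x => u x + v x) (fun i x => g i x + h i x) := by
  refine ⟨hu.toIsW1.add hv.toIsW1, fun δ hδ => ?_⟩
  obtain ⟨φ, hφ, h1⟩ := hu.approx (δ / 2) (ENNReal.half_pos hδ.ne')
  obtain ⟨ψ, hψ, h2⟩ := hv.approx (δ / 2) (ENNReal.half_pos hδ.ne')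
  refine ⟨_, hφ.add hψ, ?_⟩
  have k1 := hu.toIsW1.sub (isW1_of_isTest (U := U) hφ)
  have k2 := hv.toIsW1.sub (isW1_of_isTest (U := U) hψ)
  have := h1norm_add_le k1.1.1 k2.1.1 (fun i => (k1.2 i).1) (fun i => (k2.2 i).1)
  simp only [pd_add hφ.1 hψ.1, add_sub_add_comm]
  exact this.trans ((add_le_add h1 h2).trans_eq (ENNReal.add_halves δ))

theorem IsW10.const_mul (hu : IsW10 U u g) (c : ℂ) :
    IsW10 U (fun x => c * u x) (fun i x => c * g i x) := by
  refine ⟨hu.toIsW1.const_mul c, fun δ hδ => ?_⟩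
  obtain ⟨φ, hφ, h1⟩ := hu.approx (δ / (‖c‖ₑ + 1)) (ENNReal.div_pos hδ.ne' (by simp))
  refine ⟨_, hφ.const_mul c, ?_⟩
  simp only [pd_const_mul hφ.1, ← mul_sub]
  rw [h1norm_const_mul]
  calc _ ≤ (‖c‖ₑ + 1) * (δ / (‖c‖ₑ + 1)) := by gcongr; exact le_self_add
    _ ≤ δ := ENNReal.mul_div_le

theorem IsW10.sub (hu : IsW10 U u g) (hv : IsW10 U v h) :
    IsW10 U (fun x => u x - v x) (fun i x => g i x - h i x) := by
  simpa [sub_eq_add_neg] using hu.add (hv.const_mul (-1))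

theorem IsW10.zero : IsW10 U (fun _ => 0) (fun _ _ => 0) := by
  have h0 : ∀ i, pd i (fun _ : E3 => (0 : ℂ)) = fun _ => 0 := fun i => by ext x; simp [pd]
  simpa only [h0] using isW10_of_isTest (IsTest.zero (U := U))

theorem IsW10.sum {ι : Type*} {s : Finset ι} {u : ι → E3 → ℂ} {g : ι → Fin 3 → E3 → ℂ}
    (hu : ∀ j ∈ s, IsW10 U (u j) (g j)) :
    IsW10 U (fun x => ∑ j ∈ s, u j x) (fun i x => ∑ j ∈ s, g j i x) := by
  classical
  induction s using Finset.induction_on with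
  | empty => simpa using IsW10.zero
  | insert a s ha ih =>
    simp only [Finset.sum_insert ha]
    exact (hu a (by simp)).add (ih fun j hj => hu j (by simp [hj]))

theorem setIntegral_subset_mul {U V : Set E3} (hUV : U ⊆ V) (f : E3 → ℂ) {φ : E3 → ℂ}
    (hφ : IsTest U φ) : ∫ x in V, f x * φ x = ∫ x in U, f x * φ x := by
  rw [setIntegral_eq_integral_of_forall_compl_eq_zero,
    setIntegral_eq_integral_of_forall_compl_eq_zero]
  · intro x hx; simp [hφ.eq_zero hx]
  · intro x hx; simp [hφ.eq_zero fun h => hx (hUV h)]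

theorem IsW1.mono_set (hu : IsW1 V u g) (hUV : U ⊆ V) : IsW1 U u g := by
  refine ⟨hu.1.mono_measure (Measure.restrict_mono hUV le_rfl),
    fun i => (hu.2 i).mono_measure (Measure.restrict_mono hUV le_rfl), fun i φ hφ => ?_⟩
  rw [← setIntegral_subset_mul hUV _ (hφ.pd i), ← setIntegral_subset_mul hUV _ hφ]
  exact hu.3 i φ (hφ.mono hUV)

theorem setIntegral_univ_indicator_mul (hU : MeasurableSet U) (f φ : E3 → ℂ) :
    ∫ x in Set.univ, U.indicator f x * φ x = ∫ x in U, f x * φ x := by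
  rw [Measure.restrict_univ, ← integral_indicator hU]
  congr 1; ext x
  by_cases hx : x ∈ U <;> simp [hx]

theorem memLp_univ_indicator (hU : MeasurableSet U) {f : E3 → ℂ} (hf : MemLp f 2 (volume.restrict U)) :
    MemLp (U.indicator f) 2 (volume.restrict Set.univ) := by
  rw [Measure.restrict_univ]
  exact (memLp_indicator_iff_restrict hU).2 hf

/-- Extension by zero of a function in `H¹₀`. -/
theorem IsW10.indicator (hU : MeasurableSet U) (hu : IsW10 U u g) :
    IsW1 Set.univ (U.indicator u) (fun i => U.indicator (g i)) := by
  refine ⟨memLp_univ_indicator hU hu.1.1, fun i => memLp_univ_indicator hU (hu.1.2 i),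
    fun i ψ hψ => ?_⟩
  rw [setIntegral_univ_indicator_mul hU, setIntegral_univ_indicator_mul hU]
  refine weak_of_approx hψ hu.1.1 (hu.1.2 i) (C := 0) (by simp) fun δ hδ => ?_
  obtain ⟨φ, hφ, h1⟩ := hu.approx δ hδ
  refine ⟨φ, hφ.mono (Set.subset_univ _), (eLpNorm_le_h1norm _ _ _).trans h1,
    (eLpNorm_grad_le_h1norm U _ (fun i x => g i x - pd i φ x) i).trans h1, ?_⟩
  rw [integral_add (integrable_mul_test (hφ.memLp 2 _) (hψ.pd i))
    (integrable_mul_test ((hφ.pd i).memLp 2 _) hψ), integral_test_mul_pd hφ hψ (.inl subset_rfl)]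
  simp

/-- A smooth function that is bounded together with its first derivatives. -/
structure IsMultiplier (a : E3 → ℝ) : Prop where
  contDiff : ContDiff ℝ ∞ a
  bound : ∃ C, ∀ x, |a x| ≤ C
  bound_pd : ∃ C, ∀ i x, |pd i a x| ≤ C

theorem IsMultiplier.of_hasCompactSupport {a : E3 → ℝ} (ha : ContDiff ℝ ∞ a)
    (hc : HasCompactSupport a) : IsMultiplier a := by
  refine ⟨ha, hc.exists_bound_of_continuous ha.continuous, ?_⟩
  have := fun i : Fin 3 => (hc.mono' ((subset_tsupport _).trans
    (tsupport_pd_subset a i))).exists_bound_of_continuous (contDiff_pd ha i).continuous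
  choose C hC using this
  refine ⟨∑ i, |C i|, fun i x => (hC i x).trans ((le_abs_self _).trans ?_)⟩
  exact Finset.single_le_sum (f := fun i => |C i|) (fun _ _ => abs_nonneg _) (Finset.mem_univ i)

/-- This is why multipliers need not have compact support: 1 - χ removes a neighbourhood of the
obstacle in the argument at infinity. -/
theorem IsMultiplier.one_sub {a : E3 → ℝ} (ha : IsMultiplier a) : IsMultiplier (fun x => 1 - a x) := by
  obtain ⟨h, ⟨C, hC⟩, ⟨D, hD⟩⟩ := ha
  refine ⟨contDiff_const.sub h, ⟨1 + C, fun x => ?_⟩, ⟨D, fun i x => ?_⟩⟩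
  · exact (abs_sub _ _).trans (by simpa using hC x)
  · rw [pd_sub contDiff_const h]
    simpa [pd] using hD i x

theorem IsMultiplier.memLp {a : E3 → ℝ} (ha : IsMultiplier a) {μ : Measure E3} {w : E3 → ℂ}
    (hw : MemLp w 2 μ) : MemLp (fun x => a x • w x) 2 μ := by
  obtain ⟨h, ⟨C, hC⟩, _⟩ := ha
  exact memLp_smul_of_bound h.continuous hC hw

theorem IsMultiplier.memLp_pd {a : E3 → ℝ} (ha : IsMultiplier a) {μ : Measure E3} {w : E3 → ℂ}
    (hw : MemLp w 2 μ) (i : Fin 3) : MemLp (fun x => pd i a x • w x) 2 μ := by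
  obtain ⟨h, _, ⟨C, hC⟩⟩ := ha
  exact memLp_smul_of_bound (contDiff_pd h i).continuous (hC i) hw

theorem IsW1.smul {a : E3 → ℝ} (hu : IsW1 U u g) (ha : IsMultiplier a) :
    IsW1 U (fun x => a x • u x) (fun i x => a x • g i x + pd i a x • u x) := by
  refine ⟨ha.memLp hu.1, fun i => (ha.memLp (hu.2 i)).add (ha.memLp_pd hu.1 i), fun i φ hφ => ?_⟩
  have h1 := hu.3 i _ (hφ.smul ha.1)
  simp only [pd_smul ha.1 hφ.1] at h1
  have e1 : ∫ x in U, u x * (a x • pd i φ x + pd i a x • φ x) =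
      (∫ x in U, a x • u x * pd i φ x) + ∫ x in U, pd i a x • u x * φ x := by
    rw [← integral_add (integrable_mul_test (ha.memLp hu.1) (hφ.pd i))
      (integrable_mul_test (ha.memLp_pd hu.1 i) hφ)]
    congr 1; ext x; simp only [Complex.real_smul]; ring
  have e2 : ∫ x in U, (a x • g i x + pd i a x • u x) * φ x =
      (∫ x in U, a x • g i x * φ x) + ∫ x in U, pd i a x • u x * φ x := by
    rw [← integral_add (integrable_mul_test (ha.memLp (hu.2 i)) hφ)
      (integrable_mul_test (ha.memLp_pd hu.1 i) hφ)]
    congr 1; ext x; ring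
  have e3 : ∫ x in U, g i x * a x • φ x = ∫ x in U, a x • g i x * φ x := by
    congr 1; ext x; simp only [Complex.real_smul]; ring
  rw [e2, ← e3, neg_add, ← h1, e1]
  ring

/-- Multiplication by a multiplier is bounded on `H¹`. -/
theorem IsMultiplier.h1norm_le {a : E3 → ℝ} (ha : IsMultiplier a) (U : Set E3) :
    ∃ C : ℝ≥0∞, C ≠ ⊤ ∧ ∀ u g, AEStronglyMeasurable u (volume.restrict U) →
      (∀ i, AEStronglyMeasurable (g i) (volume.restrict U)) →
      h1norm U (fun x => a x • u x) (fun i x => a x • g i x + pd i a x • u x) ≤ C * h1norm U u g := by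
  obtain ⟨h, ⟨A, hA⟩, ⟨D, hD⟩⟩ := ha
  refine ⟨4 * (ENNReal.ofReal A + ENNReal.ofReal D), by
    simp [ENNReal.mul_eq_top], fun u g hu hg => ?_⟩
  rw [mul_assoc]
  refine KreinFormula.h1norm_le ?_ fun i => ?_
  · calc _ ≤ ENNReal.ofReal A * eLpNorm u 2 (volume.restrict U) := eLpNorm_smul_le_of_bound hA
      _ ≤ _ := by gcongr; exacts [le_self_add, eLpNorm_le_h1norm _ _ _]
  · calc _ ≤ eLpNorm (fun x => a x • g i x) 2 (volume.restrict U) +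
          eLpNorm (fun x => pd i a x • u x) 2 (volume.restrict U) :=
          eLpNorm_add_le (h.continuous.aestronglyMeasurable.smul (hg i))
            ((contDiff_pd h i).continuous.aestronglyMeasurable.smul hu) (by norm_num)
      _ ≤ ENNReal.ofReal A * h1norm U u g + ENNReal.ofReal D * h1norm U u g := by
          gcongr
          · exact (eLpNorm_smul_le_of_bound hA).trans
              (by gcongr; exact eLpNorm_grad_le_h1norm _ _ _ i)
          · exact (eLpNorm_smul_le_of_bound (hD i)).trans
              (by gcongr; exact eLpNorm_le_h1norm _ _ _)
      _ = _ := by ring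

/-- The Leibniz rule for the weak Laplacian. -/
theorem integral_smul_mul_laplacian {a : E3 → ℝ} {f φ : E3 → ℂ} (hu : IsW1 U u g)
    (ha : IsMultiplier a) (hf : MemLp f 2 (volume.restrict U))
    (hΔ : ∀ φ : E3 → ℂ, IsTest U φ →
      ∫ x in U, u x * (∑ i, pd i (pd i φ) x) = ∫ x in U, f x * φ x)
    (hφ : IsTest V φ) (hU : tsupport a ∩ tsupport φ ⊆ U) :
    ∫ x in U, a x • u x * (∑ i, pd i (pd i φ) x) =
      ∫ x in U, (a x • f x + (∑ i, pd i (pd i a) x) • u x + 2 * ∑ i, pd i a x • g i x) * φ x := by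
  -- `φ` itself may reach outside `U`. Only its products with `a` and the derivatives of `a` are
  -- used as test functions, and these are supported in `U`.
  have haφ : IsTest U (fun x => a x • φ x) := hφ.smul_of_subset ha.1 hU
  have hpφ : ∀ i, IsTest U (fun x => pd i a x • φ x) := fun i =>
    hφ.smul_of_subset (contDiff_pd ha.1 i)
      ((Set.inter_subset_inter_left _ (tsupport_pd_subset a i)).trans hU)
  have hppφ : ∀ i, IsTest U (fun x => pd i (pd i a) x • φ x) := fun i =>
    hφ.smul_of_subset (contDiff_pd (contDiff_pd ha.1 i) i)
      ((Set.inter_subset_inter_left _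
        ((tsupport_pd_subset _ i).trans (tsupport_pd_subset a i))).trans hU)
  have d2 : ∀ i x, pd i (pd i (fun y => a y • φ y)) x =
      a x • pd i (pd i φ) x + (pd i a x • pd i φ x + pd i (fun y => pd i a y • φ y) x) := by
    intro i x
    have : pd i (fun y => a y • φ y) = fun y => a y • pd i φ y + pd i a y • φ y :=
      funext fun y => pd_smul ha.1 hφ.1 i y
    rw [this, pd_add (f := fun y => a y • pd i φ y) (g := fun y => pd i a y • φ y)
      (ha.1.smul (contDiff_pd hφ.1 i)) ((contDiff_pd ha.1 i).smul hφ.1), pd_smul ha.1 (contDiff_pd hφ.1 i), add_assoc]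
  have d1 : ∀ i x, pd i (fun y => pd i a y • φ y) x =
      pd i a x • pd i φ x + pd i (pd i a) x • φ x := fun i x =>
    pd_smul (contDiff_pd ha.1 i) hφ.1 i x
  -- The identity a Δφ = Δ(aφ) - 2 div(φ∇a) + φΔa. The first term is handled by the weak Laplacian
  -- of `u`, the second by its weak gradient.
  have key : ∀ x, a x • u x * (∑ i, pd i (pd i φ) x) =
      u x * (∑ i, pd i (pd i (fun y => a y • φ y)) x) -
        ∑ i, (2 * (u x * pd i (fun y => pd i a y • φ y) x) - u x * (pd i (pd i a) x • φ x)) := by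
    intro x
    simp only [d2, d1]
    simp only [Complex.real_smul, Fin.sum_univ_three]
    ring
  simp_rw [key]
  have I1 : Integrable (fun x => u x * (∑ i, pd i (pd i (fun y => a y • φ y)) x))
      (volume.restrict U) :=
    integrable_mul_test hu.1 (IsTest.sum fun i _ => (haφ.pd i).pd i)
  have I2 : ∀ i, Integrable (fun x => 2 * (u x * pd i (fun y => pd i a y • φ y) x))
      (volume.restrict U) := fun i =>
    (integrable_mul_test hu.1 ((hpφ i).pd i)).const_mul 2
  have I3 : ∀ i, Integrable (fun x => u x * (pd i (pd i a) x • φ x)) (volume.restrict U) :=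
    fun i => integrable_mul_test hu.1 (hppφ i)
  have I4 : ∀ i, Integrable (fun x => g i x * (pd i a x • φ x)) (volume.restrict U) :=
    fun i => integrable_mul_test (hu.2 i) (hpφ i)
  have I5 : ∀ i, Integrable (fun x => 2 * (u x * pd i (fun y => pd i a y • φ y) x) -
      u x * (pd i (pd i a) x • φ x)) (volume.restrict U) := fun i => (I2 i).sub (I3 i)
  rw [integral_sub I1 (integrable_finsetSum _ fun i _ => I5 i),
    integral_finsetSum _ fun i _ => I5 i, hΔ _ haφ]
  have e1 : ∀ x, (a x • f x + (∑ i, pd i (pd i a) x) • u x + 2 * ∑ i, pd i a x • g i x) * φ x =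
      f x * (a x • φ x) + ∑ i, (u x * (pd i (pd i a) x • φ x) + 2 * (g i x * (pd i a x • φ x))) := by
    intro x
    simp only [Complex.real_smul, Fin.sum_univ_three]
    push_cast
    ring
  simp_rw [e1]
  rw [integral_add (integrable_mul_test hf haφ)
      (integrable_finsetSum _ fun i _ => (I3 i).fun_add ((I4 i).const_mul 2)),
    integral_finsetSum _ fun i _ => (I3 i).fun_add ((I4 i).const_mul 2), sub_eq_add_neg,
    ← Finset.sum_neg_distrib]
  congr 1
  refine Finset.sum_congr rfl fun i _ => ?_
  rw [integral_sub (I2 i) (I3 i), integral_add (I3 i) ((I4 i).const_mul 2), integral_const_mul,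
    integral_const_mul, hu.3 i _ (hpφ i)]
  ring

end W1

/-! ### Comparison with the Sobolev spaces of `L²` classes -/

section Bridge

variable {U : Opens E3} {u v : L2 U} {g : Fin 3 → E3 → ℂ}

theorem hasWeakPartial_weakPartial (hu : MemH1 u) (i : Fin 3) :
    HasWeakPartial i u (weakPartial i u) := by
  rw [weakPartial, dif_pos (hu i)]
  exact (hu i).choose_spec

theorem MemH1.isW1 (hu : MemH1 u) : IsW1 (U : Set E3) u (fun i => weakPartial i u) :=
  ⟨Lp.memLp u, fun _ => Lp.memLp _, fun i =>
    hasWeakPartial_iff.1 (hasWeakPartial_weakPartial hu i)⟩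

theorem IsW1.hasWeakPartial (hu : IsW1 (U : Set E3) u g) (i : Fin 3) :
    HasWeakPartial i u ((hu.2 i).toLp) := by
  rw [hasWeakPartial_iff]
  intro φ hφ
  rw [hu.3 i φ hφ]
  congr 1
  refine integral_congr_ae ?_
  filter_upwards [(hu.2 i).coeFn_toLp] with x hx
  rw [hx]

theorem IsW1.memH1 (hu : IsW1 (U : Set E3) u g) : MemH1 u := fun i => ⟨_, hu.hasWeakPartial i⟩

theorem IsW1.weakPartial_ae_eq (hu : IsW1 (U : Set E3) u g) (i : Fin 3) :
    weakPartial i u =ᵐ[volume.restrict (U : Set E3)] g i := by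
  rw [(hasWeakPartial_weakPartial hu.memH1 i).unique (hu.hasWeakPartial i)]
  exact (hu.2 i).coeFn_toLp

theorem h1norm_le_of_h1Close {V : Opens E3} {φ : 𝓓(V, ℂ)} {δ : ℝ≥0∞} (h : H1Close u φ δ) :
    h1norm U (fun x => u x - φ x) (fun i x => weakPartial i u x - pd i φ x) ≤ 4 * δ :=
  h1norm_le h.1 fun i => by simpa [coe_lineDeriv] using h.2 i

theorem h1Close_of_h1norm_le {V : Opens E3} {φ : 𝓓(V, ℂ)} {δ : ℝ≥0∞}
    (h : h1norm U (fun x => u x - φ x) (fun i x => weakPartial i u x - pd i φ x) ≤ δ) :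
    H1Close u φ δ := by
  refine ⟨(eLpNorm_le_h1norm _ _ _).trans h, fun i => ?_⟩
  rw [coe_lineDeriv]
  exact (eLpNorm_grad_le_h1norm (U : Set E3) _ (fun i x => weakPartial i u x - pd i φ x) i).trans h

theorem exists_four_mul_le {δ : ℝ≥0∞} (hδ : 0 < δ) : ∃ η : ℝ≥0∞, 0 < η ∧ 4 * η ≤ δ :=
  ⟨δ / 4, ENNReal.div_pos hδ.ne' (by simp), ENNReal.mul_div_le⟩

theorem MemH10.isW10 (hu : MemH10 u) : IsW10 (U : Set E3) u (fun i => weakPartial i u) := by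
  refine ⟨hu.1.isW1, fun δ hδ => ?_⟩
  obtain ⟨η, hη, hη'⟩ := exists_four_mul_le hδ
  obtain ⟨φ, hφ⟩ := hu.2 η hη
  exact ⟨φ, isTest_coe φ, (h1norm_le_of_h1Close hφ).trans hη'⟩

theorem IsW10.memH10 (hu : IsW10 (U : Set E3) u g) : MemH10 u := by
  refine ⟨hu.toIsW1.memH1, fun δ hδ => ?_⟩
  obtain ⟨φ, hφ, h1⟩ := (hu.congr (ae_eq_refl _) fun i =>
    (hu.toIsW1.weakPartial_ae_eq i).symm).approx δ hδ
  exact ⟨hφ.bundle, h1Close_of_h1norm_le h1⟩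

theorem MemH10.sub (hu : MemH10 u) (hv : MemH10 v) : MemH10 (u - v) :=
  ((hu.isW10.sub hv.isW10).congr (Lp.coeFn_sub u v).symm fun _ => ae_eq_refl _).memH10

theorem MemH1.isW1_sub (hu : MemH1 u) (hv : MemH1 v) :
    IsW1 (U : Set E3) (u - v : L2 U) (fun i x => weakPartial i u x - weakPartial i v x) :=
  (hu.isW1.sub hv.isW1).congr (Lp.coeFn_sub u v).symm fun _ => ae_eq_refl _

theorem HasWeakLaplacian.add {f h : L2 U} (hu : HasWeakLaplacian u f) (hv : HasWeakLaplacian v h) :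
    HasWeakLaplacian (u + v) (f + h) := by
  rw [hasWeakLaplacian_iff] at *
  intro φ hφ
  have hs : IsTest (U : Set E3) (fun x => ∑ i, pd i (pd i φ) x) :=
    IsTest.sum fun i _ => (hφ.pd i).pd i
  rw [integral_mul_congr (Lp.coeFn_add u v), integral_mul_congr (Lp.coeFn_add f h)]
  simp only [ Pi.add_apply, add_mul]
  rw [integral_add (integrable_mul_test (Lp.memLp u) hs) (integrable_mul_test (Lp.memLp v) hs),
    integral_add (integrable_mul_test (Lp.memLp f) hφ) (integrable_mul_test (Lp.memLp h) hφ),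
    hu φ hφ, hv φ hφ]

theorem HasWeakLaplacian.smul {f : L2 U} (hu : HasWeakLaplacian u f) (c : ℂ) :
    HasWeakLaplacian (c • u) (c • f) := by
  rw [hasWeakLaplacian_iff] at *
  intro φ hφ
  rw [integral_mul_congr (Lp.coeFn_smul c u), integral_mul_congr (Lp.coeFn_smul c f)]
  simp only [ Pi.smul_apply, smul_eq_mul, mul_assoc]
  rw [integral_const_mul, integral_const_mul, hu φ hφ]

theorem HasWeakLaplacian.sub {f h : L2 U} (hu : HasWeakLaplacian u f) (hv : HasWeakLaplacian v h) :
    HasWeakLaplacian (u - v) (f - h) := by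
  simpa [sub_eq_add_neg] using hu.add (hv.smul (-1))

theorem mulBy_ae_eq {a : E3 → ℝ} {C : ℝ} (ha : Continuous a) (hC : ∀ x, |a x| ≤ C) (u : L2 U) :
    mulBy a u =ᵐ[volume.restrict (U : Set E3)] fun x => a x • u x := by
  rw [mulBy, dif_pos (memLp_smul_of_bound ha hC (Lp.memLp u))]
  exact MemLp.coeFn_toLp _

theorem mulBy_ae_eq_of_hasCompactSupport {a : E3 → ℝ} (ha : Continuous a) (hc : HasCompactSupport a)
    (u : L2 U) : mulBy a u =ᵐ[volume.restrict (U : Set E3)] fun x => a x • u x := by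
  obtain ⟨C, hC⟩ := hc.exists_bound_of_continuous ha
  exact mulBy_ae_eq ha hC u

theorem commLaplacian_ae_eq {a : E3 → ℝ} (ha : ContDiff ℝ ∞ a) (hc : HasCompactSupport a) (u : L2 U) :
    commLaplacian a u =ᵐ[volume.restrict (U : Set E3)] fun x =>
      (∑ i, pd i (pd i a) x) • u x + 2 * ∑ i, pd i a x • weakPartial i u x := by
  have hpd : ∀ i, HasCompactSupport (pd i a) := fun i =>
    hc.mono' ((subset_tsupport _).trans (tsupport_pd_subset a i))
  have hΔ : Δ a = fun x => ∑ i, pd i (pd i a) x := funext fun x => laplacian_eq_sum_pd ha x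
  have h0 : Continuous (Δ a) := by
    rw [hΔ]
    exact continuous_finsetSum _ fun i _ => (contDiff_pd (contDiff_pd ha i) i).continuous
  have h0' : HasCompactSupport (Δ a) := by
    refine hc.mono' fun x hx => ?_
    by_contra hx'
    refine hx ?_
    rw [hΔ]
    exact Finset.sum_eq_zero fun i _ => image_eq_zero_of_notMem_tsupport fun h =>
      hx' (tsupport_pd_subset a i (tsupport_pd_subset _ i h))
  have h1 := mulBy_ae_eq_of_hasCompactSupport h0 h0' u
  have h2 := fun i : Fin 3 => mulBy_ae_eq_of_hasCompactSupport (contDiff_pd ha i).continuous (hpd i)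
    (weakPartial i u)
  have h3 : (∑ i, mulBy (fun x => fderiv ℝ a x (e i)) (weakPartial i u) : L2 U)
      =ᵐ[volume.restrict (U : Set E3)] fun x => ∑ i, pd i a x • weakPartial i u x := by
    filter_upwards [Lp.coeFn_finsetSum Finset.univ
      (fun i => mulBy (fun x => fderiv ℝ a x (e i)) (weakPartial i u)), ae_all_iff.2 h2] with x hx hx2
    rw [hx, Finset.sum_apply]
    exact Finset.sum_congr rfl fun i _ => hx2 i
  rw [commLaplacian]
  filter_upwards [Lp.coeFn_add (mulBy (Δ a) u) ((2 : ℂ) • ∑ i, mulBy (fun x => fderiv ℝ a x (e i))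
    (weakPartial i u)), Lp.coeFn_smul (2 : ℂ) (∑ i, mulBy (fun x => fderiv ℝ a x (e i))
    (weakPartial i u)), h1, h3] with x k1 k2 k3 k4
  rw [k1, Pi.add_apply, k2, Pi.smul_apply, k3, k4, hΔ, smul_eq_mul]

end Bridge

/-! ### Lax–Milgram and the Dirichlet problem in `H¹₀(U)` -/

/-- Lax–Milgram: coercivity bounds `T` from below, so its range is closed; a vector x orthogonal to
the range satisfies ⟨x, T x⟩ = 0 and is zero by coercivity again. -/
theorem surjective_of_coercive {H : Type*} [NormedAddCommGroup H] [InnerProductSpace ℂ H]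
    [CompleteSpace H] (T : H →L[ℂ] H) {c : ℝ} (hc : 0 < c)
    (h : ∀ x, c * ‖x‖ ^ 2 ≤ ‖inner ℂ x (T x)‖) : Function.Surjective T := by
  have hb : ∀ x, c * ‖x‖ ≤ ‖T x‖ := by
    intro x
    rcases eq_or_ne x 0 with rfl | hx
    · simp
    · have hx' : 0 < ‖x‖ := norm_pos_iff.2 hx
      have := (h x).trans (norm_inner_le_norm x (T x))
      nlinarith
  have hanti : AntilipschitzWith (Real.toNNReal c⁻¹) T := by
    refine T.antilipschitz_of_bound fun x => ?_
    rw [Real.coe_toNNReal _ (inv_nonneg.2 hc.le), ← div_eq_inv_mul, le_div_iff₀ hc, mul_comm]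
    exact hb x
  have hcl : IsClosed (LinearMap.range (T : H →ₗ[ℂ] H) : Set H) := by
    rw [LinearMap.coe_range]
    exact hanti.isClosed_range T.uniformContinuous
  have : CompleteSpace (LinearMap.range (T : H →ₗ[ℂ] H)) := hcl.completeSpace_coe
  rw [← ContinuousLinearMap.coe_coe, ← LinearMap.range_eq_top, ← Submodule.orthogonal_eq_bot_iff,
    Submodule.eq_bot_iff]
  intro x hx
  have h1 : inner ℂ x (T x) = 0 := Submodule.inner_left_of_mem_orthogonal
    (LinearMap.mem_range_self (T : H →ₗ[ℂ] H) x) hx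
  have h2 := h x
  rw [h1, norm_zero] at h2
  have h3 : ‖x‖ ^ 2 ≤ 0 := by
    by_contra h3
    push Not at h3
    nlinarith
  exact norm_eq_zero.1 (pow_eq_zero_iff (two_ne_zero) |>.1 (le_antisymm h3 (sq_nonneg _)))

/-- The space of pairs of a function and a vector field in `L²(U)`. -/
abbrev Jets (U : Opens E3) : Type := PiLp 2 (fun _ : Option (Fin 3) => L2 U)

theorem enorm_sub_eq_eLpNorm {U : Opens E3} (u v : L2 U) :
    ‖u - v‖ₑ = eLpNorm (fun x => u x - v x) 2 (volume.restrict (U : Set E3)) := by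
  rw [Lp.enorm_def]
  exact eLpNorm_congr_ae (Lp.coeFn_sub u v)

theorem eLpNorm_sub_eq {U : Opens E3} (u v : L2 U) {f : E3 → ℂ}
    (hf : v =ᵐ[volume.restrict (U : Set E3)] f) :
    eLpNorm (fun x => u x - f x) 2 (volume.restrict (U : Set E3)) = ‖u - v‖ₑ := by
  rw [enorm_sub_eq_eLpNorm]
  exact eLpNorm_congr_ae ((ae_eq_refl _).sub hf.symm)

/-- The test functions with their gradients. -/
def testJets (U : Opens E3) : Submodule ℂ (Jets U) where
  carrier := {x | ∃ φ, IsTest (U : Set E3) φ ∧ x none =ᵐ[volume.restrict (U : Set E3)] φ ∧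
    ∀ i, x (some i) =ᵐ[volume.restrict (U : Set E3)] pd i φ}
  add_mem' := by
    rintro x y ⟨φ, hφ, h1, h2⟩ ⟨ψ, hψ, h3, h4⟩
    refine ⟨_, hφ.add hψ, (Lp.coeFn_add _ _).trans (h1.add h3), fun i =>
      (Lp.coeFn_add _ _).trans (((h2 i).add (h4 i)).trans (.of_forall fun x => ?_))⟩
    exact (pd_add hφ.1 hψ.1 i x).symm
  zero_mem' := by
    refine ⟨_, IsTest.zero, Lp.coeFn_zero _ _ _, fun i =>
      (Lp.coeFn_zero _ _ _).trans (.of_forall fun x => ?_)⟩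
    simp [pd]
  smul_mem' := by
    rintro c x ⟨φ, hφ, h1, h2⟩
    refine ⟨_, hφ.const_mul c, (Lp.coeFn_smul _ _).trans (h1.const_smul c), fun i =>
      (Lp.coeFn_smul _ _).trans (((h2 i).const_smul c).trans (.of_forall fun x => ?_))⟩
    exact (pd_const_mul hφ.1 c i x).symm

/-- `H¹₀(U)` as a Hilbert space. -/
def jetSpace (U : Opens E3) : Submodule ℂ (Jets U) := (testJets U).topologicalClosure

/-- Closing the test jets in the product of `L²` spaces adds nothing spurious: integration by parts
passes to the limit, so the last three components are still the weak gradient of the first. -/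
theorem isW10_of_mem_jetSpace {U : Opens E3} {x : Jets U} (hx : x ∈ jetSpace U) :
    IsW10 (U : Set E3) (x none) (fun i => x (some i)) := by
  have key : ∀ δ : ℝ≥0∞, 0 < δ → ∃ φ, IsTest (U : Set E3) φ ∧
      eLpNorm (fun y => x none y - φ y) 2 (volume.restrict (U : Set E3)) ≤ δ ∧
      ∀ i, eLpNorm (fun y => x (some i) y - pd i φ y) 2 (volume.restrict (U : Set E3)) ≤ δ := by
    intro δ hδ
    obtain ⟨y, ⟨φ, hφ, h1, h2⟩, hy⟩ := EMetric.mem_closure_iff.1 hx δ hδ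
    rw [edist_eq_enorm_sub] at hy
    have hle : ∀ o, ‖x o - y o‖ₑ ≤ ‖x - y‖ₑ := fun o => by
      have := PiLp.norm_apply_le (x - y) o
      rwa [← enorm_le_iff_norm_le] at this
    exact ⟨φ, hφ, (eLpNorm_sub_eq _ _ h1).trans_le ((hle _).trans hy.le), fun i =>
      (eLpNorm_sub_eq _ _ (h2 i)).trans_le ((hle _).trans hy.le)⟩
  refine ⟨⟨Lp.memLp _, fun i => Lp.memLp _, fun i ψ hψ => ?_⟩, fun δ hδ => ?_⟩
  · refine weak_of_approx (hψ.mono (Set.subset_univ _)) (Lp.memLp _) (Lp.memLp _) (C := 0)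
      (by simp) fun δ hδ => ?_
    obtain ⟨φ, hφ, h1, h2⟩ := key δ hδ
    refine ⟨φ, hφ.mono (Set.subset_univ _), h1, h2 i, ?_⟩
    rw [integral_add (integrable_mul_test (hφ.memLp 2 _) (hψ.pd i))
      (integrable_mul_test ((hφ.pd i).memLp 2 _) hψ), integral_test_mul_pd hφ hψ (.inl subset_rfl)]
    simp
  · obtain ⟨η, hη, hη'⟩ := exists_four_mul_le hδ
    obtain ⟨φ, hφ, h1, h2⟩ := key η hη
    exact ⟨φ, hφ, (h1norm_le h1 h2).trans hη'⟩

theorem mem_jetSpace {U : Opens E3} {u : L2 U} (hu : MemH10 u) :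
    (WithLp.toLp 2 (fun o => o.elim u (fun i => weakPartial i u)) : Jets U) ∈ jetSpace U := by
  have h := fun n : ℕ => hu.isW10.approx ((n : ℝ≥0∞) + 1)⁻¹ (by simp)
  choose φ hφ hn using h
  refine mem_closure_of_tendsto (b := Filter.atTop)
    (f := fun n => (WithLp.toLp 2 (fun o => o.elim ((hφ n).memLp 2 _).toLp
      (fun i => (((hφ n).pd i).memLp 2 _).toLp)) : Jets U)) ?_ (.of_forall fun n => ?_)
  · refine ((PiLp.continuous_toLp 2 _).tendsto _).comp (tendsto_pi_nhds.2 fun o => ?_)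
    have h0 : Filter.Tendsto (fun n : ℕ => ((n : ℝ≥0∞) + 1)⁻¹) Filter.atTop (nhds 0) := by
      have := ENNReal.tendsto_inv_nat_nhds_zero.comp (Filter.tendsto_add_atTop_nat 1)
      simpa [Function.comp_def] using this
    rw [tendsto_iff_edist_tendsto_0]
    refine tendsto_of_tendsto_of_tendsto_of_le_of_le tendsto_const_nhds h0 (fun _ => zero_le) ?_
    intro n
    simp only
    rw [edist_comm, edist_eq_enorm_sub]
    cases o with
    | none =>
      exact (eLpNorm_sub_eq _ _ ((hφ n).memLp 2 _).coeFn_toLp).symm.trans_le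
        ((eLpNorm_le_h1norm _ _ _).trans (hn n))
    | some i =>
      exact (eLpNorm_sub_eq _ _ (((hφ n).pd i).memLp 2 _).coeFn_toLp).symm.trans_le
        ((eLpNorm_grad_le_h1norm (U : Set E3) _
          (fun i x => weakPartial i u x - pd i (φ n) x) i).trans (hn n))
  · exact ⟨φ n, hφ n, ((hφ n).memLp 2 _).coeFn_toLp, fun i => (((hφ n).pd i).memLp 2 _).coeFn_toLp⟩

/-- The operator `diag(s², 1, 1, 1)`. -/
def jetOp (U : Opens E3) (s : ℂ) : Jets U →L[ℂ] Jets U :=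
  (PiLp.continuousLinearEquiv 2 ℂ (fun _ : Option (Fin 3) => L2 U)).symm.toContinuousLinearMap ∘L
    ContinuousLinearMap.pi (fun o => (o.elim (s ^ 2) (fun _ => 1) : ℂ) •
      ContinuousLinearMap.proj o) ∘L
    (PiLp.continuousLinearEquiv 2 ℂ (fun _ : Option (Fin 3) => L2 U)).toContinuousLinearMap

@[simp] theorem jetOp_none {U : Opens E3} (s : ℂ) (x : Jets U) : jetOp U s x none = s ^ 2 • x none :=
  rfl

@[simp] theorem jetOp_some {U : Opens E3} (s : ℂ) (x : Jets U) (i : Fin 3) :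
    jetOp U s x (some i) = x (some i) := one_smul ℂ (x (some i))

theorem inner_self_eq_ofReal {H : Type*} [NormedAddCommGroup H] [InnerProductSpace ℂ H] (x : H) :
    inner ℂ x x = ((‖x‖ ^ 2 : ℝ) : ℂ) := by
  rw [inner_self_eq_norm_sq_to_K]
  push_cast
  rfl

theorem inner_smul_self_eq {H : Type*} [NormedAddCommGroup H] [InnerProductSpace ℂ H] (c : ℂ)
    (x : H) : inner ℂ x (c • x) = c * ((‖x‖ ^ 2 : ℝ) : ℂ) := by
  rw [inner_smul_right, inner_self_eq_ofReal]

theorem inner_jetOp_self {U : Opens E3} (s : ℂ) (x : Jets U) : inner ℂ x (jetOp U s x) =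
    s ^ 2 * ((‖x none‖ ^ 2 : ℝ) : ℂ) + ((∑ i, ‖x (some i)‖ ^ 2 : ℝ) : ℂ) := by
  rw [PiLp.inner_apply, Fintype.sum_option, jetOp_none, inner_smul_self_eq, Complex.ofReal_sum]
  congr 1
  refine Finset.sum_congr rfl fun i _ => ?_
  rw [jetOp_some, inner_self_eq_ofReal]

/-- The form is s²A + B with A, B ≥ 0, and s² may have negative real part. Multiplying by the
conjugate of s turns the real part into Re s (|s|²A + B); dividing by |s| gives the constant. -/
theorem jetOp_coercive {U : Opens E3} {s : ℂ} (hs : 0 < s.re) :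
    ∃ c : ℝ, 0 < c ∧ ∀ x : Jets U, c * ‖x‖ ^ 2 ≤ ‖inner ℂ x (jetOp U s x)‖ := by
  have hs0 : s ≠ 0 := fun h => by simp [h] at hs
  have hn : 0 < ‖s‖ := norm_pos_iff.2 hs0
  refine ⟨s.re * min (‖s‖ ^ 2) 1 / ‖s‖, by positivity, fun x => ?_⟩
  set A : ℝ := ‖x none‖ ^ 2
  set B : ℝ := ∑ i, ‖x (some i)‖ ^ 2
  have hA : 0 ≤ A := sq_nonneg _
  have hB : 0 ≤ B := Finset.sum_nonneg fun _ _ => sq_nonneg _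
  have h1 : inner ℂ x (jetOp U s x) = s ^ 2 * (A : ℂ) + (B : ℂ) := inner_jetOp_self s x
  have h2 : ‖x‖ ^ 2 = A + B := by
    rw [PiLp.norm_sq_eq_of_L2, Fintype.sum_option]
  have h3 : (starRingEnd ℂ s * (s ^ 2 * (A : ℂ) + (B : ℂ))).re = s.re * (‖s‖ ^ 2 * A + B) := by
    rw [← Complex.normSq_eq_norm_sq, Complex.normSq_apply]
    simp [pow_two]
    ring
  have h4 := Complex.re_le_norm (starRingEnd ℂ s * (s ^ 2 * (A : ℂ) + (B : ℂ)))
  rw [h3, norm_mul, RCLike.norm_conj] at h4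
  rw [h1, h2, div_mul_eq_mul_div, div_le_iff₀ hn, mul_comm (‖_‖ : ℝ) ‖s‖]
  refine le_trans ?_ h4
  rw [mul_assoc]
  refine mul_le_mul_of_nonneg_left ?_ hs.le
  have m1 := mul_le_mul_of_nonneg_right (min_le_left (‖s‖ ^ 2) 1) hA
  have m2 := mul_le_mul_of_nonneg_right (min_le_right (‖s‖ ^ 2) 1) hB
  linarith

theorem inner_eq_integral_of_ae_eq {U : Opens E3} (u v : L2 U) {φ : E3 → ℂ}
    (h : u =ᵐ[volume.restrict (U : Set E3)] φ) :
    inner ℂ u v = ∫ x in (U : Set E3), v x * (starRingEnd ℂ) (φ x) := by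
  rw [L2.inner_def]
  refine integral_congr_ae ?_
  filter_upwards [h] with x hx
  rw [hx]
  simp [mul_comm]

/-- Integration by parts, once in each direction. -/
theorem IsW1.integral_mul_laplacian {U : Set E3} {u φ : E3 → ℂ} {g : Fin 3 → E3 → ℂ}
    (hu : IsW1 U u g) (hφ : IsTest U φ) :
    ∫ x in U, u x * (∑ i, pd i (pd i φ) x) = -∑ i, ∫ x in U, g i x * pd i φ x := by
  simp_rw [Finset.mul_sum]
  rw [integral_finsetSum _ fun i _ => integrable_mul_test hu.1 ((hφ.pd i).pd i),
    ← Finset.sum_neg_distrib]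
  exact Finset.sum_congr rfl fun i _ => hu.3 i _ (hφ.pd i)

/-- The weak form of `(s² - Δ) u = f` in terms of jets. -/
theorem inner_jetOp_eq_iff {U : Opens E3} {s : ℂ} {f : L2 U} {x : Jets U}
    (hW : IsW1 (U : Set E3) (x none) (fun i => x (some i))) :
    (∀ y ∈ jetSpace U, inner ℂ y (jetOp U s x) = inner ℂ (y none) f) ↔
      HasWeakLaplacian (x none) (s ^ 2 • x none - f) := by
  have key : ∀ y : Jets U, ∀ φ, IsTest (U : Set E3) φ →
      y none =ᵐ[volume.restrict (U : Set E3)] (fun x => (starRingEnd ℂ) (φ x)) →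
      (∀ i, y (some i) =ᵐ[volume.restrict (U : Set E3)] pd i (fun x => (starRingEnd ℂ) (φ x))) →
      (inner ℂ y (jetOp U s x) = inner ℂ (y none) f ↔
        ∫ z in (U : Set E3), x none z * (∑ i, pd i (pd i φ) z) =
          ∫ z in (U : Set E3), (s ^ 2 • x none - f : L2 U) z * φ z) := by
    intro y φ hφ h1 h2
    have e1 : inner ℂ y (jetOp U s x) = s ^ 2 * (∫ z in (U : Set E3), x none z * φ z) +
        ∑ i, ∫ z in (U : Set E3), x (some i) z * pd i φ z := by
      rw [PiLp.inner_apply, Fintype.sum_option]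
      simp only [jetOp_none, jetOp_some, inner_smul_right]
      rw [inner_eq_integral_of_ae_eq _ _ h1]
      simp_rw [inner_eq_integral_of_ae_eq _ _ (h2 _), pd_conj hφ.1, Complex.conj_conj]
    have e2 : inner ℂ (y none) f = ∫ z in (U : Set E3), f z * φ z := by
      rw [inner_eq_integral_of_ae_eq _ _ h1]
      simp
    have e3 : ∫ z in (U : Set E3), (s ^ 2 • x none - f : L2 U) z * φ z =
        s ^ 2 * (∫ z in (U : Set E3), x none z * φ z) - ∫ z in (U : Set E3), f z * φ z := by
      have : (s ^ 2 • x none - f : L2 U) =ᵐ[volume.restrict (U : Set E3)]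
          fun z => s ^ 2 * x none z - f z := by
        filter_upwards [Lp.coeFn_sub (s ^ 2 • x none) f, Lp.coeFn_smul (s ^ 2) (x none)] with z h h'
        rw [h, Pi.sub_apply, h', Pi.smul_apply, smul_eq_mul]
      rw [integral_mul_congr this]
      simp_rw [sub_mul, mul_assoc]
      rw [integral_sub ((integrable_mul_test (Lp.memLp _) hφ).const_mul _)
        (integrable_mul_test (Lp.memLp _) hφ), integral_const_mul]
    rw [e1, e2, e3, hW.integral_mul_laplacian hφ]
    constructor
    · intro h; rw [← h]; ring
    · intro h; linear_combination -h
  rw [hasWeakLaplacian_iff]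
  constructor
  · intro h φ hφ
    -- The inner product is conjugate-linear in its first argument, so the jet of the conjugate of
    -- `φ` produces the bilinear pairing with `φ`.
    let y : Jets U := WithLp.toLp 2 (fun o => o.elim (hφ.conj.memLp 2 _).toLp
      (fun i => ((hφ.conj.pd i).memLp 2 _).toLp))
    have h1 : y none =ᵐ[volume.restrict (U : Set E3)] (fun x => (starRingEnd ℂ) (φ x)) :=
      (hφ.conj.memLp 2 _).coeFn_toLp
    have h2 : ∀ i, y (some i) =ᵐ[volume.restrict (U : Set E3)]
        pd i (fun x => (starRingEnd ℂ) (φ x)) := fun i => ((hφ.conj.pd i).memLp 2 _).coeFn_toLp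
    exact (key y φ hφ h1 h2).1
      (h y (Submodule.le_topologicalClosure _ ⟨_, hφ.conj, h1, h2⟩))
  · intro h y hy
    -- Both sides are continuous in `y`, so it suffices to test with the dense subspace of test
    -- jets.
    have hcl : IsClosed {y : Jets U | inner ℂ y (jetOp U s x) = inner ℂ (y none) f} :=
      isClosed_eq (continuous_id.inner continuous_const)
        (((PiLp.continuous_apply 2 _ none)).inner continuous_const)
    refine closure_minimal ?_ hcl hy
    rintro y ⟨ψ, hψ, h1, h2⟩
    exact (key y _ hψ.conj (by simpa using h1) (by simpa using h2)).2 (h _ hψ.conj)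

/-- The difference solves the homogeneous equation and is in H¹₀, so it may be tested against
itself; coercivity forces it to vanish. -/
theorem eq_of_dirichlet {U : Opens E3} {s : ℂ} (hs : 0 < s.re) {f u v : L2 U} (hu : MemH10 u)
    (hv : MemH10 v) (hfu : HasWeakLaplacian u (s ^ 2 • u - f))
    (hfv : HasWeakLaplacian v (s ^ 2 • v - f)) : u = v := by
  have hw := hu.sub hv
  have hΔ := hfu.sub hfv
  have e1 : s ^ 2 • u - f - (s ^ 2 • v - f) = s ^ 2 • (u - v) - 0 := by
    rw [smul_sub]; abel
  rw [e1] at hΔ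
  have hx := mem_jetSpace hw
  have h0 := (inner_jetOp_eq_iff (s := s) (f := 0) (isW10_of_mem_jetSpace hx).toIsW1).2 hΔ _ hx
  rw [inner_zero_right] at h0
  obtain ⟨c, hc, h⟩ := jetOp_coercive (U := U) hs
  have h2 := h (WithLp.toLp 2 (fun o => o.elim (u - v) (fun i => weakPartial i (u - v))))
  rw [h0, norm_zero] at h2
  set x : Jets U := WithLp.toLp 2 (fun o => o.elim (u - v) (fun i => weakPartial i (u - v)))
  have h3 : ‖x‖ ^ 2 ≤ 0 := by
    by_contra h3
    push Not at h3
    nlinarith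
  have h4 : x = 0 :=
    norm_eq_zero.1 (pow_eq_zero_iff (two_ne_zero) |>.1 (le_antisymm h3 (sq_nonneg _)))
  have h5 : x none = 0 := by rw [h4]; rfl
  exact sub_eq_zero.1 h5

/-- Solvability of the variational problem on jets. -/
theorem exists_mem_jetSpace_inner (U : Opens E3) {s : ℂ} (hs : 0 < s.re) (F : Jets U) :
    ∃ x ∈ jetSpace U, ∀ y ∈ jetSpace U, inner ℂ y (jetOp U s x) = inner ℂ y F := by
  have hcl : IsClosed (jetSpace U : Set (Jets U)) := Submodule.isClosed_topologicalClosure _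
  have : CompleteSpace (jetSpace U) := hcl.completeSpace_coe
  -- The compression of `jetOp` to the Hilbert space H¹₀ has the same quadratic form there, hence is
  -- coercive.
  let T : jetSpace U →L[ℂ] jetSpace U :=
    (jetSpace U).orthogonalProjectionOnto ∘L jetOp U s ∘L (jetSpace U).subtypeL
  have hT : ∀ y x : jetSpace U, inner ℂ y (T x) = inner ℂ (y : Jets U) (jetOp U s x) :=
    fun y x => Submodule.inner_orthogonalProjectionOnto_eq_of_mem_left y (jetOp U s x)
  obtain ⟨c, hc, h⟩ := jetOp_coercive (U := U) hs
  have hsurj : Function.Surjective T := surjective_of_coercive T hc fun x => by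
    rw [hT]; exact h x
  obtain ⟨x, hx⟩ := hsurj ((jetSpace U).orthogonalProjectionOnto F)
  refine ⟨x, x.2, fun y hy => ?_⟩
  rw [← hT ⟨y, hy⟩ x, hx, Submodule.inner_orthogonalProjectionOnto_eq_of_mem_left]

/-- Solvability of the Dirichlet problem in `H¹₀(U)`. -/
theorem existsUnique_dirichlet (U : Opens E3) {s : ℂ} (hs : 0 < s.re) (f : L2 U) :
    ∃! u : L2 U, MemH10 u ∧ HasWeakLaplacian u (s ^ 2 • u - f) := by
  let F : Jets U := WithLp.toLp 2 (fun o => o.elim f (fun _ => 0))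
  obtain ⟨x, hx, hF⟩ := exists_mem_jetSpace_inner U hs F
  have hw := (inner_jetOp_eq_iff (s := s) (f := f) (isW10_of_mem_jetSpace hx).toIsW1).1
    fun y hy => by
      rw [hF y hy]
      simp [F, PiLp.inner_apply, Fintype.sum_option]
  exact ⟨x none, ⟨(isW10_of_mem_jetSpace hx).memH10, hw⟩, fun v hv =>
    eq_of_dirichlet hs hv.1 (isW10_of_mem_jetSpace hx).memH10 hv.2 hw⟩

/-- Every function in `H¹(U)` differs by an element of `H¹₀(U)` from a solution of
`(s² - Δ) v = 0`. -/
theorem exists_memH10_sub_solution {U : Opens E3} {s : ℂ} (hs : 0 < s.re) {u : L2 U} (hu : MemH1 u) :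
    ∃ w : L2 U, MemH10 w ∧ HasWeakLaplacian (u - w) (s ^ 2 • (u - w)) := by
  let X : Jets U := WithLp.toLp 2 (fun o => o.elim u (fun i => weakPartial i u))
  -- With `jetOp U s X` as right-hand side, the form of `X - x` vanishes against all of H¹₀, which
  -- is the weak homogeneous equation.
  obtain ⟨x, hx, hF⟩ := exists_mem_jetSpace_inner U hs (jetOp U s X)
  have hxW := isW10_of_mem_jetSpace hx
  refine ⟨x none, hxW.memH10, ?_⟩
  have hW : IsW1 (U : Set E3) ((X - x) none) (fun i => (X - x) (some i)) :=
    (hu.isW1.sub hxW.toIsW1).congr (Lp.coeFn_sub u (x none)).symm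
      fun i => (Lp.coeFn_sub (weakPartial i u) (x (some i))).symm
  have := (inner_jetOp_eq_iff (s := s) (f := 0) hW).1 fun y hy => by
    rw [map_sub, inner_sub_right, hF y hy, sub_self, inner_zero_right]
  rwa [sub_zero] at this

/-! ### Mollification -/

/-- Continuity of translations in `L²`, read off from the continuous action of `DomAddAct`; the
parameter is `-y` because the action precomposes with addition. -/
theorem eLpNorm_translate_le {u : E3 → ℂ} (hu : MemLp u 2 volume) {δ : ℝ≥0∞} (hδ : 0 < δ) :
    ∃ r > 0, ∀ y : E3, ‖y‖ < r → eLpNorm (fun x => u (x - y) - u x) 2 volume ≤ δ := by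
  have : Fact ((2 : ℝ≥0∞) ≠ ⊤) := ⟨by norm_num⟩
  have hc : Continuous fun y : E3 => (DomAddAct.mk (-y)) +ᵥ hu.toLp u :=
    (DomAddAct.continuous_mk.comp continuous_neg).vadd continuous_const
  have h0 := (hc.tendsto 0).eventually (Metric.eball_mem_nhds _ hδ)
  obtain ⟨r, hr, h⟩ := Metric.eventually_nhds_iff_ball.1 h0
  refine ⟨r, hr, fun y hy => ?_⟩
  have h1 := (h y (by simpa using hy)).le
  rw [edist_eq_enorm_sub, Lp.enorm_def] at h1
  refine le_of_eq_of_le (eLpNorm_congr_ae ?_) h1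
  have h2 : (DomAddAct.mk (-y) +ᵥ hu.toLp u : Lp ℂ 2 (volume : Measure E3)) =ᵐ[volume]
      fun x => u (x - y) := by
    have q := (measurePreserving_add_left (volume : Measure E3) (-y)).quasiMeasurePreserving
    refine (DomAddAct.vadd_Lp_ae_eq _ _).trans ((q.ae_eq_comp hu.coeFn_toLp).trans ?_)
    refine .of_forall fun x => ?_
    simp only [Function.comp]
    congr 1
    abel
  have h3 : (DomAddAct.mk (-(0 : E3)) +ᵥ hu.toLp u : Lp ℂ 2 (volume : Measure E3)) =ᵐ[volume] u := by
    simpa using hu.coeFn_toLp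
  filter_upwards [Lp.coeFn_sub (DomAddAct.mk (-y) +ᵥ hu.toLp u)
    (DomAddAct.mk (-(0 : E3)) +ᵥ hu.toLp u), h2, h3] with x k1 k2 k3
  rw [k1, Pi.sub_apply, k2, k3]

theorem eLpNorm_two_sq (f : E3 → ℂ) (μ : Measure E3) :
    eLpNorm f 2 μ ^ 2 = ∫⁻ x, ‖f x‖ₑ ^ 2 ∂μ := by
  rw [eLpNorm_eq_lintegral_rpow_enorm_toReal (by norm_num) (by norm_num), ← ENNReal.rpow_natCast,
    ← ENNReal.rpow_mul]
  norm_num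

/-- The convolution `η * u` of a real and a complex function. -/
def mollify (η : E3 → ℝ) (u : E3 → ℂ) : E3 → ℂ :=
  convolution η u (ContinuousLinearMap.lsmul ℝ ℝ) volume

theorem mollify_eq (η : E3 → ℝ) (u : E3 → ℂ) (x : E3) :
    mollify η u x = ∫ t, η t • u (x - t) := rfl

theorem mollify_eq_swap (η : E3 → ℝ) (u : E3 → ℂ) (x : E3) :
    mollify η u x = ∫ t, η (x - t) • u t := by
  rw [mollify, convolution_eq_swap]
  rfl

/-- The weight `η` of a mollifier. -/
structure IsWeight (η : E3 → ℝ) : Prop where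
  contDiff : ContDiff ℝ ∞ η
  hasCompactSupport : HasCompactSupport η
  nonneg : ∀ x, 0 ≤ η x
  integral_eq_one : ∫ x, η x = 1

/-- The bump is centred at `y`, not at the origin: convolution with it mollifies and translates by
about `y` at once, which later moves supports into the domain. -/
theorem exists_isWeight (y : E3) {r : ℝ} (hr : 0 < r) :
    ∃ η, IsWeight η ∧ tsupport η ⊆ Metric.closedBall y r := by
  let b : ContDiffBump y := ⟨r / 2, r, by positivity, by linarith⟩
  exact ⟨b.normed volume, ⟨b.contDiff_normed, b.hasCompactSupport_normed, b.nonneg_normed,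
    b.integral_normed⟩, (b.tsupport_normed_eq (μ := volume)).subset⟩

section Mollify

variable {η : E3 → ℝ} {u : E3 → ℂ}

theorem integrable_mollify (hη : Continuous η) (hc : HasCompactSupport η)
    (hu : LocallyIntegrable u volume) (x : E3) :
    Integrable (fun t => η t • u (x - t)) volume :=
  hc.convolutionExists_left (ContinuousLinearMap.lsmul ℝ ℝ) hη hu x

theorem IsWeight.contDiff_mollify (hη : IsWeight η) (hu : LocallyIntegrable u volume) :
    ContDiff ℝ ∞ (mollify η u) :=
  hη.hasCompactSupport.contDiff_convolution_left _ hη.contDiff hu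

theorem IsWeight.pd_mollify (hη : IsWeight η) (hu : LocallyIntegrable u volume) (i : Fin 3)
    (x : E3) : pd i (mollify η u) x = ∫ t, pd i η (x - t) • u t := by
  have h := hη.2.hasFDerivAt_convolution_left (ContinuousLinearMap.lsmul ℝ ℝ : ℝ →L[ℝ] ℂ →L[ℝ] ℂ)
    (hη.1.of_le (by simp)) hu x
  have hex := (hη.2.fderiv ℝ).convolutionExists_left
    ((ContinuousLinearMap.lsmul ℝ ℝ : ℝ →L[ℝ] ℂ →L[ℝ] ℂ).precompL E3)
    (hη.1.continuous_fderiv (by simp)) hu x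
  rw [pd, show mollify η u = convolution η u (ContinuousLinearMap.lsmul ℝ ℝ) volume from rfl,
    h.fderiv, convolution_def, ContinuousLinearMap.integral_apply hex]
  rw [← integral_sub_left_eq_self _ volume x]
  refine integral_congr_ae (.of_forall fun t => ?_)
  simp [ContinuousLinearMap.precompL_apply, pd]

/-- For fixed x the function t ↦ η(x - t) is a test function, so the derivative that falls on `η`
can be moved to `u` by the definition of the weak gradient. -/
theorem IsWeight.pd_mollify_eq {g : Fin 3 → E3 → ℂ} (hη : IsWeight η) (hu : IsW1 Set.univ u g)
    (i : Fin 3) : pd i (mollify η u) = mollify η (g i) := by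
  have hloc : LocallyIntegrable u volume := by
    have := hu.1
    rw [Measure.restrict_univ] at this
    exact this.locallyIntegrable (by norm_num)
  ext x
  rw [hη.pd_mollify hloc, mollify_eq_swap]
  have hψ : IsTest Set.univ (fun t => (η (x - t) : ℂ)) := by
    refine ⟨Complex.ofRealCLM.contDiff.comp (hη.1.comp (contDiff_const.sub contDiff_id)), ?_,
      Set.subset_univ _⟩
    exact (hη.2.comp_homeomorph (Homeomorph.subLeft x)).comp_left Complex.ofReal_zero
  have hpd : ∀ t, pd i (fun t => (η (x - t) : ℂ)) t = -((pd i η (x - t) : ℝ) : ℂ) := by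
    intro t
    have h1 : HasFDerivAt (fun t : E3 => x - t) (-ContinuousLinearMap.id ℝ E3) t :=
      (hasFDerivAt_id t).const_sub x
    have h2 := (Complex.ofRealCLM.hasFDerivAt (x := η (x - t))).comp t
      (((differentiable_of_smooth hη.1) (x - t)).hasFDerivAt.comp t h1)
    have h3 : HasFDerivAt (fun t => (η (x - t) : ℂ)) _ t := h2
    rw [pd, h3.fderiv]
    simp [pd]
  have h1 := hu.3 i _ hψ
  simp only [hpd, Measure.restrict_univ] at h1
  have e1 : ∫ t, pd i η (x - t) • u t = -∫ t, u t * -((pd i η (x - t) : ℝ) : ℂ) := by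
    rw [← integral_neg]
    congr 1; ext t; rw [Complex.real_smul]; ring
  rw [e1, h1, neg_neg]
  congr 1; ext t; rw [Complex.real_smul]; ring

/-- The weight defines a probability measure, and η * u - u is the mean of the differences u(· - t)
- u under it. The `L¹` norm is at most the `L²` norm for that measure, and Tonelli reduces the claim
to the bound for each t. -/
theorem IsWeight.eLpNorm_mollify_sub_le (hη : IsWeight η) (hu : MemLp u 2 volume) {δ : ℝ≥0∞}
    (h : ∀ y ∈ tsupport η, eLpNorm (fun x => u (x - y) - u x) 2 volume ≤ δ) :
    eLpNorm (fun x => mollify η u x - u x) 2 volume ≤ δ := by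
  have hloc : LocallyIntegrable u volume := hu.locallyIntegrable (by norm_num)
  set w : E3 → ℝ≥0∞ := fun t => ‖η t‖ₑ
  have hw : Measurable w := hη.1.continuous.measurable.enorm
  set ν : Measure E3 := volume.withDensity w
  have hint : Integrable η volume := hη.1.continuous.integrable_of_hasCompactSupport hη.2
  have hν : IsProbabilityMeasure ν := by
    refine ⟨?_⟩
    rw [withDensity_apply _ MeasurableSet.univ, Measure.restrict_univ]
    have := ofReal_integral_eq_lintegral_ofReal hint (.of_forall hη.3)
    rw [hη.4, ENNReal.ofReal_one] at this
    rw [this]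
    refine lintegral_congr fun t => ?_
    exact Real.enorm_of_nonneg (hη.3 t)
  have hac : ν ≪ volume := withDensity_absolutelyContinuous _ _
  have hmeas : AEStronglyMeasurable (fun p : E3 × E3 => u (p.1 - p.2) - u p.1)
      ((volume : Measure E3).prod ν) := by
    have h1 : AEStronglyMeasurable (fun p : E3 × E3 => u (p.1 - p.2) - u p.1)
        ((volume : Measure E3).prod volume) :=
      (hu.1.comp_quasiMeasurePreserving
        (quasiMeasurePreserving_sub_of_right_invariant volume volume)).sub hu.1.comp_fst
    exact h1.mono_ac (Measure.AbsolutelyContinuous.rfl.prod hac)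
  have hpt : ∀ x, ‖mollify η u x - u x‖ₑ ^ 2 ≤ ∫⁻ t, ‖u (x - t) - u x‖ₑ ^ 2 ∂ν := by
    intro x
    have e1 : mollify η u x - u x = ∫ t, η t • (u (x - t) - u x) := by
      simp_rw [smul_sub]
      rw [integral_sub (integrable_mollify hη.1.continuous hη.2 hloc x) (hint.smul_const _),
        integral_smul_const, hη.4, one_smul, mollify_eq]
    have hux : AEStronglyMeasurable (fun t => u (x - t) - u x) ν := by
      refine ((hu.1.comp_quasiMeasurePreserving ?_).sub aestronglyMeasurable_const).mono_ac hac
      exact (Measure.measurePreserving_sub_left volume x).quasiMeasurePreserving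
    have e2 : ‖mollify η u x - u x‖ₑ ≤ eLpNorm (fun t => u (x - t) - u x) 1 ν := by
      rw [e1, eLpNorm_one_eq_lintegral_enorm, lintegral_withDensity_eq_lintegral_mul₀ hw.aemeasurable]
      · refine (enorm_integral_le_lintegral_enorm _).trans_eq (lintegral_congr fun t => ?_)
        rw [enorm_smul]; rfl
      · refine ((hu.1.comp_quasiMeasurePreserving ?_).sub aestronglyMeasurable_const).enorm
        exact (Measure.measurePreserving_sub_left volume x).quasiMeasurePreserving
    have e3 := e2.trans (eLpNorm_le_eLpNorm_of_exponent_le (p := 1) (q := 2) (by norm_num) hux)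
    calc _ ≤ (eLpNorm (fun t => u (x - t) - u x) 2 ν) ^ 2 := by gcongr
      _ = _ := eLpNorm_two_sq _ _
  refine (ENNReal.pow_le_pow_left_iff (n := 2) (by norm_num)).1 ?_
  calc _ = ∫⁻ x, ‖mollify η u x - u x‖ₑ ^ 2 := eLpNorm_two_sq _ _
    _ ≤ ∫⁻ x, ∫⁻ t, ‖u (x - t) - u x‖ₑ ^ 2 ∂ν := lintegral_mono hpt
    _ = ∫⁻ t, (∫⁻ x, ‖u (x - t) - u x‖ₑ ^ 2) ∂ν :=
        lintegral_lintegral_swap (hmeas.enorm.pow_const 2)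
    _ ≤ ∫⁻ _t, δ ^ 2 ∂ν := by
        refine lintegral_mono_ae ?_
        -- The bound on translates is assumed only for t in the support of `η`, which carries all of
        -- `ν`.
        have : ∀ᵐ t ∂ν, w t ≠ 0 := by
          rw [ae_withDensity_iff hw]
          exact .of_forall fun t ht => ht
        filter_upwards [this] with t ht
        rw [← eLpNorm_two_sq]
        gcongr
        exact h t (subset_tsupport _ fun h0 => ht (by simp [w, h0]))
    _ = δ ^ 2 := by simp

theorem mollify_eq_zero {K : Set E3} (hu : ∀ x ∉ K, u x = 0) {x : E3}
    (hx : x ∉ tsupport η + K) : mollify η u x = 0 := by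
  rw [mollify_eq]
  refine integral_eq_zero_of_ae (.of_forall fun t => ?_)
  by_cases ht : t ∈ tsupport η
  · have : x - t ∉ K := fun h => hx ⟨t, ht, x - t, h, by simp⟩
    simp [hu _ this]
  · simp [image_eq_zero_of_notMem_tsupport ht]

end Mollify

/-! ### Approximation by test functions: translations, cut-offs at infinity, localisation -/

section Approx

variable {U : Set E3} {u : E3 → ℂ} {g h : Fin 3 → E3 → ℂ}

theorem IsW1.grad_unique (hUo : IsOpen U) (hu : IsW1 U u g) (hv : IsW1 U u h) (i : Fin 3) :
    g i =ᵐ[volume.restrict U] h i := by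
  let V : Opens E3 := ⟨U, hUo⟩
  have h1 : IsW1 (V : Set E3) (hu.1.toLp (μ := volume.restrict (V : Set E3))) g :=
    hu.congr hu.1.coeFn_toLp.symm fun _ => ae_eq_refl _
  have h2 : IsW1 (V : Set E3) (hu.1.toLp (μ := volume.restrict (V : Set E3))) h :=
    hv.congr hu.1.coeFn_toLp.symm fun _ => ae_eq_refl _
  exact (h1.weakPartial_ae_eq i).symm.trans (h2.weakPartial_ae_eq i)

theorem IsW1.memLp_univ (hu : IsW1 Set.univ u g) : MemLp u 2 volume := by
  simpa using hu.1

theorem IsW1.memLp_grad_univ (hu : IsW1 Set.univ u g) (i : Fin 3) : MemLp (g i) 2 volume := by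
  simpa using hu.2 i

/-- A Sobolev function on `ℝ³` with compact support `K` is in `H¹₀(U)` if `K` can be moved into `U`
by arbitrarily small translations. -/
theorem IsW1.isW10_of_shift {K : Set E3} (hU : IsOpen U) (hu : IsW1 Set.univ u g) (hK : IsCompact K)
    (huK : ∀ x ∉ K, u x = 0) (hs : ∀ r > 0, ∃ y : E3, ‖y‖ < r ∧ ∀ x ∈ K, x + y ∈ U) :
    IsW10 U u g := by
  refine ⟨hu.mono_set (Set.subset_univ _), fun δ hδ => ?_⟩
  obtain ⟨ε, hε, hε'⟩ := exists_four_mul_le hδ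
  obtain ⟨r₀, hr₀, h₀⟩ := eLpNorm_translate_le hu.memLp_univ hε
  choose r₁ hr₁ h₁ using fun i => eLpNorm_translate_le (hu.memLp_grad_univ i) hε
  obtain ⟨r, hr, hrr₀, hrr₁⟩ : ∃ r > 0, r ≤ r₀ ∧ ∀ i, r ≤ r₁ i := by
    refine ⟨min r₀ (Finset.univ.inf' Finset.univ_nonempty r₁), ?_, min_le_left _ _, fun i =>
      (min_le_right _ _).trans (Finset.inf'_le _ (Finset.mem_univ i))⟩
    exact lt_min hr₀ ((Finset.lt_inf'_iff _).2 fun i _ => hr₁ i)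
  obtain ⟨y, hy, hyU⟩ := hs (r / 2) (by positivity)
  have hKy : IsCompact ((fun x => x + y) '' K) := hK.image (by fun_prop)
  obtain ⟨ρ, hρ, hρU⟩ := hKy.exists_cthickening_subset_open hU (by rintro _ ⟨x, hx, rfl⟩; exact hyU x hx)
  -- Radius at most `ρ` keeps the support within the `ρ`-thickening of K + y, hence in `U`; radius
  -- at most r/4 with ‖y‖ < r/2 keeps every shift t below `r`, where the translation estimates hold.
  obtain ⟨η, hη, hηs⟩ := exists_isWeight y (r := min ρ (r / 4)) (by positivity)
  have hsupp : ∀ t ∈ tsupport η, ‖t‖ < r := by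
    intro t ht
    have h1 := mem_closedBall_iff_norm.1 (hηs ht)
    have h2 : ‖t‖ ≤ ‖t - y‖ + ‖y‖ := by simpa using norm_add_le (t - y) y
    have h3 := min_le_right ρ (r / 4)
    linarith
  have hloc : LocallyIntegrable u volume := hu.memLp_univ.locallyIntegrable (by norm_num)
  have hcl : tsupport (mollify η u) ⊆ tsupport η + K := by
    have hc : IsClosed (tsupport η + K) := (hη.2.isCompact.add hK).isClosed
    refine closure_minimal (fun x hx => ?_) hc
    by_contra h
    exact hx (mollify_eq_zero huK h)
  refine ⟨mollify η u, ⟨hη.contDiff_mollify hloc, ?_, ?_⟩, ?_⟩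
  · exact (hη.2.isCompact.add hK).of_isClosed_subset (isClosed_tsupport _) hcl
  · refine hcl.trans (Set.Subset.trans ?_ hρU)
    rintro _ ⟨t, ht, x, hx, rfl⟩
    refine Metric.mem_cthickening_of_dist_le _ (x + y) ρ _ ⟨x, hx, rfl⟩ ?_
    have h1 := mem_closedBall_iff_norm.1 (hηs ht)
    rw [dist_eq_norm]
    have : t + x - (x + y) = t - y := by abel
    simp only [this]
    exact h1.trans (min_le_left _ _)
  · refine (h1norm_mono_set (Set.subset_univ U) _ _).trans ((h1norm_le ?_ fun i => ?_).trans hε')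
    · rw [Measure.restrict_univ]
      refine le_of_eq_of_le ?_ (hη.eLpNorm_mollify_sub_le hu.memLp_univ fun t ht =>
        h₀ t ((hsupp t ht).trans_le hrr₀))
      exact eLpNorm_sub_comm u (mollify η u) 2 volume
    · rw [Measure.restrict_univ, hη.pd_mollify_eq hu]
      refine le_of_eq_of_le ?_ (hη.eLpNorm_mollify_sub_le (hu.memLp_grad_univ i) fun t ht =>
        h₁ i t ((hsupp t ht).trans_le (hrr₁ i)))
      exact eLpNorm_sub_comm (g i) (mollify η (g i)) 2 volume

theorem pd_comp_smul {a : E3 → ℝ} (ha : ContDiff ℝ ∞ a) (c : ℝ) (i : Fin 3) (x : E3) :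
    pd i (fun y => a (c • y)) x = c * pd i a (c • x) := by
  have h1 : HasFDerivAt (fun y : E3 => c • y) (c • ContinuousLinearMap.id ℝ E3) x :=
    (hasFDerivAt_id x).const_smul c
  have h2 : HasFDerivAt (fun y => a (c • y)) _ x :=
    (differentiable_of_smooth ha (c • x)).hasFDerivAt.comp x h1
  rw [pd, h2.fderiv]
  simp [pd]

/-- Take a compactly supported v close to `w` and R so large that v vanishes beyond R. Then 1 - a is
zero up to R, and beyond it `w` equals w - v. -/
theorem eLpNorm_one_sub_cutoff {w : E3 → ℂ} (hw : MemLp w 2 volume) {δ : ℝ≥0∞} (hδ : δ ≠ 0) :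
    ∃ R : ℝ, ∀ a : E3 → ℝ, Continuous a → (∀ x, a x ∈ Set.Icc (0 : ℝ) 1) →
      (∀ x, ‖x‖ ≤ R → a x = 1) → eLpNorm (fun x => (1 - a x) • w x) 2 volume ≤ δ := by
  obtain ⟨v, hv, hv', -, -⟩ := hw.exists_hasCompactSupport_eLpNorm_sub_le (by norm_num) hδ
  obtain ⟨R, hR⟩ := hv.isCompact.isBounded.subset_closedBall 0
  refine ⟨R, fun a ha h01 h1 => le_trans ?_ hv'⟩
  refine eLpNorm_mono fun x => ?_
  by_cases hx : ‖x‖ ≤ R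
  · simp [h1 x hx]
  · have : v x = 0 := image_eq_zero_of_notMem_tsupport fun h => hx (by simpa using hR h)
    rw [norm_smul, Pi.sub_apply, this, sub_zero]
    refine mul_le_of_le_one_left (norm_nonneg _) ?_
    rw [Real.norm_eq_abs, abs_le]
    have := h01 x
    constructor <;> linarith [this.1, this.2]

/-- Cutting off at infinity. -/
theorem IsW1.exists_cutoff (hu : IsW1 Set.univ u g) {δ : ℝ≥0∞} (hδ : 0 < δ) :
    ∃ a : E3 → ℝ, ContDiff ℝ ∞ a ∧ HasCompactSupport a ∧
      h1norm Set.univ (fun x => u x - a x • u x)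
        (fun i x => g i x - (a x • g i x + pd i a x • u x)) ≤ δ := by
  obtain ⟨ε, hε, hε'⟩ := exists_four_mul_le hδ
  have hε2 : ε / 2 ≠ 0 := (ENNReal.half_pos hε.ne').ne'
  obtain ⟨R₀, hR₀⟩ := eLpNorm_one_sub_cutoff hu.memLp_univ hε.ne'
  choose R₁ hR₁ using fun i => eLpNorm_one_sub_cutoff (hu.memLp_grad_univ i) hε2
  let b : ContDiffBump (0 : E3) := ⟨1, 2, by norm_num, by norm_num⟩
  have hb : ContDiff ℝ ∞ b := b.contDiff
  obtain ⟨-, -, ⟨C, hC⟩⟩ := IsMultiplier.of_hasCompactSupport hb b.hasCompactSupport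
  have hlim : Filter.Tendsto (fun n : ℕ => ENNReal.ofReal (((n : ℝ) + 1)⁻¹ * C) *
      eLpNorm u 2 volume) Filter.atTop (nhds 0) := by
    have h1 : Filter.Tendsto (fun n : ℕ => ((n : ℝ) + 1)⁻¹ * C) Filter.atTop (nhds 0) := by
      simpa [one_div] using (tendsto_one_div_add_atTop_nhds_zero_nat (𝕜 := ℝ)).mul_const C
    have h2 := ENNReal.tendsto_ofReal h1
    rw [ENNReal.ofReal_zero] at h2
    have h3 := ENNReal.Tendsto.mul_const h2 (b := eLpNorm u 2 volume)
      (.inr hu.memLp_univ.eLpNorm_ne_top)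
    rwa [zero_mul] at h3
  have hev := (hlim.eventually_le_const (pos_iff_ne_zero.2 hε2)).and
    ((Filter.eventually_ge_atTop ⌈R₀⌉₊).and
      (Filter.eventually_all.2 fun i => Filter.eventually_ge_atTop ⌈R₁ i⌉₊))
  obtain ⟨n, hn0, hn1, hn2⟩ := hev.exists
  -- The cut-off is x ↦ b(cx). Its gradient is of size c, so the term in which the derivative hits
  -- the cut-off tends to zero as n grows.
  set c : ℝ := ((n : ℝ) + 1)⁻¹
  have hc : 0 < c := by positivity
  have ha : ContDiff ℝ ∞ (fun x : E3 => b (c • x)) := hb.comp (contDiff_const_smul c)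
  have hone : ∀ x : E3, ‖x‖ ≤ n → b (c • x) = 1 := by
    intro x hx
    refine b.one_of_mem_closedBall ?_
    rw [mem_closedBall_zero_iff, norm_smul, Real.norm_of_nonneg hc.le]
    change c * ‖x‖ ≤ 1
    rw [inv_mul_le_iff₀ (by positivity)]
    linarith
  have hIcc : ∀ x : E3, b (c • x) ∈ Set.Icc (0 : ℝ) 1 := fun x => ⟨b.nonneg, b.le_one⟩
  refine ⟨fun x => b (c • x), ha, ?_, (h1norm_le ?_ fun i => ?_).trans hε'⟩
  · exact b.hasCompactSupport.comp_smul hc.ne'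
  · rw [Measure.restrict_univ]
    convert hR₀ _ ha.continuous hIcc fun x hx => hone x (hx.trans (Nat.ceil_le.1 hn1)) using 2
    ext x; rw [sub_smul, one_smul]
  · rw [Measure.restrict_univ]
    have e1 : (fun x => g i x - (b (c • x) • g i x + pd i (fun x => b (c • x)) x • u x)) =
        fun x => (1 - b (c • x)) • g i x - pd i (fun x => b (c • x)) x • u x := by
      ext x; rw [sub_smul, one_smul]; ring
    rw [e1]
    refine (eLpNorm_sub_le ?_ ?_ (by norm_num)).trans ((add_le_add ?_ ?_).trans_eq
      (ENNReal.add_halves ε))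
    · exact (continuous_const.sub ha.continuous).aestronglyMeasurable.smul (hu.memLp_grad_univ i).1
    · exact (contDiff_pd ha i).continuous.aestronglyMeasurable.smul hu.memLp_univ.1
    · exact hR₁ i _ ha.continuous hIcc fun x hx => hone x (hx.trans (Nat.ceil_le.1 (hn2 i)))
    · refine (eLpNorm_smul_le_of_bound (C := c * C) fun x => ?_).trans hn0
      rw [pd_comp_smul hb, abs_mul, abs_of_pos hc]
      gcongr
      exact hC i _

/-- After a cut-off at infinity the support is compact, and in the whole space mollification needs
no shift. This makes uniqueness for the free equation a case of Dirichlet uniqueness and yields test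
functions for traces. -/
theorem IsW1.isW10_univ (hu : IsW1 Set.univ u g) : IsW10 Set.univ u g := by
  refine IsW10.of_approx hu fun δ hδ => ?_
  obtain ⟨a, ha, hc, h⟩ := hu.exists_cutoff hδ
  refine ⟨_, _, (hu.smul (.of_hasCompactSupport ha hc)).isW10_of_shift isOpen_univ hc.isCompact
    (fun x hx => by simp [image_eq_zero_of_notMem_tsupport hx]) fun r hr => ⟨0, by simpa, by simp⟩, h⟩

open scoped Manifold in
/-- A finite smooth partition of unity on a compact set. -/
theorem exists_partition {K : Set E3} (hK : IsCompact K) {N : E3 → Set E3}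
    (hN : ∀ x ∈ K, IsOpen (N x) ∧ x ∈ N x) :
    ∃ (t : Finset E3) (θ : E3 → E3 → ℝ), (∀ j ∈ t, j ∈ K) ∧ (∀ j ∈ t, ContDiff ℝ ∞ (θ j)) ∧
      (∀ j ∈ t, HasCompactSupport (θ j)) ∧ (∀ j ∈ t, tsupport (θ j) ⊆ N j) ∧
      (∀ j ∈ t, ∀ x, θ j x ∈ Set.Icc (0 : ℝ) 1) ∧ ∀ x ∈ K, ∑ j ∈ t, θ j x = 1 := by
  classical
  -- The unit balls are there only to make the supports of the partition compact.
  obtain ⟨t, htK, htN⟩ := hK.elim_nhds_subcover (fun x => N x ∩ Metric.ball x 1) fun x hx =>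
    Filter.inter_mem ((hN x hx).1.mem_nhds (hN x hx).2) (Metric.ball_mem_nhds x one_pos)
  obtain ⟨f, hf⟩ := SmoothPartitionOfUnity.exists_isSubordinate 𝓘(ℝ, E3) hK.isClosed
    (fun j : t => N j ∩ Metric.ball (j : E3) 1)
    (fun j => (hN j (htK j j.2)).1.inter Metric.isOpen_ball) (by
      intro x hx
      obtain ⟨j, hj, hx'⟩ := Set.mem_iUnion₂.1 (htN hx)
      exact Set.mem_iUnion.2 ⟨⟨j, hj⟩, hx'⟩)
  have hval : ∀ j (hj : j ∈ t), (fun x => if h : j ∈ t then f ⟨j, h⟩ x else 0) = f ⟨j, hj⟩ := by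
    intro j hj; ext x; simp [hj]
  refine ⟨t, fun j x => if h : j ∈ t then f ⟨j, h⟩ x else 0, htK, fun j hj => ?_, fun j hj => ?_,
    fun j hj => ?_, fun j hj x => ?_, fun x hx => ?_⟩
  · beta_reduce
    rw [hval j hj]
    exact (f ⟨j, hj⟩).contMDiff.contDiff
  · beta_reduce
    rw [hval j hj]
    refine (isCompact_closedBall j 1).of_isClosed_subset (isClosed_tsupport _) ?_
    exact (hf ⟨j, hj⟩).trans (Set.inter_subset_right.trans Metric.ball_subset_closedBall)
  · beta_reduce
    rw [hval j hj]
    exact (hf ⟨j, hj⟩).trans Set.inter_subset_left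
  · simp only [hj, dite_true]
    exact ⟨f.nonneg _ _, f.le_one _ _⟩
  · rw [← f.sum_eq_one hx, finsum_eq_sum_of_fintype, ← Finset.sum_coe_sort t]
    exact Finset.sum_congr rfl fun j _ => by simp

/-- Membership in `H¹₀` is a local property. -/
theorem IsW1.isW10_of_local {K : Set E3} (hU : IsOpen U) (hu : IsW1 Set.univ u g) (hK : IsCompact K)
    (huK : ∀ x ∉ K, u x = 0) {N : E3 → Set E3} (hN : ∀ x ∈ K, IsOpen (N x) ∧ x ∈ N x)
    (hloc : ∀ x ∈ K, ∀ a : E3 → ℝ, ContDiff ℝ ∞ a → HasCompactSupport a → tsupport a ⊆ N x →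
      IsW10 U (fun y => a y • u y) (fun i y => a y • g i y + pd i a y • u y)) :
    IsW10 U u g := by
  obtain ⟨t, θ, h1, h2, h3, h4, -, h6⟩ := exists_partition hK hN
  have hs := IsW10.sum fun j hj => hloc j (h1 j hj) (θ j) (h2 j hj) (h3 j hj) (h4 j hj)
  have e1 : (fun x => ∑ j ∈ t, θ j x • u x) = u := by
    ext x
    rw [← Finset.sum_smul]
    by_cases hx : x ∈ K
    · rw [h6 x hx, one_smul]
    · rw [huK x hx, smul_zero]
  rw [e1] at hs
  -- The gradients need not be summed by hand: the pieces add up to `u`, and its weak gradient is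
  -- unique.
  exact hs.congr (ae_eq_refl _) fun i =>
    hs.toIsW1.grad_unique hU (hu.mono_set (Set.subset_univ _)) i

end Approx

/-! ### Boundary geometry -/

/-- Near `x₀ ∈ ∂Ω` the direction `d` points out of `Ω`, uniformly. -/
structure IsTransversal (Ω : Set E3) (d x₀ : E3) (r : ℝ) : Prop where
  pos : 0 < r
  ne_zero : d ≠ 0
  push : ∀ p ∈ Metric.ball x₀ r, p ∉ Ω → ∀ t : ℝ, 0 < t → p + t • d ∈ Metric.ball x₀ r →
    p + t • d ∈ (closure Ω)ᶜ
  lipschitz : ∃ C : ℝ, 0 ≤ C ∧ ∀ p ∈ frontier Ω ∩ Metric.ball x₀ r,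
    ∀ q ∈ frontier Ω ∩ Metric.ball x₀ r, ∀ τ : ℝ, ‖p - q‖ ≤ C * ‖p - q - τ • d‖

/-- Strict differentiability of the defining function ρ replaces the implicit function theorem. In a
small ball ρ increases along d at rate at least ℓ(d)/2, which gives `push`. On the boundary ρ = 0,
so ℓ(p - q) is small relative to p - q; thus p - q cannot be nearly parallel to d, which is the
Lipschitz bound. Allowing every d with ℓ(d) > 0 matters later, when a coordinate direction is split
into two outward ones. -/
theorem HasSmoothBoundary.exists_isTransversal {Ω : Set E3} (hΩ : IsOpen Ω)
    (hs : HasSmoothBoundary Ω) {x₀ : E3} (hx : x₀ ∈ frontier Ω) :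
    ∃ ℓ : E3 →L[ℝ] ℝ, ℓ ≠ 0 ∧ ∀ d, 0 < ℓ d → ∃ r, IsTransversal Ω d x₀ r := by
  obtain ⟨V, ρ, hV, hxV, hρ, hρ0, hΩV⟩ := hs x₀ hx
  refine ⟨fderiv ℝ ρ x₀, hρ0, fun d hd => ?_⟩
  set ℓ := fderiv ℝ ρ x₀
  have hd0 : d ≠ 0 := fun h => by simp [h] at hd
  have hdn : 0 < ‖d‖ := norm_pos_iff.2 hd0
  -- Chosen so that η‖d‖ = ℓ(d)/2: the error of the linearisation eats at most half of the increase
  -- along d.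
  set η : ℝ := ℓ d / (2 * ‖d‖)
  have hη : 0 < η := by positivity
  have hηd : η * ‖d‖ = ℓ d / 2 := by simp only [η]; field_simp
  have hstrict : HasStrictFDerivAt ρ ℓ x₀ :=
    (hρ.contDiffAt (hV.mem_nhds hxV)).hasStrictFDerivAt (by simp)
  have hlo := hstrict.isLittleO.def hη
  rw [nhds_prod_eq] at hlo
  obtain ⟨W, hW, hWρ⟩ := Filter.mem_prod_same_iff.1 hlo
  obtain ⟨r, hr, hrW⟩ := Metric.mem_nhds_iff.1 (Filter.inter_mem hW (hV.mem_nhds hxV))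
  have key : ∀ p ∈ Metric.ball x₀ r, ∀ q ∈ Metric.ball x₀ r,
      |ρ p - ρ q - ℓ (p - q)| ≤ η * ‖p - q‖ := fun p hp q hq =>
    hWρ (Set.mk_mem_prod (hrW hp).1 (hrW hq).1)
  have hmem : ∀ p ∈ Metric.ball x₀ r, (p ∈ Ω ↔ ρ p < 0) := by
    intro p hp
    have : p ∈ Ω ∩ V ↔ p ∈ {y ∈ V | ρ y < 0} := by rw [hΩV]
    simpa [(hrW hp).2] using this
  have hcl : ∀ p ∈ Metric.ball x₀ r, p ∈ closure Ω → ρ p ≤ 0 := by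
    intro p hp hpc
    by_contra h
    push Not at h
    have hc : ContinuousAt ρ p := hρ.continuousOn.continuousAt (hV.mem_nhds (hrW hp).2)
    have hn : {y | 0 < ρ y} ∩ Metric.ball x₀ r ∈ nhds p :=
      Filter.inter_mem (hc.eventually (lt_mem_nhds h)) (Metric.isOpen_ball.mem_nhds hp)
    obtain ⟨y, ⟨hy1, hy2⟩, hy3⟩ := mem_closure_iff_nhds.1 hpc _ hn
    exact lt_asymm hy1 ((hmem y hy2).1 hy3)
  have hfr : ∀ p ∈ Metric.ball x₀ r, p ∈ frontier Ω → ρ p = 0 := by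
    intro p hp hpf
    rw [hΩ.frontier_eq] at hpf
    exact le_antisymm (hcl p hp hpf.1) (not_lt.1 fun h => hpf.2 ((hmem p hp).2 h))
  refine ⟨r, hr, hd0, ?_, 1 + 2 / ℓ d * (η + ‖ℓ‖) * ‖d‖, by positivity, ?_⟩
  · intro p hp hpΩ t ht hpt hc
    have h1 : 0 ≤ ρ p := not_lt.1 fun h => hpΩ ((hmem p hp).2 h)
    have h2 := hcl _ hpt hc
    have h3 := (abs_le.1 (key _ hpt p hp)).1
    rw [add_sub_cancel_left, map_smul, smul_eq_mul, norm_smul, Real.norm_of_nonneg ht.le,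
      mul_left_comm, hηd] at h3
    nlinarith [mul_pos ht hd]
  · rintro p ⟨hp1, hp2⟩ q ⟨hq1, hq2⟩ τ
    have h1 := key p hp2 q hq2
    rw [hfr p hp2 hp1, hfr q hq2 hq1, sub_self, zero_sub, abs_neg] at h1
    set v := p - q - τ • d with hv
    have h2 : p - q = v + τ • d := by rw [hv]; abel
    have h3 : ‖p - q‖ ≤ ‖v‖ + |τ| * ‖d‖ := by
      rw [h2]; exact (norm_add_le _ _).trans (by rw [norm_smul, Real.norm_eq_abs])
    -- Applying ℓ to p - q = v + τd bounds τ by v, up to half of itself, which is then absorbed.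
    have h4 : |τ| * ℓ d ≤ |ℓ (p - q)| + ‖ℓ‖ * ‖v‖ := by
      have : τ * ℓ d = ℓ (p - q) - ℓ v := by rw [h2, map_add, map_smul, smul_eq_mul]; ring
      calc |τ| * ℓ d = |τ * ℓ d| := by rw [abs_mul, abs_of_pos hd]
        _ = |ℓ (p - q) - ℓ v| := by rw [this]
        _ ≤ |ℓ (p - q)| + |ℓ v| := abs_sub _ _
        _ ≤ _ := by gcongr; exact ℓ.le_opNorm v
    have h5 : |τ| * ℓ d ≤ η * ‖v‖ + |τ| * (ℓ d / 2) + ‖ℓ‖ * ‖v‖ := by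
      calc _ ≤ η * (‖v‖ + |τ| * ‖d‖) + ‖ℓ‖ * ‖v‖ := by
            refine h4.trans ?_
            gcongr
            exact h1.trans (by gcongr)
        _ = _ := by rw [← hηd]; ring
    have h6 : |τ| ≤ 2 / ℓ d * (η + ‖ℓ‖) * ‖v‖ := by
      rw [mul_assoc, div_mul_eq_mul_div, le_div_iff₀ hd]
      linarith
    calc _ ≤ ‖v‖ + |τ| * ‖d‖ := h3
      _ ≤ ‖v‖ + 2 / ℓ d * (η + ‖ℓ‖) * ‖v‖ * ‖d‖ := by gcongr
      _ = _ := by ring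

/-! ### The fundamental theorem of calculus on lines crossing the boundary -/

section Lines

variable {Ω : Set E3} {d x₀ : E3} {r : ℝ} {φ : E3 → ℂ}

theorem hasDerivAt_line (hφ : ContDiff ℝ ∞ φ) (p d : E3) (t : ℝ) :
    HasDerivAt (fun t : ℝ => φ (p + t • d)) (fderiv ℝ φ (p + t • d) d) t := by
  have h1 : HasDerivAt (fun t : ℝ => p + t • d) d t := by
    simpa using ((hasDerivAt_id t).smul_const d).const_add p
  exact (differentiable_of_smooth hφ _).hasFDerivAt.comp_hasDerivAt t h1

theorem integral_Ioi_line (hφ : ContDiff ℝ ∞ φ) (hc : HasCompactSupport φ) (hd : d ≠ 0) (p : E3)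
    (b : ℝ) : ∫ t in Set.Ioi b, fderiv ℝ φ (p + t • d) d = -φ (p + b • d) := by
  have hcs : HasCompactSupport (fun t : ℝ => φ (p + t • d)) := by
    refine hc.comp_isClosedEmbedding ?_
    exact (Homeomorph.addLeft p).isClosedEmbedding.comp (isClosedEmbedding_smul_left hd)
  have hcd : ContDiff ℝ 1 (fun t : ℝ => φ (p + t • d)) :=
    (hφ.comp (contDiff_const.add (contDiff_id.smul contDiff_const))).of_le (by simp)
  rw [← hcs.integral_Ioi_deriv_eq hcd b]
  refine setIntegral_congr_fun measurableSet_Ioi fun t _ => ?_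
  exact (hasDerivAt_line hφ p d t).deriv.symm

theorem fderiv_apply_eq_zero {x : E3} (hx : x ∉ tsupport φ) : fderiv ℝ φ x d = 0 := by
  rw [image_eq_zero_of_notMem_tsupport fun h => hx (tsupport_fderiv_subset ℝ h)]
  rfl

/-- The boundary value is minus the integral of the derivative along the outward ray from `p`. That
ray lies in the exterior as long as it stays in the ball, and outside the ball the derivative
vanishes. -/
theorem IsTransversal.norm_le_lintegral_line (h : IsTransversal Ω d x₀ r) (hΩ : IsOpen Ω)
    (hφ : ContDiff ℝ ∞ φ) (hc : HasCompactSupport φ) (hφr : tsupport φ ⊆ Metric.ball x₀ r) {p : E3}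
    (hp : p ∈ frontier Ω) (hpr : p ∈ Metric.ball x₀ r) :
    ‖φ p‖ₑ ≤ ∫⁻ t : ℝ, (closure Ω)ᶜ.indicator (fun x => ‖fderiv ℝ φ x d‖ₑ) (p + t • d) := by
  have h1 := integral_Ioi_line hφ hc h.ne_zero p 0
  rw [zero_smul, add_zero] at h1
  have hpΩ : p ∉ Ω := by
    rw [hΩ.frontier_eq] at hp
    exact hp.2
  calc ‖φ p‖ₑ = ‖∫ t in Set.Ioi (0 : ℝ), fderiv ℝ φ (p + t • d) d‖ₑ := by rw [h1, enorm_neg]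
    _ ≤ ∫⁻ t in Set.Ioi (0 : ℝ), ‖fderiv ℝ φ (p + t • d) d‖ₑ := enorm_integral_le_lintegral_enorm _
    _ ≤ ∫⁻ t in Set.Ioi (0 : ℝ),
        (closure Ω)ᶜ.indicator (fun x => ‖fderiv ℝ φ x d‖ₑ) (p + t • d) := by
        refine setLIntegral_mono' measurableSet_Ioi fun t ht => ?_
        by_cases hs : p + t • d ∈ tsupport φ
        · rw [Set.indicator_of_mem (h.push p hpr hpΩ t ht (hφr hs))]
        · simp [fderiv_apply_eq_zero hs]
    _ ≤ _ := setLIntegral_le_lintegral _ _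

/-- By `push`, once a line has entered the exterior it stays there within the ball. The integral is
therefore over a half-line, up to zeros of the derivative, and leaves only the value at the entry
point. -/
theorem IsTransversal.integral_line (h : IsTransversal Ω d x₀ r) (hΩ : IsOpen Ω)
    (hφ : ContDiff ℝ ∞ φ) (hc : HasCompactSupport φ) (hφr : tsupport φ ⊆ Metric.ball x₀ r) (p : E3) :
    ∫ t : ℝ, (closure Ω)ᶜ.indicator (fun x => fderiv ℝ φ x d) (p + t • d) = 0 ∨
    ∃ t : ℝ, p + t • d ∈ frontier Ω ∩ tsupport φ ∧
      ∫ t : ℝ, (closure Ω)ᶜ.indicator (fun x => fderiv ℝ φ x d) (p + t • d) = -φ (p + t • d) := by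
  have hΩc : ∀ x ∈ (closure Ω)ᶜ, x ∉ Ω := fun x hx hx' => hx (subset_closure hx')
  set E : Set ℝ := {t | p + t • d ∈ Metric.ball x₀ r ∩ (closure Ω)ᶜ}
  have hline : Continuous fun t : ℝ => p + t • d := by fun_prop
  have hEo : IsOpen E := (Metric.isOpen_ball.inter isClosed_closure.isOpen_compl).preimage hline
  have hzero : ∀ t ∉ E, (closure Ω)ᶜ.indicator (fun x => fderiv ℝ φ x d) (p + t • d) = 0 := by
    intro t ht
    by_cases h1 : p + t • d ∈ (closure Ω)ᶜ
    · rw [Set.indicator_of_mem h1]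
      exact fderiv_apply_eq_zero fun hs => ht ⟨hφr hs, h1⟩
    · exact Set.indicator_of_notMem h1 _
  rcases Set.eq_empty_or_nonempty E with hE | hE
  · left
    exact integral_eq_zero_of_ae (.of_forall fun t => hzero t (by rw [hE]; exact Set.notMem_empty t))
  have hbdd : BddBelow E := by
    have hdn : 0 < ‖d‖ := norm_pos_iff.2 h.ne_zero
    refine ⟨-((r + ‖x₀ - p‖) / ‖d‖), fun t ht => ?_⟩
    have h1 := mem_ball_iff_norm.1 ht.1
    have h2 : ‖t • d‖ ≤ ‖p + t • d - x₀‖ + ‖x₀ - p‖ := by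
      refine le_of_eq_of_le ?_ (norm_add_le _ _)
      congr 1; abel
    rw [norm_smul, Real.norm_eq_abs] at h2
    have h3 : |t| ≤ (r + ‖x₀ - p‖) / ‖d‖ := by
      rw [le_div_iff₀ hdn]; linarith
    exact (abs_le.1 h3).1
  -- The parameter at which the line enters the exterior.
  set b := sInf E
  have hint : ∫ t : ℝ, (closure Ω)ᶜ.indicator (fun x => fderiv ℝ φ x d) (p + t • d) =
      -φ (p + b • d) := by
    rw [← integral_Ioi_line hφ hc h.ne_zero p b, ← integral_indicator measurableSet_Ioi]
    refine integral_congr_ae ?_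
    have hne : ∀ᵐ t : ℝ, t ≠ b := by simp [ae_iff]
    filter_upwards [hne] with t ht
    rcases lt_or_gt_of_ne ht with hlt | hgt
    · rw [Set.indicator_of_notMem (s := Set.Ioi b) (by simpa using hlt.le)]
      exact hzero t fun htE => absurd (csInf_le hbdd htE) (not_le.2 hlt)
    · rw [Set.indicator_of_mem (s := Set.Ioi b) hgt]
      by_cases hs : p + t • d ∈ tsupport φ
      · obtain ⟨u, huE, hut⟩ := exists_lt_of_csInf_lt hE hgt
        have e1 : p + t • d = (p + u • d) + (t - u) • d := by rw [sub_smul]; abel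
        have := h.push _ huE.1 (hΩc _ huE.2) (t - u) (by linarith) (by rw [← e1]; exact hφr hs)
        rw [← e1] at this
        exact Set.indicator_of_mem this _
      · rw [fderiv_apply_eq_zero hs]
        by_cases h1 : p + t • d ∈ (closure Ω)ᶜ
        · rw [Set.indicator_of_mem h1, fderiv_apply_eq_zero hs]
        · exact Set.indicator_of_notMem h1 _
  by_cases h0 : φ (p + b • d) = 0
  · left; rw [hint, h0, neg_zero]
  right
  have hsupp : p + b • d ∈ tsupport φ := subset_tsupport _ h0
  refine ⟨b, ⟨?_, hsupp⟩, hint⟩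
  -- `E` is open, so its infimum is not attained. If `φ` is nonzero at the entry point, that point
  -- is in the ball and hence in the closure of `Ω`; as a limit of exterior points it is not in `Ω`.
  have hbE : b ∉ E := by
    intro hbE
    obtain ⟨ε, hε, hεE⟩ := Metric.isOpen_iff.1 hEo b hbE
    have huE : b - ε / 2 ∈ E := hεE (by
      rw [Metric.mem_ball, Real.dist_eq, sub_sub_cancel_left, abs_neg, abs_of_pos (by positivity)]
      linarith)
    linarith [csInf_le hbdd huE]
  have hbc : p + b • d ∈ closure Ω := by
    by_contra hb
    exact hbE ⟨hφr hsupp, hb⟩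
  rw [hΩ.frontier_eq]
  refine ⟨hbc, fun hbΩ => ?_⟩
  have hn : {t : ℝ | p + t • d ∈ Ω} ∈ nhds b := (hΩ.preimage hline).mem_nhds hbΩ
  obtain ⟨u, hu1, hu2⟩ := mem_closure_iff_nhds.1 (csInf_mem_closure hE hbdd) _ hn
  exact hΩc _ hu2.2 hu1

end Lines

/-- Straightening a direction. -/
theorem exists_straightening {d : E3} (hd : d ≠ 0) :
    ∃ (A : E3 ≃L[ℝ] (Fin 2 → ℝ) × ℝ) (κ : ℝ≥0∞), A d = (0, 1) ∧ κ ≠ 0 ∧ κ ≠ ⊤ ∧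
      (volume : Measure E3) = κ • (volume : Measure ((Fin 2 → ℝ) × ℝ)).map A.symm := by
  have hfin : Module.finrank ℝ E3 = Module.finrank ℝ ((Fin 2 → ℝ) × ℝ) := by simp
  let A₀ : E3 ≃L[ℝ] (Fin 2 → ℝ) × ℝ := ContinuousLinearEquiv.ofFinrankEq hfin
  obtain ⟨B, hB⟩ := SeparatingDual.exists_continuousLinearEquiv_apply_eq (R := ℝ)
    (x := A₀ d) (y := ((0, 1) : (Fin 2 → ℝ) × ℝ)) (by simpa using hd) (by simp)
  let A := A₀.trans B
  have hV : (volume : Measure ((Fin 2 → ℝ) × ℝ)).IsAddHaarMeasure := by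
    rw [Measure.volume_eq_prod]; infer_instance
  have hH : ((volume : Measure ((Fin 2 → ℝ) × ℝ)).map A.symm).IsAddHaarMeasure :=
    A.symm.isAddHaarMeasure_map _
  refine ⟨A, (Measure.addHaarScalarFactor (volume : Measure E3)
    ((volume : Measure ((Fin 2 → ℝ) × ℝ)).map A.symm) : ℝ≥0∞), hB, ?_, ENNReal.coe_ne_top,
    Measure.isAddLeftInvariant_eq_smul _ _⟩
  exact ENNReal.coe_ne_zero.2 (Measure.addHaarScalarFactor_pos_of_isAddHaarMeasure _ _).ne'

/-! ### Surface integrals -/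

/-- A `K`-Lipschitz map enlarges two-dimensional Hausdorff measure by at most K², and on `Fin 2 → ℝ`
with the sup metric this measure is Lebesgue measure. Together with `setLIntegral_le_image` it
replaces the area formula by bounds in both directions. -/
theorem setLIntegral_image_le {S : Set E3} (hS : MeasurableSet S) {π : E3 → Fin 2 → ℝ}
    (hπm : Measurable π) {K : NNReal} (hπ : LipschitzWith K π) {σ : (Fin 2 → ℝ) → E3}
    (hσ : ∀ p ∈ S, σ (π p) = p) (F : E3 → ℝ≥0∞) :
    ∫⁻ a in π '' S, F (σ a) ≤ (K : ℝ≥0∞) ^ (2 : ℝ) *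
      ∫⁻ p in S, F p ∂(Measure.hausdorffMeasure 2) := by
  have hv : (volume : Measure (Fin 2 → ℝ)) = Measure.hausdorffMeasure 2 := by
    rw [← hausdorffMeasure_pi_real]; simp
  have hle : (volume : Measure (Fin 2 → ℝ)).restrict (π '' S) ≤ ((K : ℝ≥0∞) ^ (2 : ℝ)) •
      ((Measure.hausdorffMeasure 2 : Measure E3).restrict S).map π := by
    refine Measure.le_iff.2 fun B hB => ?_
    rw [Measure.restrict_apply hB, Measure.smul_apply, Measure.map_apply hπm hB,
      Measure.restrict_apply (hπm hB), smul_eq_mul, hv]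
    refine (measure_mono ?_).trans (hπ.lipschitzOnWith (s := π ⁻¹' B ∩ S) |>.hausdorffMeasure_image_le
      (by norm_num))
    rintro _ ⟨hb, p, hp, rfl⟩
    exact ⟨p, ⟨hb, hp⟩, rfl⟩
  calc _ ≤ ∫⁻ a, F (σ a) ∂(((K : ℝ≥0∞) ^ (2 : ℝ)) •
        ((Measure.hausdorffMeasure 2 : Measure E3).restrict S).map π) := lintegral_mono' hle le_rfl
    _ = (K : ℝ≥0∞) ^ (2 : ℝ) *
        ∫⁻ a, F (σ a) ∂((Measure.hausdorffMeasure 2 : Measure E3).restrict S).map π := by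
        rw [lintegral_smul_measure, smul_eq_mul]
    -- `lintegral_map_le` needs no measurability of `F ∘ σ`.
    _ ≤ (K : ℝ≥0∞) ^ (2 : ℝ) * ∫⁻ p in S, F (σ (π p)) ∂(Measure.hausdorffMeasure 2) := by
        gcongr; exact lintegral_map_le _ _
    _ = _ := by
        rw [setLIntegral_congr_fun hS fun p hp => by rw [hσ p hp]]

/-- The opposite comparison, obtained from the Lipschitz parametrisation `σ` instead of the
projection. -/
theorem setLIntegral_le_image {S : Set E3} {P : Set (Fin 2 → ℝ)} (hP : MeasurableSet P)
    {σ : (Fin 2 → ℝ) → E3} {L : NNReal} (hL : LipschitzOnWith L σ P) (hσ : S ⊆ σ '' P)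
    {F : E3 → ℝ≥0∞} (hF : Measurable F) :
    ∫⁻ p in S, F p ∂(Measure.hausdorffMeasure 2) ≤ (L : ℝ≥0∞) ^ (2 : ℝ) * ∫⁻ a in P, F (σ a) := by
  have hv : (volume : Measure (Fin 2 → ℝ)) = Measure.hausdorffMeasure 2 := by
    rw [← hausdorffMeasure_pi_real]; simp
  have hσm : AEMeasurable σ ((volume : Measure (Fin 2 → ℝ)).restrict P) :=
    hL.continuousOn.aemeasurable hP
  have hle : (Measure.hausdorffMeasure 2 : Measure E3).restrict S ≤ ((L : ℝ≥0∞) ^ (2 : ℝ)) •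
      ((volume : Measure (Fin 2 → ℝ)).restrict P).map σ := by
    refine Measure.le_iff.2 fun B hB => ?_
    rw [Measure.restrict_apply hB, Measure.smul_apply, Measure.map_apply_of_aemeasurable hσm hB,
      smul_eq_mul, Measure.restrict_apply' hP, hv]
    refine (measure_mono ?_).trans ((hL.mono Set.inter_subset_right
      (s := σ ⁻¹' B ∩ P)).hausdorffMeasure_image_le (by norm_num))
    rintro p ⟨hb, hp⟩
    obtain ⟨a, ha, rfl⟩ := hσ hp
    exact ⟨a, ⟨hb, ha⟩, rfl⟩
  calc _ ≤ ∫⁻ p, F p ∂(((L : ℝ≥0∞) ^ (2 : ℝ)) •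
        ((volume : Measure (Fin 2 → ℝ)).restrict P).map σ) := lintegral_mono' hle le_rfl
    _ = _ := by rw [lintegral_smul_measure, smul_eq_mul, lintegral_map' hF.aemeasurable hσm]

/-! ### Trace and flux inequalities near a boundary point -/

section LocalEstimates

variable {Ω : Set E3} {d x₀ : E3} {r r' : ℝ}

/-- The graph structure of the boundary over the plane transversal to `d`. -/
theorem IsTransversal.exists_graph (h : IsTransversal Ω d x₀ r) (hr' : r' < r)
    (A : E3 ≃L[ℝ] (Fin 2 → ℝ) × ℝ) (hA : A d = (0, 1)) :
    ∃ (σ : (Fin 2 → ℝ) → E3) (L : NNReal),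
      (∀ p ∈ frontier Ω ∩ Metric.closedBall x₀ r', σ (A p).1 = p) ∧
      LipschitzOnWith L σ ((fun p => (A p).1) '' (frontier Ω ∩ Metric.closedBall x₀ r')) := by
  obtain ⟨C, hC, hl⟩ := h.lipschitz
  set S := frontier Ω ∩ Metric.closedBall x₀ r'
  have hSb : S ⊆ frontier Ω ∩ Metric.ball x₀ r :=
    Set.inter_subset_inter_right _ (Metric.closedBall_subset_ball hr')
  set π : E3 → Fin 2 → ℝ := fun p => (A p).1
  set M : ℝ := ‖(A.symm : (Fin 2 → ℝ) × ℝ →L[ℝ] E3)‖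
  have key : ∀ p ∈ S, ∀ q ∈ S, ‖p - q‖ ≤ C * M * ‖π p - π q‖ := by
    intro p hp q hq
    set τ : ℝ := (A p).2 - (A q).2
    -- Removing the difference of heights along d leaves a vector determined by the projections
    -- alone, to which the transversality bound applies.
    have e1 : p - q - τ • d = A.symm (π p - π q, 0) := by
      apply A.injective
      rw [A.apply_symm_apply, map_sub, map_sub, map_smul, hA]
      ext <;> simp [π, τ]
    have e2 : ‖A.symm (π p - π q, (0 : ℝ))‖ ≤ M * ‖π p - π q‖ := by
      refine ((A.symm : (Fin 2 → ℝ) × ℝ →L[ℝ] E3).le_opNorm _).trans_eq ?_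
      simp [M, Prod.norm_def]
    calc _ ≤ C * ‖p - q - τ • d‖ := hl p (hSb hp) q (hSb hq) τ
      _ ≤ C * (M * ‖π p - π q‖) := by rw [e1]; gcongr
      _ = _ := by ring
  have hinj : Set.InjOn π S := by
    intro p hp q hq hpq
    have := key p hp q hq
    rw [hpq, sub_self, norm_zero, mul_zero] at this
    exact sub_eq_zero.1 (norm_eq_zero.1 (le_antisymm this (norm_nonneg _)))
  have : Nonempty E3 := ⟨0⟩
  refine ⟨Function.invFunOn π S, Real.toNNReal (C * M), fun p hp => hinj.leftInvOn_invFunOn hp, ?_⟩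
  refine LipschitzOnWith.of_dist_le_mul ?_
  rintro _ ⟨p, hp, rfl⟩ _ ⟨q, hq, rfl⟩
  rw [hinj.leftInvOn_invFunOn hp, hinj.leftInvOn_invFunOn hq, dist_eq_norm, dist_eq_norm,
    Real.coe_toNNReal _ (by positivity)]
  exact key p hp q hq

theorem symm_eq_add_smul (A : E3 ≃L[ℝ] (Fin 2 → ℝ) × ℝ) (hA : A d = (0, 1)) (a : Fin 2 → ℝ) (t : ℝ) :
    A.symm (a, t) = A.symm (a, 0) + t • d := by
  apply A.injective
  rw [map_add, map_smul, hA, A.apply_symm_apply, A.apply_symm_apply]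
  ext <;> simp

theorem isCompact_frontier_inter (Ω : Set E3) (x₀ : E3) (r : ℝ) :
    IsCompact (frontier Ω ∩ Metric.closedBall x₀ r) :=
  (isCompact_closedBall x₀ r).inter_left isClosed_frontier

theorem lintegral_surfaceMeasure_eq {S : Set E3} (hS : MeasurableSet S) {F : E3 → ℝ≥0∞}
    (hF : ∀ x ∉ S, F x = 0) :
    ∫⁻ x, F x ∂(surfaceMeasure Ω) = ∫⁻ x in frontier Ω ∩ S, F x ∂(Measure.hausdorffMeasure 2) := by
  have : F = S.indicator F := by
    ext x
    by_cases hx : x ∈ S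
    · rw [Set.indicator_of_mem hx]
    · rw [Set.indicator_of_notMem hx, hF x hx]
  rw [this, lintegral_indicator hS, surfaceMeasure, Measure.restrict_restrict hS, ← this,
    Set.inter_comm]

/-- The trace inequality near a boundary point. -/
theorem IsTransversal.trace_le (h : IsTransversal Ω d x₀ r) (hΩ : IsOpen Ω) (hr' : r' < r) :
    ∃ C : ℝ≥0∞, C ≠ ⊤ ∧ ∀ φ : E3 → ℂ, ContDiff ℝ ∞ φ → HasCompactSupport φ →
      tsupport φ ⊆ Metric.closedBall x₀ r' →
      ∫⁻ x, ‖φ x‖ₑ ∂(surfaceMeasure Ω) ≤ C * ∫⁻ x in (closure Ω)ᶜ, ‖fderiv ℝ φ x d‖ₑ := by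
  obtain ⟨A, κ, hA, hκ0, hκ, hvol⟩ := exists_straightening h.ne_zero
  obtain ⟨σ, L, hσ, hL⟩ := h.exists_graph hr' A hA
  refine ⟨(L : ℝ≥0∞) ^ (2 : ℝ) * κ⁻¹, ENNReal.mul_ne_top
    (ENNReal.rpow_ne_top_of_nonneg (by norm_num) ENNReal.coe_ne_top) (ENNReal.inv_ne_top.2 hκ0),
    fun φ hφ hc hs => ?_⟩
  set S := frontier Ω ∩ Metric.closedBall x₀ r'
  set H : E3 → ℝ≥0∞ := (closure Ω)ᶜ.indicator fun x => ‖fderiv ℝ φ x d‖ₑ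
  have hH : Measurable H := by
    refine Measurable.indicator ?_ isClosed_closure.isOpen_compl.measurableSet
    exact (((hφ.continuous_fderiv (by simp)).clm_apply continuous_const).measurable).enorm
  have hPc : IsCompact ((fun p => (A p).1) '' S) :=
    (isCompact_frontier_inter Ω x₀ r').image (by fun_prop)
  have hsurf : ∫⁻ x, ‖φ x‖ₑ ∂(surfaceMeasure Ω) =
      ∫⁻ x in S, ‖φ x‖ₑ ∂(Measure.hausdorffMeasure 2) :=
    lintegral_surfaceMeasure_eq Metric.isClosed_closedBall.measurableSet fun x hx => by
      rw [image_eq_zero_of_notMem_tsupport fun h => hx (hs h), enorm_zero]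
  have hline : ∀ a ∈ (fun p => (A p).1) '' S, ‖φ (σ a)‖ₑ ≤ ∫⁻ t : ℝ, H (A.symm (a, t)) := by
    rintro _ ⟨p, hp, rfl⟩
    simp only
    rw [hσ p hp]
    refine (h.norm_le_lintegral_line hΩ hφ hc (hs.trans (Metric.closedBall_subset_ball hr')) hp.1
      (Metric.closedBall_subset_ball hr' hp.2)).trans_eq ?_
    -- The ray was parametrised from `p`; shifting by the height of `p` makes it the coordinate line
    -- over its projection.
    rw [← lintegral_add_left_eq_self (fun t : ℝ => H (A.symm ((A p).1, t))) (A p).2]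
    refine lintegral_congr fun t => ?_
    have : A.symm ((A p).1, (A p).2 + t) = p + t • d := by
      rw [symm_eq_add_smul A hA, add_smul, ← add_assoc, ← symm_eq_add_smul A hA]
      simp
    rw [this]
  calc _ = ∫⁻ x in S, ‖φ x‖ₑ ∂(Measure.hausdorffMeasure 2) := hsurf
    _ ≤ (L : ℝ≥0∞) ^ (2 : ℝ) * ∫⁻ a in (fun p => (A p).1) '' S, ‖φ (σ a)‖ₑ :=
        setLIntegral_le_image hPc.measurableSet hL
          (fun p hp => ⟨_, ⟨p, hp, rfl⟩, hσ p hp⟩) hφ.continuous.measurable.enorm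
    _ ≤ (L : ℝ≥0∞) ^ (2 : ℝ) * ∫⁻ a, ∫⁻ t : ℝ, H (A.symm (a, t)) := by
        exact mul_le_mul' le_rfl
          ((setLIntegral_mono' hPc.measurableSet hline).trans (setLIntegral_le_lintegral _ _))
    _ = (L : ℝ≥0∞) ^ (2 : ℝ) * κ⁻¹ * ∫⁻ x, H x := by
        rw [hvol, lintegral_smul_measure, smul_eq_mul, lintegral_map hH A.symm.continuous.measurable,
          Measure.volume_eq_prod, lintegral_prod (fun z => H (A.symm z))
            (hH.comp A.symm.continuous.measurable).aemeasurable,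
          mul_assoc, ← mul_assoc κ⁻¹, ENNReal.inv_mul_cancel hκ0 hκ, one_mul]
    _ = _ := by rw [lintegral_indicator isClosed_closure.isOpen_compl.measurableSet]

/-- The divergence theorem, as an inequality, near a boundary point. -/
theorem IsTransversal.integral_le (h : IsTransversal Ω d x₀ r) (hΩ : IsOpen Ω) (hr' : r' < r) :
    ∃ C : ℝ≥0∞, C ≠ ⊤ ∧ ∀ φ : E3 → ℂ, ContDiff ℝ ∞ φ → HasCompactSupport φ →
      tsupport φ ⊆ Metric.closedBall x₀ r' →
      ‖∫ x in (closure Ω)ᶜ, fderiv ℝ φ x d‖ₑ ≤ C * ∫⁻ x, ‖φ x‖ₑ ∂(surfaceMeasure Ω) := by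
  obtain ⟨A, κ, hA, hκ0, hκ, hvol⟩ := exists_straightening h.ne_zero
  obtain ⟨σ, L, hσ, -⟩ := h.exists_graph hr' A hA
  set π : E3 →L[ℝ] (Fin 2 → ℝ) :=
    (ContinuousLinearMap.fst ℝ _ _) ∘L (A : E3 →L[ℝ] (Fin 2 → ℝ) × ℝ)
  refine ⟨κ * (‖π‖₊ : ℝ≥0∞) ^ (2 : ℝ), ENNReal.mul_ne_top hκ
    (ENNReal.rpow_ne_top_of_nonneg (by norm_num) ENNReal.coe_ne_top), fun φ hφ hc hs => ?_⟩
  set S := frontier Ω ∩ Metric.closedBall x₀ r'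
  have hSc : IsCompact S := isCompact_frontier_inter Ω x₀ r'
  set G : E3 → ℂ := (closure Ω)ᶜ.indicator fun x => fderiv ℝ φ x d
  have hext : MeasurableSet (closure Ω)ᶜ := isClosed_closure.isOpen_compl.measurableSet
  have hGi : Integrable G volume := by
    refine Integrable.indicator ?_ hext
    exact ((hφ.continuous_fderiv (by simp)).clm_apply continuous_const).integrable_of_hasCompactSupport
      (hc.fderiv_apply ℝ d)
  have hsurf : ∫⁻ x, ‖φ x‖ₑ ∂(surfaceMeasure Ω) =
      ∫⁻ x in S, ‖φ x‖ₑ ∂(Measure.hausdorffMeasure 2) :=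
    lintegral_surfaceMeasure_eq Metric.isClosed_closedBall.measurableSet fun x hx => by
      rw [image_eq_zero_of_notMem_tsupport fun h => hx (hs h), enorm_zero]
  have hPc : IsCompact (π '' S) := hSc.image π.continuous
  -- A line over `a` contributes either nothing or the value at a boundary point above `a`, and `σ`
  -- recovers that point from `a`.
  have hline : ∀ a, ‖∫ t : ℝ, G (A.symm (a, t))‖ₑ ≤ (π '' S).indicator (fun a => ‖φ (σ a)‖ₑ) a := by
    intro a
    rw [show (fun t : ℝ => G (A.symm (a, t))) = fun t => G (A.symm (a, 0) + t • d) from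
      funext fun t => congrArg G (symm_eq_add_smul A hA a t)]
    rcases h.integral_line hΩ hφ hc (hs.trans (Metric.closedBall_subset_ball hr')) (A.symm (a, 0))
      with h0 | ⟨t, ht, h0⟩
    · rw [h0, enorm_zero]; exact zero_le
    · rw [h0, enorm_neg]
      have hS : A.symm (a, 0) + t • d ∈ S := ⟨ht.1, hs ht.2⟩
      have hπ : π (A.symm (a, 0) + t • d) = a := by
        rw [← symm_eq_add_smul A hA]
        change (A (A.symm (a, t))).1 = a
        rw [A.apply_symm_apply]
      have ha : a ∈ (fun p => π p) '' S := ⟨_, hS, hπ⟩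
      rw [Set.indicator_of_mem ha]
      have := hσ _ hS
      rw [show (A (A.symm (a, 0) + t • d)).1 = a from hπ] at this
      rw [this]
  have hG2 : Integrable G ((volume : Measure ((Fin 2 → ℝ) × ℝ)).map A.symm) := by
    rw [hvol] at hGi
    exact (integrable_smul_measure hκ0 hκ).1 hGi
  have hG3 : Integrable (fun z => G (A.symm z)) (volume : Measure ((Fin 2 → ℝ) × ℝ)) :=
    hG2.comp_measurable A.symm.continuous.measurable
  calc _ = ‖∫ x, G x‖ₑ := by rw [integral_indicator hext]
    _ = κ * ‖∫ z : (Fin 2 → ℝ) × ℝ, G (A.symm z)‖ₑ := by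
        rw [hvol, integral_smul_measure, integral_map A.symm.continuous.measurable.aemeasurable hG2.1,
          enorm_smul, Real.enorm_of_nonneg ENNReal.toReal_nonneg, ENNReal.ofReal_toReal hκ]
    _ = κ * ‖∫ a, ∫ t : ℝ, G (A.symm (a, t))‖ₑ := by
        rw [Measure.volume_eq_prod] at hG3 ⊢
        rw [integral_prod _ hG3]
    _ ≤ κ * ∫⁻ a, (π '' S).indicator (fun a => ‖φ (σ a)‖ₑ) a := by
        gcongr
        exact (enorm_integral_le_lintegral_enorm _).trans (lintegral_mono hline)
    _ = κ * ∫⁻ a in π '' S, ‖φ (σ a)‖ₑ := by rw [lintegral_indicator hPc.measurableSet]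
    _ ≤ κ * ((‖π‖₊ : ℝ≥0∞) ^ (2 : ℝ) * ∫⁻ x in S, ‖φ x‖ₑ ∂(Measure.hausdorffMeasure 2)) := by
        gcongr
        exact setLIntegral_image_le hSc.measurableSet π.continuous.measurable π.lipschitz
          (σ := σ) hσ (fun x => ‖φ x‖ₑ)
    _ = _ := by rw [hsurf, mul_assoc]

end LocalEstimates

/-! ### Global estimates on the boundary -/

theorem lintegral_enorm_mul_le {μ : Measure E3} {f g : E3 → ℂ} (hf : AEStronglyMeasurable f μ)
    (hg : AEStronglyMeasurable g μ) :
    ∫⁻ x, ‖f x‖ₑ * ‖g x‖ₑ ∂μ ≤ eLpNorm f 2 μ * eLpNorm g 2 μ := by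
  calc _ = eLpNorm (f • g) 1 μ := by
        rw [eLpNorm_one_eq_lintegral_enorm]
        simp only [Pi.smul_apply', smul_eq_mul, enorm_mul]
    _ ≤ _ := eLpNorm_smul_le_mul_eLpNorm (p := 2) (q := 2) (r := 1) hg hf

theorem integral_fderiv_eq_zero {φ : E3 → ℂ} (hφ : IsTest Set.univ φ) (d : E3) :
    ∫ x, fderiv ℝ φ x d = 0 := by
  have hi : Integrable (fun x => fderiv ℝ φ x d) volume :=
    ((hφ.1.continuous_fderiv (by simp)).clm_apply continuous_const).integrable_of_hasCompactSupport
      (hφ.2.fderiv_apply ℝ d)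
  have := integral_mul_fderiv_eq_neg_fderiv_mul_of_integrable (μ := volume) (f := fun _ : E3 => (1 : ℂ))
    (g := φ) (v := d) (by simp) (by simpa using hi)
    (by simpa using hφ.continuous.integrable_of_hasCompactSupport hφ.2)
    (fun x _ => differentiableAt_const _) (fun x _ => differentiable_of_smooth hφ.1 x)
  simpa using this

section Global

variable {Ω : Set E3}

/-- Inside either open side the flux is zero. At a boundary point the coordinate vector is the
difference of the outward directions e_i + n and n, and the estimate for outward directions applies
to each. -/
theorem exists_local_flux (hΩ : IsOpen Ω) (hs : HasSmoothBoundary Ω) (i : Fin 3) (x₀ : E3) :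
    ∃ N : Set E3, (IsOpen N ∧ x₀ ∈ N) ∧ ∃ C : ℝ≥0∞, C ≠ ⊤ ∧ ∀ φ : E3 → ℂ, IsTest N φ →
      ‖∫ x in (closure Ω)ᶜ, pd i φ x‖ₑ ≤ C * ∫⁻ x, ‖φ x‖ₑ ∂(surfaceMeasure Ω) := by
  by_cases h1 : x₀ ∈ (closure Ω)ᶜ
  · refine ⟨(closure Ω)ᶜ, ⟨isClosed_closure.isOpen_compl, h1⟩, 0, ENNReal.zero_ne_top,
      fun φ hφ => ?_⟩
    rw [setIntegral_eq_integral_of_forall_compl_eq_zero fun x hx => (hφ.pd i).eq_zero hx]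
    rw [show ∫ x, pd i φ x = 0 from integral_fderiv_eq_zero (hφ.mono (Set.subset_univ _)) _]
    simp
  by_cases h2 : x₀ ∈ Ω
  · refine ⟨Ω, ⟨hΩ, h2⟩, 0, ENNReal.zero_ne_top, fun φ hφ => ?_⟩
    rw [setIntegral_eq_zero_of_forall_eq_zero fun x (hx : x ∈ (closure Ω)ᶜ) =>
      (hφ.pd i).eq_zero fun h => hx (subset_closure h)]
    simp
  have h3 : x₀ ∈ frontier Ω := by
    rw [hΩ.frontier_eq]; exact ⟨not_not.1 h1, h2⟩
  obtain ⟨ℓ, hℓ, H⟩ := hs.exists_isTransversal hΩ h3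
  obtain ⟨v, hv⟩ : ∃ v, ℓ v ≠ 0 := by
    by_contra! h; exact hℓ (ContinuousLinearMap.ext h)
  -- Scaled so that ℓ(n) = 1 + |ℓ(e_i)|, which makes both ℓ(n) and ℓ(e_i + n) positive.
  set n := ((1 + |ℓ (e i)|) * (ℓ v)⁻¹) • v
  have hn : ℓ n = 1 + |ℓ (e i)| := by
    simp only [n, map_smul, smul_eq_mul]; field_simp
  obtain ⟨r₁, hr₁⟩ := H (e i + n) (by
    rw [map_add, hn]; linarith [neg_abs_le (ℓ (e i))])
  obtain ⟨r₂, hr₂⟩ := H n (by rw [hn]; positivity)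
  have hr : 0 < min r₁ r₂ := lt_min hr₁.pos hr₂.pos
  obtain ⟨C₁, hC₁, H₁⟩ := hr₁.integral_le hΩ (r' := min r₁ r₂ / 2)
    ((half_lt_self hr).trans_le (min_le_left _ _))
  obtain ⟨C₂, hC₂, H₂⟩ := hr₂.integral_le hΩ (r' := min r₁ r₂ / 2)
    ((half_lt_self hr).trans_le (min_le_right _ _))
  refine ⟨Metric.ball x₀ (min r₁ r₂ / 2), ⟨Metric.isOpen_ball, Metric.mem_ball_self (half_pos hr)⟩,
    C₁ + C₂, ENNReal.add_ne_top.2 ⟨hC₁, hC₂⟩, fun φ hφ => ?_⟩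
  have hsub := hφ.3.trans Metric.ball_subset_closedBall
  have hi (d : E3) : Integrable (fun x => fderiv ℝ φ x d) (volume.restrict (closure Ω)ᶜ) :=
    (((hφ.1.continuous_fderiv (by simp)).clm_apply
      continuous_const).integrable_of_hasCompactSupport (hφ.2.fderiv_apply ℝ d)).restrict
  have : ∫ x in (closure Ω)ᶜ, pd i φ x = (∫ x in (closure Ω)ᶜ, fderiv ℝ φ x (e i + n)) -
      ∫ x in (closure Ω)ᶜ, fderiv ℝ φ x n := by
    rw [← integral_sub (hi _) (hi _)]
    simp [pd]
  rw [this, add_mul]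
  exact (enorm_sub_le).trans (add_le_add (H₁ φ hφ.1 hφ.2 hsub) (H₂ φ hφ.1 hφ.2 hsub))

/-- The partition of unity acts inside the derivative: φ is the sum of the θ_j φ, so no derivative
of θ_j survives and the bound contains boundary values only. The constant depends on `K` but not on
`φ`. -/
theorem exists_flux_le (hΩ : IsOpen Ω) (hs : HasSmoothBoundary Ω) (i : Fin 3) {K : Set E3}
    (hK : IsCompact K) : ∃ C : ℝ≥0∞, C ≠ ⊤ ∧ ∀ φ : E3 → ℂ, IsTest Set.univ φ → tsupport φ ⊆ K →
      ‖∫ x in (closure Ω)ᶜ, pd i φ x‖ₑ ≤ C * ∫⁻ x, ‖φ x‖ₑ ∂(surfaceMeasure Ω) := by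
  choose N hN C hC H using exists_local_flux hΩ hs i
  obtain ⟨t, θ, -, h2, h3, h4, h5, h6⟩ := exists_partition hK fun x _ => hN x
  refine ⟨∑ j ∈ t, C j, ENNReal.sum_ne_top.2 fun j _ => hC j, fun φ hφ hφK => ?_⟩
  have hsum : φ = fun x => ∑ j ∈ t, θ j x • φ x := by
    ext x
    rw [← Finset.sum_smul]
    by_cases hx : x ∈ K
    · rw [h6 x hx, one_smul]
    · rw [image_eq_zero_of_notMem_tsupport fun h => hx (hφK h), smul_zero]
  have htest : ∀ j ∈ t, IsTest (N j) fun x => θ j x • φ x := fun j hj =>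
    hφ.smul_of_subset (h2 j hj) (Set.inter_subset_left.trans (h4 j hj))
  have hpd : ∀ x, pd i φ x = ∑ j ∈ t, pd i (fun x => θ j x • φ x) x := fun x => by
    rw [← pd_sum t (fun j hj => (htest j hj).1), ← hsum]
  simp_rw [hpd]
  rw [integral_finsetSum _ fun j hj => memLp_one_iff_integrable.1 (((htest j hj).pd i).memLp 1 _),
    Finset.sum_mul]
  refine (enorm_sum_le _ _).trans (Finset.sum_le_sum fun j hj => ?_)
  refine (H j _ (htest j hj)).trans ?_
  gcongr with x
  rw [enorm_smul, Real.enorm_eq_ofReal (h5 j hj x).1]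
  exact mul_le_of_le_one_left zero_le (ENNReal.ofReal_le_one.2 (h5 j hj x).2)

/-- The `L¹` trace inequality for one outward direction d; expanding d in coordinates bounds the
directional derivative by the partial ones. -/
theorem exists_local_trace (hΩ : IsOpen Ω) (hs : HasSmoothBoundary Ω) {x₀ : E3}
    (hx : x₀ ∈ frontier Ω) :
    ∃ N : Set E3, (IsOpen N ∧ x₀ ∈ N) ∧ ∃ C : ℝ≥0∞, C ≠ ⊤ ∧ ∀ φ : E3 → ℂ, IsTest N φ →
      ∫⁻ x, ‖φ x‖ₑ ∂(surfaceMeasure Ω) ≤ C * ∑ i, ∫⁻ x in (closure Ω)ᶜ, ‖pd i φ x‖ₑ := by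
  obtain ⟨ℓ, hℓ, H⟩ := hs.exists_isTransversal hΩ hx
  obtain ⟨v, hv⟩ : ∃ v, ℓ v ≠ 0 := by
    by_contra! h; exact hℓ (ContinuousLinearMap.ext h)
  set d := (ℓ v)⁻¹ • v
  obtain ⟨r, hr⟩ := H d (by
    simp only [d, map_smul, smul_eq_mul]
    rw [inv_mul_cancel₀ hv]
    exact one_pos)
  obtain ⟨C, hC, H⟩ := hr.trace_le hΩ (half_lt_self hr.pos)
  refine ⟨Metric.ball x₀ (r / 2), ⟨Metric.isOpen_ball, Metric.mem_ball_self (half_pos hr.pos)⟩,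
    C * ∑ i, ‖d i‖ₑ, ENNReal.mul_ne_top hC (ENNReal.sum_ne_top.2 fun i _ => enorm_ne_top),
    fun φ hφ => ?_⟩
  refine (H φ hφ.1 hφ.2 (hφ.3.trans Metric.ball_subset_closedBall)).trans ?_
  rw [mul_assoc]
  gcongr
  have hd : d = ∑ i, d i • e i := by
    ext j; simp [e, Finset.sum_apply, Pi.single_apply]
  rw [← lintegral_finsetSum' _ fun i _ =>
    ((contDiff_pd hφ.1 i).continuous.aestronglyMeasurable.enorm),
    ← lintegral_const_mul' _ _ (ENNReal.sum_ne_top.2 fun i _ => enorm_ne_top)]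
  refine lintegral_mono fun x => ?_
  conv_lhs => rw [hd]
  rw [map_sum, Finset.sum_mul]
  refine (enorm_sum_le _ _).trans (Finset.sum_le_sum fun i _ => ?_)
  rw [map_smul, enorm_smul]
  gcongr
  exact Finset.single_le_sum (f := fun i => ‖pd i φ x‖ₑ) (fun _ _ => zero_le) (Finset.mem_univ i)

/-- Prepares the passage from the `L¹` to the `L²` trace inequality, which applies the former to
a|φ|². Writing |φ|² as φ times its conjugate keeps it a smooth complex test function. -/
theorem lintegral_enorm_pd_smul_sq_le {a : E3 → ℝ} (ha : IsMultiplier a)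
    (ha1 : ∀ x, a x ∈ Set.Icc (0 : ℝ) 1) (U : Set E3) :
    ∃ D : ℝ≥0∞, D ≠ ⊤ ∧ ∀ i, ∀ φ : E3 → ℂ, IsTest Set.univ φ →
      ∫⁻ x in U, ‖pd i (fun x => a x • (φ x * (starRingEnd ℂ) (φ x))) x‖ₑ ≤
        D * h1norm U φ (fun i => pd i φ) ^ 2 := by
  obtain ⟨D, hD⟩ := ha.bound_pd
  refine ⟨2 + ENNReal.ofReal D, by simp, fun i φ hφ => ?_⟩
  have hφm := hφ.continuous.aestronglyMeasurable (μ := volume.restrict U)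
  have hpm := (hφ.pd i).continuous.aestronglyMeasurable (μ := volume.restrict U)
  have hpt : ∀ x, ‖pd i (fun x => a x • (φ x * (starRingEnd ℂ) (φ x))) x‖ₑ ≤
      2 * (‖φ x‖ₑ * ‖pd i φ x‖ₑ) + ENNReal.ofReal D * (‖φ x‖ₑ * ‖φ x‖ₑ) := by
    intro x
    rw [pd_smul ha.1 (hφ.1.mul hφ.conj.1), pd_mul hφ.1 hφ.conj.1, pd_conj hφ.1]
    have h1 : ‖a x‖ₑ ≤ 1 := by
      rw [Real.enorm_eq_ofReal (ha1 x).1]; exact ENNReal.ofReal_le_one.2 (ha1 x).2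
    have h2 : ‖pd i a x‖ₑ ≤ ENNReal.ofReal D := by
      rw [← ofReal_norm]; exact ENNReal.ofReal_le_ofReal (hD i x)
    have hc : ∀ w : ℂ, ‖(starRingEnd ℂ) w‖ₑ = ‖w‖ₑ := fun w => by
      rw [← ofReal_norm, ← ofReal_norm, RCLike.norm_conj]
    calc _ ≤ ‖a x‖ₑ * (‖φ x‖ₑ * ‖pd i φ x‖ₑ + ‖pd i φ x‖ₑ * ‖φ x‖ₑ) +
          ‖pd i a x‖ₑ * (‖φ x‖ₑ * ‖φ x‖ₑ) := by
          refine (enorm_add_le _ _).trans ?_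
          rw [enorm_smul, enorm_smul]
          gcongr
          · refine (enorm_add_le _ _).trans_eq ?_
            rw [enorm_mul, enorm_mul, hc, hc]
          · rw [enorm_mul, hc]
      _ ≤ 1 * (‖φ x‖ₑ * ‖pd i φ x‖ₑ + ‖pd i φ x‖ₑ * ‖φ x‖ₑ) +
          ENNReal.ofReal D * (‖φ x‖ₑ * ‖φ x‖ₑ) := by gcongr
      _ = _ := by ring
  have hm : Measurable fun x => ‖φ x‖ₑ := hφ.continuous.measurable.enorm
  have hm' : Measurable fun x => ‖pd i φ x‖ₑ := (hφ.pd i).continuous.measurable.enorm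
  have hm1 : Measurable fun x => ‖φ x‖ₑ * ‖pd i φ x‖ₑ := hm.mul hm'
  have hm2 : Measurable fun x => ‖φ x‖ₑ * ‖φ x‖ₑ := hm.mul hm
  set n := h1norm U φ (fun i => pd i φ)
  calc _ ≤ _ := lintegral_mono hpt
    _ = 2 * (∫⁻ x in U, ‖φ x‖ₑ * ‖pd i φ x‖ₑ) + ENNReal.ofReal D * ∫⁻ x in U, ‖φ x‖ₑ * ‖φ x‖ₑ := by
        rw [lintegral_add_left (hm1.const_mul _), lintegral_const_mul _ hm1, lintegral_const_mul _ hm2]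
    _ ≤ 2 * (n * n) + ENNReal.ofReal D * (n * n) := by
        gcongr
        · exact (lintegral_enorm_mul_le hφm hpm).trans (mul_le_mul' (eLpNorm_le_h1norm _ _ _)
            (eLpNorm_grad_le_h1norm U φ (fun i => pd i φ) i))
        · exact (lintegral_enorm_mul_le hφm hφm).trans (mul_le_mul' (eLpNorm_le_h1norm _ _ _)
            (eLpNorm_le_h1norm _ _ _))
    _ = _ := by ring

/-- The trace inequality. -/
theorem exists_trace_le (hΩ : IsOpen Ω) (hs : HasSmoothBoundary Ω) (hc : IsCompact (frontier Ω)) :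
    ∃ C : ℝ≥0∞, C ≠ ⊤ ∧ ∀ φ : E3 → ℂ, IsTest Set.univ φ →
      eLpNorm φ 2 (surfaceMeasure Ω) ≤ C * h1norm (closure Ω)ᶜ φ (fun i => pd i φ) := by
  have hloc : ∀ x₀, ∃ N : Set E3, ∃ C : ℝ≥0∞, x₀ ∈ frontier Ω → (IsOpen N ∧ x₀ ∈ N) ∧ C ≠ ⊤ ∧
      ∀ φ : E3 → ℂ, IsTest N φ →
      ∫⁻ x, ‖φ x‖ₑ ∂(surfaceMeasure Ω) ≤ C * ∑ i, ∫⁻ x in (closure Ω)ᶜ, ‖pd i φ x‖ₑ := by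
    intro x₀
    by_cases hx : x₀ ∈ frontier Ω
    · obtain ⟨N, hN, C, hC⟩ := exists_local_trace hΩ hs hx
      exact ⟨N, C, fun _ => ⟨hN, hC⟩⟩
    · exact ⟨∅, 0, fun h => absurd h hx⟩
  choose N C H using hloc
  obtain ⟨t, θ, h1, h2, h3, h4, h5, h6⟩ := exists_partition hc fun x hx => (H x hx).1
  have hD : ∀ j, ∃ D : ℝ≥0∞, j ∈ t → D ≠ ⊤ ∧ ∀ i, ∀ φ : E3 → ℂ, IsTest Set.univ φ →
      ∫⁻ x in (closure Ω)ᶜ, ‖pd i (fun x => θ j x • (φ x * (starRingEnd ℂ) (φ x))) x‖ₑ ≤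
        D * h1norm (closure Ω)ᶜ φ (fun i => pd i φ) ^ 2 := by
    intro j
    by_cases hj : j ∈ t
    · obtain ⟨D, hD⟩ := lintegral_enorm_pd_smul_sq_le
        (.of_hasCompactSupport (h2 j hj) (h3 j hj)) (h5 j hj) (closure Ω)ᶜ
      exact ⟨D, fun _ => hD⟩
    · exact ⟨0, fun h => absurd h hj⟩
  choose D hD using hD
  set A : ℝ≥0∞ := ∑ j ∈ t, C j * (3 * D j)
  have hA : A ≠ ⊤ := ENNReal.sum_ne_top.2 fun j hj => ENNReal.mul_ne_top (H j (h1 j hj)).2.1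
    (ENNReal.mul_ne_top (by simp) (hD j hj).1)
  -- The estimate is for squares with constant `A`; since A ≤ (A + 1)², using A + 1 avoids a square
  -- root.
  refine ⟨A + 1, ENNReal.add_ne_top.2 ⟨hA, ENNReal.one_ne_top⟩, fun φ hφ => ?_⟩
  set n := h1norm (closure Ω)ᶜ φ (fun i => pd i φ)
  have hsq : eLpNorm φ 2 (surfaceMeasure Ω) ^ 2 ≤ A * n ^ 2 := by
    rw [eLpNorm_two_sq]
    have hm : ∀ j ∈ t, Measurable fun x => ‖θ j x • (φ x * (starRingEnd ℂ) (φ x))‖ₑ := fun j hj =>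
      ((h2 j hj).continuous.smul (hφ.continuous.mul hφ.conj.continuous)).measurable.enorm
    calc _ = ∫⁻ x, ∑ j ∈ t, ‖θ j x • (φ x * (starRingEnd ℂ) (φ x))‖ₑ ∂(surfaceMeasure Ω) := by
          -- The θ_j sum to one only on the boundary, where the surface measure is concentrated.
          refine setLIntegral_congr_fun isClosed_frontier.measurableSet fun x hx => ?_
          have e1 : ∀ j ∈ t, ‖θ j x • (φ x * (starRingEnd ℂ) (φ x))‖ₑ =
              ENNReal.ofReal (θ j x) * ‖φ x‖ₑ ^ 2 := fun j hj => by
            rw [enorm_smul, Real.enorm_eq_ofReal (h5 j hj x).1, enorm_mul, pow_two]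
            congr 2
            rw [← ofReal_norm, ← ofReal_norm, RCLike.norm_conj]
          rw [Finset.sum_congr rfl e1, ← Finset.sum_mul, ← ENNReal.ofReal_sum_of_nonneg fun j hj =>
            (h5 j hj x).1, h6 x hx, ENNReal.ofReal_one, one_mul]
      _ = ∑ j ∈ t, ∫⁻ x, ‖θ j x • (φ x * (starRingEnd ℂ) (φ x))‖ₑ ∂(surfaceMeasure Ω) :=
          lintegral_finsetSum _ hm
      _ ≤ ∑ j ∈ t, C j * ∑ _i : Fin 3, D j * n ^ 2 := by
          refine Finset.sum_le_sum fun j hj => ((H j (h1 j hj)).2.2 _ ?_).trans ?_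
          · exact (hφ.mul hφ.conj.1).smul_of_subset (h2 j hj)
              (Set.inter_subset_left.trans (h4 j hj))
          · gcongr with i
            exact (hD j hj).2 i φ hφ
      _ = A * n ^ 2 := by
          simp only [A, Finset.sum_mul, Finset.sum_const, Finset.card_univ, Fintype.card_fin]
          refine Finset.sum_congr rfl fun j _ => ?_
          rw [nsmul_eq_mul]; push_cast; ring
  refine (ENNReal.pow_le_pow_left_iff (n := 2) (by norm_num)).1 (hsq.trans ?_)
  rw [mul_pow]
  gcongr
  calc A ≤ A + 1 := le_self_add
    _ ≤ (A + 1) ^ 2 := le_self_pow₀ le_add_self (by norm_num)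

end Global

/-! ### Traces -/

/-- The open set `Ω` has a smooth and compact boundary. -/
structure IsRegular (Ω : Set E3) : Prop where
  isOpen : IsOpen Ω
  smooth : HasSmoothBoundary Ω
  isCompact_frontier : IsCompact (frontier Ω)

section Trace

variable {Ω : Set E3} {u v : L2 (exterior Ω)} {g h : L2Boundary Ω}

theorem IsTrace.exists_isTest (hu : IsTrace Ω u g) {δ : ℝ≥0∞} (hδ : 0 < δ) :
    ∃ φ, IsTest Set.univ φ ∧ h1norm (exterior Ω) (fun x => u x - φ x)
      (fun i x => weakPartial i u x - pd i φ x) ≤ δ ∧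
      eLpNorm (fun x => g x - φ x) 2 (surfaceMeasure Ω) ≤ δ := by
  obtain ⟨η, hη, hη'⟩ := exists_four_mul_le hδ
  obtain ⟨φ, h1, h2⟩ := hu.2 η hη
  exact ⟨φ, (isTest_coe φ).mono (Set.subset_univ _), (h1norm_le_of_h1Close h1).trans hη',
    h2.trans ((le_mul_of_one_le_left zero_le (by norm_num)).trans hη')⟩

theorem isTrace_of_approx {G : Fin 3 → E3 → ℂ} (hu : IsW1 (exterior Ω : Set E3) u G)
    (H : ∀ δ : ℝ≥0∞, 0 < δ → ∃ φ, IsTest Set.univ φ ∧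
      h1norm (exterior Ω) (fun x => u x - φ x) (fun i x => G i x - pd i φ x) ≤ δ ∧
      eLpNorm (fun x => g x - φ x) 2 (surfaceMeasure Ω) ≤ δ) : IsTrace Ω u g := by
  refine ⟨hu.memH1, fun δ hδ => ?_⟩
  obtain ⟨φ, hφ, h1, h2⟩ := H δ hδ
  refine ⟨(hφ.mono (V := ((⊤ : Opens E3) : Set E3)) (by simp)).bundle, h1Close_of_h1norm_le ?_, h2⟩
  exact (h1norm_congr (ae_eq_refl _)
    fun i => (hu.weakPartial_ae_eq i).sub (ae_eq_refl (pd i φ))).trans_le h1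

theorem IsTrace.sub (hu : IsTrace Ω u g) (hv : IsTrace Ω v h) : IsTrace Ω (u - v) (g - h) := by
  refine isTrace_of_approx (hu.1.isW1_sub hv.1) fun δ hδ => ?_
  obtain ⟨φ, hφ, h1, h2⟩ := hu.exists_isTest (ENNReal.half_pos hδ.ne')
  obtain ⟨ψ, hψ, h3, h4⟩ := hv.exists_isTest (ENNReal.half_pos hδ.ne')
  have hsub : IsTest Set.univ fun x => φ x + -ψ x := hφ.add hψ.neg
  simp only [← sub_eq_add_neg] at hsub
  refine ⟨_, hsub, ?_, ?_⟩
  · have ku := hu.1.isW1.sub (isW1_of_isTest (U := (exterior Ω : Set E3)) hφ)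
    have kv := (hv.1.isW1.sub (isW1_of_isTest (U := (exterior Ω : Set E3)) hψ)).const_mul (-1)
    have h3' : h1norm (exterior Ω) (fun x => -1 * (v x - ψ x))
        (fun i x => -1 * (weakPartial i v x - pd i ψ x)) ≤ δ / 2 := by
      rw [h1norm_const_mul, enorm_neg, enorm_one, one_mul]; exact h3
    refine le_trans (le_of_eq ?_) ((h1norm_add_le ku.1.1 kv.1.1 (fun i => (ku.2 i).1)
      fun i => (kv.2 i).1).trans ((add_le_add h1 h3').trans_eq (ENNReal.add_halves δ)))
    refine h1norm_congr ?_ fun i => .of_forall fun x => ?_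
    · filter_upwards [Lp.coeFn_sub u v] with x hx
      rw [hx, Pi.sub_apply]; ring
    · simp only [pd_sub hφ.1 hψ.1]; ring
  · calc _ = eLpNorm ((fun x => g x - φ x) - fun x => h x - ψ x) 2 (surfaceMeasure Ω) := by
          refine eLpNorm_congr_ae ?_
          filter_upwards [Lp.coeFn_sub g h] with x hx
          simp only [hx, Pi.sub_apply]; ring
      _ ≤ _ := eLpNorm_sub_le ((Lp.aestronglyMeasurable g).sub hφ.continuous.aestronglyMeasurable)
          ((Lp.aestronglyMeasurable h).sub hψ.continuous.aestronglyMeasurable) (by norm_num)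
      _ ≤ δ := (add_le_add h2 h4).trans_eq (ENNReal.add_halves δ)

/-- Finiteness of the surface measure is never shown separately; the trace inequality supplies
integrability. -/
theorem IsRegular.memLp (hΩ : IsRegular Ω) {φ : E3 → ℂ} (hφ : IsTest Set.univ φ) :
    MemLp φ 2 (surfaceMeasure Ω) := by
  obtain ⟨C, hC, H⟩ := exists_trace_le hΩ.1 hΩ.2 hΩ.3
  refine ⟨hφ.continuous.aestronglyMeasurable, (H φ hφ).trans_lt ?_⟩
  have := isW1_of_isTest (U := (closure Ω)ᶜ) hφ
  refine ENNReal.mul_lt_top hC.lt_top (ENNReal.add_lt_top.2 ⟨this.1.2, ?_⟩)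
  exact ENNReal.sum_lt_top.2 fun i _ => (this.2 i).2

theorem h1norm_sub_comm (U : Set E3) (u v : E3 → ℂ) (g h : Fin 3 → E3 → ℂ) :
    h1norm U (fun x => u x - v x) (fun i x => g i x - h i x) =
      h1norm U (fun x => v x - u x) (fun i x => h i x - g i x) := by
  have := h1norm_const_mul U (fun x => v x - u x) (fun i x => h i x - g i x) (-1)
  simpa using this

theorem eq_zero_of_forall_eLpNorm_le {C : ℝ≥0∞} (hC : C ≠ ⊤)
    (H : ∀ δ : ℝ≥0∞, 0 < δ → ‖g‖ₑ ≤ C * δ) : g = 0 := by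
  rw [← enorm_eq_zero]
  refine le_antisymm (le_of_forall_gt fun c hc => ?_) zero_le
  by_cases hc' : c = ⊤
  · rw [hc']; exact enorm_lt_top
  refine (H (c / (C + 1) / 2) (ENNReal.half_pos (ENNReal.div_pos hc.ne' (by simp [hC])).ne')).trans_lt
    ?_
  have hlt : c / (C + 1) / 2 < c / (C + 1) := ENNReal.half_lt_self
    (ENNReal.div_pos hc.ne' (by simp [hC])).ne' (ENNReal.div_ne_top hc' (by simp))
  calc C * (c / (C + 1) / 2) ≤ (C + 1) * (c / (C + 1) / 2) := by gcongr; exact le_self_add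
    _ < (C + 1) * (c / (C + 1)) :=
        (ENNReal.mul_lt_mul_iff_right (by simp) (by simp [hC])).2 hlt
    _ ≤ c := ENNReal.mul_div_le

/-- Restriction to the boundary is closable: test functions that tend to zero in H¹ of the exterior
tend to zero on the boundary by the trace inequality. -/
theorem IsRegular.eq_zero_of_isTrace_zero (hΩ : IsRegular Ω) (hg : IsTrace Ω 0 g) : g = 0 := by
  obtain ⟨C, hC, H⟩ := exists_trace_le hΩ.1 hΩ.2 hΩ.3
  have h0 : IsW1 (exterior Ω : Set E3) (0 : L2 (exterior Ω)) (fun _ _ => 0) :=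
    IsW10.zero.toIsW1.congr (Lp.coeFn_zero _ _ _).symm fun _ => ae_eq_refl _
  refine eq_zero_of_forall_eLpNorm_le (C := C + 1) (by simp [hC]) fun δ hδ => ?_
  obtain ⟨φ, hφ, h1, h2⟩ := hg.exists_isTest hδ
  have h3 : h1norm (closure Ω)ᶜ φ (fun i => pd i φ) ≤ δ := by
    refine le_trans (le_of_eq ?_) h1
    refine Eq.symm ((h1norm_congr (v := fun x => (0 : ℂ) - φ x) (h := fun i x => 0 - pd i φ x)
      ((Lp.coeFn_zero _ _ _).sub (ae_eq_refl φ))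
      fun i => (h0.weakPartial_ae_eq i).sub (ae_eq_refl (pd i φ))).trans ?_)
    rw [h1norm_sub_comm]
    simp only [sub_zero]; rfl
  rw [Lp.enorm_def]
  calc _ = eLpNorm ((fun x => g x - φ x) + φ) 2 (surfaceMeasure Ω) := by
        congr 1; ext x; simp
    _ ≤ _ := eLpNorm_add_le ((Lp.aestronglyMeasurable g).sub hφ.continuous.aestronglyMeasurable)
        hφ.continuous.aestronglyMeasurable (by norm_num)
    _ ≤ δ + C * δ := by
        gcongr
        exact (H φ hφ).trans (by gcongr)
    _ = _ := by ring

theorem IsRegular.isTrace_unique (hΩ : IsRegular Ω) (hg : IsTrace Ω u g) (hh : IsTrace Ω u h) :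
    g = h := by
  have := hg.sub hh
  rw [sub_self] at this
  exact sub_eq_zero.1 (hΩ.eq_zero_of_isTrace_zero this)

/-- By the trace inequality the boundary values of an approximating sequence are Cauchy in `L²` of
the boundary; the limit is the trace. -/
theorem IsRegular.exists_isTrace (hΩ : IsRegular Ω) {G : Fin 3 → E3 → ℂ}
    (hu : IsW1 (exterior Ω : Set E3) u G)
    (H : ∀ δ : ℝ≥0∞, 0 < δ → ∃ φ, IsTest Set.univ φ ∧
      h1norm (exterior Ω) (fun x => u x - φ x) (fun i x => G i x - pd i φ x) ≤ δ) :
    ∃ g, IsTrace Ω u g := by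
  obtain ⟨C, hC, HC⟩ := exists_trace_le hΩ.1 hΩ.2 hΩ.3
  have hpos : ∀ n : ℕ, (0 : ℝ≥0∞) < (n : ℝ≥0∞)⁻¹ := fun n =>
    ENNReal.inv_pos.2 (ENNReal.natCast_ne_top n)
  choose φ hφ h1 using fun n : ℕ => H _ (hpos n)
  have hlim : Filter.Tendsto (fun n : ℕ => C * (2 * (n : ℝ≥0∞)⁻¹)) Filter.atTop (nhds 0) := by
    have := ENNReal.Tendsto.const_mul (ENNReal.Tendsto.const_mul
      ENNReal.tendsto_inv_nat_nhds_zero (a := 2) (by simp)) (a := C) (by simp [hC])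
    simpa using this
  have hd : ∀ n m N : ℕ, N ≤ n → N ≤ m →
      edist ((hΩ.memLp (hφ n)).toLp) ((hΩ.memLp (hφ m)).toLp) ≤ C * (2 * (N : ℝ≥0∞)⁻¹) := by
    intro n m N hn hm
    rw [Lp.edist_toLp_toLp]
    have hsub : IsTest Set.univ fun x => φ n x + -φ m x := (hφ n).add (hφ m).neg
    simp only [← sub_eq_add_neg] at hsub
    refine (HC _ hsub).trans ?_
    gcongr
    have kn := (isW1_of_isTest (U := (exterior Ω : Set E3)) (hφ n)).sub hu
    have km := hu.sub (isW1_of_isTest (U := (exterior Ω : Set E3)) (hφ m))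
    have := h1norm_add_le kn.1.1 km.1.1 (fun i => (kn.2 i).1) fun i => (km.2 i).1
    simp only [sub_add_sub_cancel] at this
    rw [show (fun i => pd i fun x => φ n x - φ m x) = fun i x => pd i (φ n) x - pd i (φ m) x from
      funext fun i => funext fun x => pd_sub (hφ n).1 (hφ m).1 i x]
    refine this.trans ?_
    rw [h1norm_sub_comm, two_mul]
    exact add_le_add ((h1 n).trans (by gcongr)) ((h1 m).trans (by gcongr))
  have hc : CauchySeq fun n => (hΩ.memLp (hφ n)).toLp :=
    EMetric.cauchySeq_iff_le_tendsto_0.2 ⟨_, fun n m N hn hm => hd n m N hn hm, hlim⟩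
  obtain ⟨g, hg⟩ := cauchySeq_tendsto_of_complete hc
  refine ⟨g, isTrace_of_approx hu fun δ hδ => ?_⟩
  have e1 := (tendsto_iff_edist_tendsto_0.1 hg).eventually_le_const hδ
  have e2 := ENNReal.tendsto_inv_nat_nhds_zero.eventually_le_const hδ
  obtain ⟨n, hn1, hn2⟩ := (e1.and e2).exists
  refine ⟨φ n, hφ n, (h1 n).trans hn2, le_trans (le_of_eq ?_) hn1⟩
  rw [edist_comm, Lp.edist_def]
  refine eLpNorm_congr_ae ?_
  filter_upwards [(hΩ.memLp (hφ n)).coeFn_toLp] with x hx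
  rw [Pi.sub_apply, hx]

theorem MemH10.isTrace_zero (hu : MemH10 u) : IsTrace Ω u 0 := by
  refine isTrace_of_approx hu.1.isW1 fun δ hδ => ?_
  obtain ⟨φ, hφ, h1⟩ := hu.isW10.approx δ hδ
  refine ⟨φ, hφ.mono (Set.subset_univ _), h1, ?_⟩
  have : (fun x => (0 : L2Boundary Ω) x - φ x) =ᵐ[surfaceMeasure Ω] 0 := by
    filter_upwards [Lp.coeFn_zero ℂ 2 (surfaceMeasure Ω),
      ae_restrict_mem isClosed_frontier.measurableSet] with x hx hxf
    rw [hx, hφ.eq_zero fun h => h (frontier_subset_closure hxf)]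
    simp
  rw [eLpNorm_congr_ae this, eLpNorm_zero]
  exact zero_le

theorem IsTrace.mulBy (hu : IsTrace Ω u g) {a : E3 → ℝ} (ha : ContDiff ℝ ∞ a)
    (hc : HasCompactSupport a) (h1 : ∀ x ∈ frontier Ω, a x = 1) :
    IsTrace Ω (mulBy a u) g := by
  have hm : IsMultiplier a := .of_hasCompactSupport ha hc
  obtain ⟨C, hC, H⟩ := hm.h1norm_le (exterior Ω : Set E3)
  refine isTrace_of_approx ((hu.1.isW1.smul hm).congr
    (mulBy_ae_eq_of_hasCompactSupport ha.continuous hc u).symm fun _ => ae_eq_refl _) fun δ hδ => ?_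
  obtain ⟨φ, hφ, h2, h3⟩ := hu.exists_isTest (δ := δ / (C + 1))
    (ENNReal.div_pos hδ.ne' (by simp [hC]))
  refine ⟨_, hφ.smul ha, ?_, ?_⟩
  · have k := hu.1.isW1.sub (isW1_of_isTest (U := (exterior Ω : Set E3)) hφ)
    calc _ = _ := h1norm_congr (v := fun x => a x • (u x - φ x))
          (h := fun i x => a x • (weakPartial i u x - pd i φ x) + pd i a x • (u x - φ x))
          (by
            filter_upwards [mulBy_ae_eq_of_hasCompactSupport ha.continuous hc u] with x hx
            rw [hx, smul_sub]) fun i => .of_forall fun x => by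
              simp only [pd_smul ha hφ.1, smul_sub]; ring
      _ ≤ _ := H _ _ k.1.1 fun i => (k.2 i).1
      _ ≤ C * (δ / (C + 1)) := by gcongr
      _ ≤ (C + 1) * (δ / (C + 1)) := by gcongr; exact le_self_add
      _ ≤ δ := ENNReal.mul_div_le
  · have : (fun x => g x - a x • φ x) =ᵐ[surfaceMeasure Ω] fun x => g x - φ x := by
      filter_upwards [ae_restrict_mem isClosed_frontier.measurableSet] with x hx
      rw [h1 x hx, one_smul]
    rw [eLpNorm_congr_ae this]
    exact h3.trans (ENNReal.div_le_of_le_mul (le_mul_of_one_le_right zero_le le_add_self))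

/-- Extension by zero of a function with vanishing trace. -/
theorem IsRegular.isW1_indicator (hΩ : IsRegular Ω) (hu : IsTrace Ω u 0) :
    IsW1 Set.univ ((exterior Ω : Set E3).indicator u)
      (fun i => (exterior Ω : Set E3).indicator (weakPartial i u)) := by
  have hU : MeasurableSet (exterior Ω : Set E3) := (exterior Ω).isOpen.measurableSet
  have hw := hu.1.isW1
  refine ⟨memLp_univ_indicator hU hw.1, fun i => memLp_univ_indicator hU (hw.2 i),
    fun i ψ hψ => ?_⟩
  rw [setIntegral_univ_indicator_mul hU, setIntegral_univ_indicator_mul hU]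
  obtain ⟨C, hC, H⟩ := exists_flux_le hΩ.1 hΩ.2 i hψ.2.isCompact
  refine weak_of_approx hψ hw.1 (hw.2 i)
    (ENNReal.mul_ne_top hC (hΩ.memLp hψ).eLpNorm_ne_top) fun δ hδ => ?_
  obtain ⟨φ, hφ, h1, h2⟩ := hu.exists_isTest hδ
  refine ⟨φ, hφ, (eLpNorm_le_h1norm _ _ _).trans h1,
    (eLpNorm_grad_le_h1norm _ _ (fun i x => weakPartial i u x - pd i φ x) i).trans h1, ?_⟩
  have h3 : eLpNorm φ 2 (surfaceMeasure Ω) ≤ δ := by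
    rw [← eLpNorm_neg]
    refine le_trans (le_of_eq (eLpNorm_congr_ae ?_)) h2
    filter_upwards [Lp.coeFn_zero ℂ 2 (surfaceMeasure Ω)] with x hx
    rw [hx]; simp
  -- The boundary term is the flux of φψ. It is at most a constant times the boundary norms of φ and
  -- ψ, and that of φ is at most `δ` because the trace of `u` is zero.
  simp only [← pd_mul hφ.1 hψ.1 i]
  refine (H _ (hφ.mul hψ.1) (closure_mono (Function.support_mul_subset_right _ _))).trans ?_
  rw [mul_assoc, mul_comm _ δ]
  gcongr
  simp only [enorm_mul]
  exact (lintegral_enorm_mul_le (hΩ.memLp hφ).1 (hΩ.memLp hψ).1).trans (by gcongr)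

/-- In the exterior mollification suffices, and inside `Ω` the function is zero. At a boundary point
the support lies in the complement of `Ω`, and a small translation along an outward direction moves
it, boundary points included, into the exterior. -/
theorem IsRegular.isW10_local (hΩ : IsRegular Ω) {w : E3 → ℂ} {k : Fin 3 → E3 → ℂ}
    (hw : IsW1 Set.univ w k) (h0 : ∀ x ∈ Ω, w x = 0) (x₀ : E3) :
    ∃ N : Set E3, (IsOpen N ∧ x₀ ∈ N) ∧ ∀ a : E3 → ℝ, ContDiff ℝ ∞ a → HasCompactSupport a →
      tsupport a ⊆ N → IsW10 (closure Ω)ᶜ (fun y => a y • w y)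
        (fun i y => a y • k i y + pd i a y • w y) := by
  have hU : IsOpen (closure Ω)ᶜ := isClosed_closure.isOpen_compl
  by_cases hx1 : x₀ ∈ (closure Ω)ᶜ
  · refine ⟨_, ⟨hU, hx1⟩, fun a ha hc hs => ?_⟩
    refine (hw.smul (.of_hasCompactSupport ha hc)).isW10_of_shift hU hc.isCompact
      (fun y hy => by rw [image_eq_zero_of_notMem_tsupport hy, zero_smul]) fun r hr =>
      ⟨0, by simpa, fun y hy => ?_⟩
    rw [add_zero]; exact hs hy
  by_cases hx2 : x₀ ∈ Ω
  · refine ⟨Ω, ⟨hΩ.1, hx2⟩, fun a ha hc hs => ?_⟩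
    have e : (fun y => a y • w y) = fun _ => (0 : ℂ) := by
      ext y
      by_cases hy : y ∈ Ω
      · rw [h0 y hy, smul_zero]
      · rw [image_eq_zero_of_notMem_tsupport fun h => hy (hs h), zero_smul]
    have h1 := (hw.smul (.of_hasCompactSupport ha hc)).mono_set (Set.subset_univ (closure Ω)ᶜ)
    rw [e] at h1 ⊢
    exact IsW10.zero.congr (ae_eq_refl _) fun i => IsW10.zero.toIsW1.grad_unique hU h1 i
  have hx3 : x₀ ∈ frontier Ω := by
    rw [hΩ.1.frontier_eq]; exact ⟨not_not.1 hx1, hx2⟩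
  obtain ⟨ℓ, hℓ, H⟩ := hΩ.2.exists_isTransversal hΩ.1 hx3
  obtain ⟨v, hv⟩ : ∃ v, ℓ v ≠ 0 := by
    by_contra! h; exact hℓ (ContinuousLinearMap.ext h)
  obtain ⟨r, hr⟩ := H ((ℓ v)⁻¹ • v) (by
    rw [map_smul, smul_eq_mul, inv_mul_cancel₀ hv]; exact one_pos)
  set d := (ℓ v)⁻¹ • v
  refine ⟨_, ⟨Metric.isOpen_ball, Metric.mem_ball_self hr.pos⟩, fun a ha hc hs => ?_⟩
  obtain ⟨η, hη, hη'⟩ := hc.isCompact.exists_cthickening_subset_open Metric.isOpen_ball hs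
  refine (hw.smul (.of_hasCompactSupport ha hc)).isW10_of_shift hU
    (K := tsupport a ∩ Ωᶜ) (hc.isCompact.inter_right hΩ.1.isClosed_compl) (fun y hy => ?_)
    fun ρ hρ => ?_
  · by_cases hy' : y ∈ Ω
    · rw [h0 y hy', smul_zero]
    · rw [image_eq_zero_of_notMem_tsupport fun h => hy ⟨h, hy'⟩, zero_smul]
  · have hd : 0 < ‖d‖ := norm_pos_iff.2 hr.ne_zero
    -- The shift has length min(η, ρ)/2: below `ρ` as requested, and below `η` so that translated
    -- points stay in the ball where `push` holds.
    have hpos : 0 < min η ρ / 2 / ‖d‖ := by have := lt_min hη hρ; positivity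
    have hnorm : ‖(min η ρ / 2 / ‖d‖) • d‖ = min η ρ / 2 := by
      rw [norm_smul, Real.norm_of_nonneg hpos.le]; field_simp
    have hlt : min η ρ / 2 < min η ρ := half_lt_self (lt_min hη hρ)
    refine ⟨(min η ρ / 2 / ‖d‖) • d, by rw [hnorm]; exact hlt.trans_le (min_le_right _ _),
      fun p hp => hr.push p (hs hp.1) hp.2 _ hpos (hη' ?_)⟩
    refine Metric.mem_cthickening_of_dist_le _ p η _ hp.1 ?_
    rw [dist_eq_norm, add_sub_cancel_left, hnorm]
    exact hlt.le.trans (min_le_left _ _)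

/-- The zero extension is in H¹(ℝ³); cutting off at infinity makes the support compact, and then
membership is local. Converse to `MemH10.isTrace_zero`, it puts differences of functions with equal
traces within reach of H¹₀ uniqueness. -/
theorem IsRegular.memH10_of_isTrace_zero (hΩ : IsRegular Ω) (hu : IsTrace Ω u 0) : MemH10 u := by
  have hU : MeasurableSet (exterior Ω : Set E3) := (exterior Ω).isOpen.measurableSet
  have hw := hΩ.isW1_indicator hu
  have h10 : IsW10 (exterior Ω : Set E3) ((exterior Ω : Set E3).indicator u)
      (fun i => (exterior Ω : Set E3).indicator (weakPartial i u)) := by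
    refine IsW10.of_approx (hw.mono_set (Set.subset_univ _)) fun δ hδ => ?_
    obtain ⟨a, ha, hc, h1⟩ := hw.exists_cutoff hδ
    refine ⟨_, _, ?_, (h1norm_mono_set (Set.subset_univ _) _ _).trans h1⟩
    have hv := hw.smul (.of_hasCompactSupport ha hc)
    choose N hN hloc using hΩ.isW10_local hv fun x hx => by
      have hx' : x ∉ (exterior Ω : Set E3) := fun h => h (subset_closure hx)
      rw [Set.indicator_of_notMem hx', smul_zero]
    exact hv.isW10_of_local (exterior Ω).isOpen hc.isCompact
      (fun x hx => by rw [image_eq_zero_of_notMem_tsupport hx, zero_smul])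
      (fun x _ => hN x) fun x _ => hloc x
  exact (h10.congr (indicator_ae_eq_restrict hU) fun i => indicator_ae_eq_restrict hU).memH10

end Trace

/-! ### The free resolvent -/

section Free

open TemperedDistribution FourierTransform

variable {s : ℂ}

/-- The Fourier symbol of `s² - Δ`. -/
def symbol (s : ℂ) (ξ : E3) : ℂ := s ^ 2 + ((2 * Real.pi) ^ 2 * ‖ξ‖ ^ 2 : ℝ)

theorem hasTemperateGrowth_symbol (s : ℂ) : (symbol s).HasTemperateGrowth := by
  unfold symbol
  fun_prop

theorem symbol_apply (T : 𝓢'(E3, ℂ)) :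
    s ^ 2 • T - Δ T = fourierMultiplierCLM ℂ (symbol s) T := by
  have h1 : symbol s = (fun _ => s ^ 2) + ((2 * Real.pi : ℂ) ^ 2) • fun ξ : E3 =>
      Complex.ofReal (‖ξ‖ ^ 2) := by
    ext ξ; simp [symbol]
  have hn : (fun ξ : E3 => Complex.ofReal (‖ξ‖ ^ 2)).HasTemperateGrowth := by fun_prop
  have hn' : (((2 * Real.pi : ℂ) ^ 2) • fun ξ : E3 =>
      Complex.ofReal (‖ξ‖ ^ 2)).HasTemperateGrowth := by
    simp only [Pi.smul_def, smul_eq_mul]; fun_prop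
  have h2 : fourierMultiplierCLM ℂ (symbol s) T = fourierMultiplierCLM ℂ (fun _ : E3 => s ^ 2) T +
      ((2 * Real.pi : ℂ) ^ 2) • fourierMultiplierCLM ℂ (fun ξ : E3 => Complex.ofReal (‖ξ‖ ^ 2)) T := by
    rw [← smul_apply, ← fourierMultiplierCLM_smul hn, h1]
    simp only [fourierMultiplierCLM_apply, smulLeftCLM_add (.const _) hn', add_apply]
    exact map_add (fourierInvCLM ℂ 𝓢'(E3, ℂ)) _ _
  rw [h2, laplacian_eq_fourierMultiplierCLM, fourierMultiplierCLM_const]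
  ext φ
  simp

/-- Multiplication by the conjugate of s, as in `jetOp_coercive`, now at each frequency: no
cancellation can occur between s² and the nonnegative term. -/
theorem symbol_lower_bound (hs : 0 < s.re) :
    ∃ c : ℝ, 0 < c ∧ ∀ ξ, c * (1 + ‖ξ‖ ^ 2) ≤ ‖symbol s ξ‖ := by
  have hs0 : 0 < ‖s‖ := norm_pos_iff.2 fun h => by simp [h] at hs
  refine ⟨s.re / ‖s‖ * min (‖s‖ ^ 2) ((2 * Real.pi) ^ 2), by positivity, fun ξ => ?_⟩
  set t : ℝ := (2 * Real.pi) ^ 2 * ‖ξ‖ ^ 2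
  have h1 : s.re * (‖s‖ ^ 2 + t) ≤ ‖s‖ * ‖symbol s ξ‖ := by
    have h2 : ((starRingEnd ℂ) s * symbol s ξ).re = s.re * (‖s‖ ^ 2 + t) := by
      have : symbol s ξ = s ^ 2 + (t : ℂ) := rfl
      rw [this, Complex.sq_norm, Complex.normSq_apply]
      simp [pow_two]
      ring
    rw [← h2, ← RCLike.norm_conj s, ← norm_mul]
    exact Complex.re_le_norm _
  have h3 : min (‖s‖ ^ 2) ((2 * Real.pi) ^ 2) * (1 + ‖ξ‖ ^ 2) ≤ ‖s‖ ^ 2 + t := by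
    rw [mul_add, mul_one]
    exact add_le_add (min_le_left _ _) (mul_le_mul_of_nonneg_right (min_le_right _ _) (by positivity))
  calc _ = s.re / ‖s‖ * (min (‖s‖ ^ 2) ((2 * Real.pi) ^ 2) * (1 + ‖ξ‖ ^ 2)) := by ring
    _ ≤ s.re / ‖s‖ * (‖s‖ ^ 2 + t) := by gcongr
    _ = s.re * (‖s‖ ^ 2 + t) / ‖s‖ := by ring
    _ ≤ ‖symbol s ξ‖ := by rw [div_le_iff₀ hs0, mul_comm ‖symbol s ξ‖]; exact h1

theorem symbol_upper_bound (s : ℂ) :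
    ∃ C : ℝ, ∀ ξ, ‖symbol s ξ‖ ≤ C * (1 + ‖ξ‖ ^ 2) := by
  refine ⟨‖s‖ ^ 2 + (2 * Real.pi) ^ 2, fun ξ => (norm_add_le _ _).trans ?_⟩
  rw [norm_pow, Complex.norm_real, Real.norm_of_nonneg (by positivity), add_mul, mul_add, mul_add]
  nlinarith [mul_nonneg (sq_nonneg ‖s‖) (sq_nonneg ‖ξ‖), sq_nonneg (2 * Real.pi)]

/-- The symbol is factored through (1 + |ξ|²)⁻¹: the product `M` is bounded above and away from
zero, so f̂ / M is in `L²`. The Bessel potential then restores the factor and places the solution in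
H² at once. -/
theorem exists_isFreeResolvent (hs : 0 < s.re) (f : L2Space) : ∃ u, IsFreeResolvent s f u := by
  obtain ⟨c, hc, hlow⟩ := symbol_lower_bound hs
  obtain ⟨C, hup⟩ := symbol_upper_bound s
  set b : E3 → ℂ := fun ξ => ((1 + ‖ξ‖ ^ 2) ^ ((-2 : ℝ) / 2) : ℝ)
  have hb : b.HasTemperateGrowth := by fun_prop
  have hbn : ∀ ξ, ‖b ξ‖ = (1 + ‖ξ‖ ^ 2)⁻¹ := fun ξ => by
    rw [Complex.norm_real, Real.norm_of_nonneg (by positivity)]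
    norm_num [Real.rpow_neg_one]
  set M : E3 → ℂ := b * symbol s
  have hM : M.HasTemperateGrowth := hb.mul (hasTemperateGrowth_symbol s)
  have hMn : ∀ ξ, ‖M ξ‖ = (1 + ‖ξ‖ ^ 2)⁻¹ * ‖symbol s ξ‖ := fun ξ => by
    rw [← hbn, ← norm_mul]; rfl
  have hM1 : ∀ ξ, ‖M ξ‖ ≤ C := fun ξ => by
    rw [hMn, inv_mul_le_iff₀ (by positivity), mul_comm]; exact hup ξ
  have hM2 : ∀ ξ, c ≤ ‖M ξ‖ := fun ξ => by
    rw [hMn, le_inv_mul_iff₀ (by positivity), mul_comm]; exact hlow ξ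
  have hM0 : ∀ ξ, M ξ ≠ 0 := fun ξ => norm_pos_iff.1 (hc.trans_le (hM2 ξ))
  have hMc : Continuous M := hM.1.continuous
  have hML : MemLp M ⊤ (volume : Measure E3) :=
    memLp_top_of_bound hMc.aestronglyMeasurable C (.of_forall hM1)
  have hIL : MemLp (fun ξ => (M ξ)⁻¹) ⊤ (volume : Measure E3) :=
    memLp_top_of_bound (hMc.inv₀ hM0).aestronglyMeasurable c⁻¹ (.of_forall fun ξ => by
      rw [norm_inv]; exact inv_anti₀ hc (hM2 ξ))
  set wh : L2Space := hIL.toLp _ • 𝓕 f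
  set w : L2Space := 𝓕⁻ wh
  have hmul : (hML.toLp _ • wh : L2Space) = 𝓕 f := by
    ext1
    filter_upwards [Lp.coeFn_lpSMul (r := 2) (hML.toLp M) wh, Lp.coeFn_lpSMul (r := 2) (hIL.toLp _) (𝓕 f),
      hML.coeFn_toLp, hIL.coeFn_toLp] with ξ h1 h2 h3 h4
    rw [h1, Pi.smul_apply', h2, Pi.smul_apply', h3, h4, smul_smul, mul_inv_cancel₀ (hM0 ξ), one_smul]
  have hw : fourierMultiplierCLM ℂ M (w : 𝓢'(E3, ℂ)) = (f : 𝓢'(E3, ℂ)) := by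
    rw [fourierMultiplierCLM_apply, Lp.fourier_toTemperedDistribution_eq, fourier_fourierInv_eq,
      ← Lp.toTemperedDistribution_smul_eq hM hML (r := 2), hmul,
      ← Lp.fourier_toTemperedDistribution_eq, fourierInv_fourier_eq]
  set T : 𝓢'(E3, ℂ) := besselPotential E3 ℂ (-2) (w : 𝓢'(E3, ℂ))
  have hT : MemSobolev 2 2 T := ⟨w, by simp [T]⟩
  obtain ⟨u, hu⟩ := memSobolev_zero_iff.1 (hT.mono (s' := 0) (by norm_num))
  refine ⟨u, hu ▸ hT, ?_⟩
  rw [← hu, symbol_apply, ← hw]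
  exact fourierMultiplierCLM_fourierMultiplierCLM_apply hb (hasTemperateGrowth_symbol s) _

theorem toTemperedDistribution_apply_eq {φ : E3 → ℂ} (u : L2Space) (Φ : 𝓢(E3, ℂ))
    (hΦ : ∀ x, Φ x = φ x) : (u : 𝓢'(E3, ℂ)) Φ = ∫ x, u x * φ x := by
  rw [Lp.toTemperedDistribution_apply]
  simp_rw [hΦ, smul_eq_mul, mul_comm]

theorem exists_isW1_of_memSobolev {u : L2Space} (hu : MemSobolev 2 2 (u : 𝓢'(E3, ℂ))) :
    ∃ g, IsW1 Set.univ u g := by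
  have : ∀ i, ∃ g : L2Space, ∂_{e i} (u : 𝓢'(E3, ℂ)) = (g : 𝓢'(E3, ℂ)) := fun i =>
    memSobolev_zero_iff.1 ((hu.lineDerivOp (m := e i)).mono (s' := 0) (by norm_num))
  choose g hg using this
  refine ⟨fun i => g i, ?_, fun i => ?_, fun i φ hφ => ?_⟩
  · rw [Measure.restrict_univ]; exact Lp.memLp u
  · rw [Measure.restrict_univ]; exact Lp.memLp (g i)
  · rw [Measure.restrict_univ]
    have h := congrArg (fun T : 𝓢'(E3, ℂ) => T (hφ.2.toSchwartzMap hφ.1)) (hg i)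
    simp only [TemperedDistribution.lineDerivOp_apply_apply, map_neg] at h
    rw [toTemperedDistribution_apply_eq (φ := φ) (g i) _ fun x => rfl,
      toTemperedDistribution_apply_eq (φ := pd i φ) u _ fun x => rfl] at h
    rw [← h, neg_neg]

theorem IsFreeResolvent.integral_mul_laplacian {f u : L2Space} (hu : IsFreeResolvent s f u)
    {φ : E3 → ℂ} (hφ : IsTest Set.univ φ) :
    ∫ x, u x * (∑ i, pd i (pd i φ) x) = ∫ x, (s ^ 2 * u x - f x) * φ x := by
  have h := congrArg (fun T : 𝓢'(E3, ℂ) => T (hφ.2.toSchwartzMap hφ.1)) hu.2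
  have h1 : (u : 𝓢'(E3, ℂ)) (Δ (hφ.2.toSchwartzMap hφ.1)) = ∫ x, u x * (∑ i, pd i (pd i φ) x) :=
    toTemperedDistribution_apply_eq u _ fun x => by
      rw [SchwartzMap.laplacian_apply]
      exact laplacian_eq_sum_pd hφ.1 x
  change s ^ 2 • (u : 𝓢'(E3, ℂ)) (hφ.2.toSchwartzMap hφ.1) -
    (Δ (u : 𝓢'(E3, ℂ))) (hφ.2.toSchwartzMap hφ.1) = _ at h
  rw [TemperedDistribution.laplacian_apply_apply, h1, toTemperedDistribution_apply_eq (φ := φ) u _ fun x => rfl] at h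
  change _ = (f : 𝓢'(E3, ℂ)) (hφ.2.toSchwartzMap hφ.1) at h
  rw [toTemperedDistribution_apply_eq (φ := φ) f _ fun x => rfl] at h
  have hi (v : L2Space) : Integrable (fun x => v x * φ x) :=
    (Lp.memLp v).integrable_mul (hφ.memLp 2 _)
  simp_rw [sub_mul, mul_assoc]
  rw [integral_sub ((hi u).const_mul _) (hi f), integral_const_mul, ← h, smul_eq_mul]
  ring

/-- `L²(ℝ³)` as `L²` of the open set `⊤`. -/
def toTop (u : L2Space) : L2 ⊤ := ((Lp.memLp u).restrict _).toLp u

theorem toTop_ae_eq (u : L2Space) :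
    toTop u =ᵐ[volume.restrict ((⊤ : Opens E3) : Set E3)] u :=
  ((Lp.memLp u).restrict _).coeFn_toLp

theorem ae_restrict_top {p : E3 → Prop} :
    (∀ᵐ x ∂(volume.restrict ((⊤ : Opens E3) : Set E3)), p x) ↔ ∀ᵐ x, p x := by
  rw [Opens.coe_top, Measure.restrict_univ]

/-- A solution of `(s² - Δ) u = f` in `H¹(ℝ³)` is unique. -/
theorem eq_of_isW1_univ (hs : 0 < s.re) {f u v : L2Space} {g h : Fin 3 → E3 → ℂ}
    (hu : IsW1 Set.univ u g) (hv : IsW1 Set.univ v h)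
    (hfu : ∀ φ, IsTest Set.univ φ →
      ∫ x, u x * (∑ i, pd i (pd i φ) x) = ∫ x, (s ^ 2 * u x - f x) * φ x)
    (hfv : ∀ φ, IsTest Set.univ φ →
      ∫ x, v x * (∑ i, pd i (pd i φ) x) = ∫ x, (s ^ 2 * v x - f x) * φ x) : u = v := by
  have hmem : ∀ {w : L2Space} {k}, IsW1 Set.univ w k → MemH10 (toTop w) := fun {w k} hw => by
    have : IsW10 ((⊤ : Opens E3) : Set E3) (toTop w) k :=
      IsW10.congr (U := ((⊤ : Opens E3) : Set E3)) hw.isW10_univ (toTop_ae_eq w).symm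
        fun _ => ae_eq_refl _
    exact this.memH10
  have hlap : ∀ {w : L2Space}, (∀ φ, IsTest Set.univ φ →
      ∫ x, w x * (∑ i, pd i (pd i φ) x) = ∫ x, (s ^ 2 * w x - f x) * φ x) →
      HasWeakLaplacian (toTop w) (s ^ 2 • toTop w - toTop f) := fun {w} hw => by
    rw [hasWeakLaplacian_iff]
    intro φ hφ
    have e3 : (s ^ 2 • toTop w - toTop f : L2 ⊤) =ᵐ[volume.restrict ((⊤ : Opens E3) : Set E3)]
        fun x => s ^ 2 * w x - f x := by
      filter_upwards [Lp.coeFn_sub (s ^ 2 • toTop w) (toTop f), Lp.coeFn_smul (s ^ 2) (toTop w), toTop_ae_eq w,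
        toTop_ae_eq f]
        with x h1 h2 h3 h4
      rw [h1, Pi.sub_apply, h2, Pi.smul_apply, h3, h4, smul_eq_mul]
    rw [integral_mul_congr (toTop_ae_eq w), integral_mul_congr e3, Opens.coe_top, Measure.restrict_univ]
    exact hw φ (hφ.mono (Set.subset_univ _))
  have := eq_of_dirichlet hs (hmem hu) (hmem hv) (hlap hfu) (hlap hfv)
  ext1
  refine ae_restrict_top.1 ((toTop_ae_eq u).symm.trans ?_)
  rw [this]
  exact toTop_ae_eq v

theorem existsUnique_isFreeResolvent (hs : 0 < s.re) (f : L2Space) :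
    ∃! u, IsFreeResolvent s f u := by
  obtain ⟨u, hu⟩ := exists_isFreeResolvent hs f
  refine ⟨u, hu, fun v hv => ?_⟩
  obtain ⟨g, hg⟩ := exists_isW1_of_memSobolev hu.1
  obtain ⟨h, hh⟩ := exists_isW1_of_memSobolev hv.1
  exact eq_of_isW1_univ hs hh hg (fun _ => hv.integral_mul_laplacian)
    fun _ => hu.integral_mul_laplacian

theorem isFreeResolvent_freeResolvent (hs : 0 < s.re) (f : L2Space) :
    IsFreeResolvent s f (freeResolvent s f) := by
  have h := exists_isFreeResolvent hs f
  rw [freeResolvent, dif_pos h]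
  exact h.choose_spec

/-- Identifies a free resolvent from H¹ and the weak equation alone, so H² regularity of the
candidate need not be checked. -/
theorem eq_freeResolvent (hs : 0 < s.re) {f u : L2Space} {g : Fin 3 → E3 → ℂ}
    (hu : IsW1 Set.univ u g)
    (hfu : ∀ φ, IsTest Set.univ φ →
      ∫ x, u x * (∑ i, pd i (pd i φ) x) = ∫ x, (s ^ 2 * u x - f x) * φ x) :
    u = freeResolvent s f := by
  have hv := isFreeResolvent_freeResolvent hs f
  obtain ⟨h, hh⟩ := exists_isW1_of_memSobolev hv.1
  exact eq_of_isW1_univ hs hu hh hfu fun _ => hv.integral_mul_laplacian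

end Free

/-! ### The operators in the exterior of a regular set -/

section Exterior

variable {Ω : Set E3} {s z : ℂ}

theorem restrictTo_ae_eq (U : Opens E3) (u : L2Space) :
    restrictTo U u =ᵐ[volume.restrict (U : Set E3)] u :=
  ((Lp.memLp u).restrict _).coeFn_toLp

theorem extendZero_ae_eq {U : Opens E3} (u : L2 U) :
    extendZero u =ᵐ[volume] (U : Set E3).indicator u :=
  MemLp.coeFn_toLp _

theorem isDirichletResolvent_dirichletResolvent (hs : 0 < s.re) (f : L2 (exterior Ω)) :
    IsDirichletResolvent Ω s f (dirichletResolvent Ω s f) := by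
  have h : ∃ u, IsDirichletResolvent Ω s f u := (existsUnique_dirichlet (exterior Ω) hs f).exists
  rw [dirichletResolvent, dif_pos h]
  exact h.choose_spec

theorem eq_dirichletResolvent (hs : 0 < s.re) {f u : L2 (exterior Ω)}
    (hu : IsDirichletResolvent Ω s f u) : u = dirichletResolvent Ω s f :=
  have h := isDirichletResolvent_dirichletResolvent hs f
  eq_of_dirichlet hs hu.1 h.1 hu.2 h.2

theorem exists_isW1_freeResolventExt (hs : 0 < s.re) (f : L2 (exterior Ω)) :
    ∃ g, IsW1 Set.univ (freeResolvent s (extendZero f)) g :=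
  exists_isW1_of_memSobolev (isFreeResolvent_freeResolvent hs (extendZero f)).1

theorem IsRegular.existsUnique_isTrace (hΩ : IsRegular Ω) (hs : 0 < s.re) (f : L2 (exterior Ω)) :
    ∃! g, IsTrace Ω (freeResolventExt Ω s f) g := by
  obtain ⟨G, hG⟩ := exists_isW1_freeResolventExt hs f
  have e := restrictTo_ae_eq (exterior Ω) (freeResolvent s (extendZero f))
  obtain ⟨g, hg⟩ := hΩ.exists_isTrace (u := freeResolventExt Ω s f)
    ((hG.mono_set (Set.subset_univ (exterior Ω : Set E3))).congr e.symm fun _ => ae_eq_refl _)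
    fun δ hδ => by
      obtain ⟨φ, hφ, h1⟩ := hG.isW10_univ.approx δ hδ
      exact ⟨φ, hφ, (h1norm_congr (e.sub (ae_eq_refl φ)) fun _ => ae_eq_refl _).trans_le
        ((h1norm_mono_set (Set.subset_univ _) _ _).trans h1)⟩
  exact ⟨g, hg, fun h hh => hΩ.isTrace_unique hh hg⟩

theorem isTrace_trace {u : L2 (exterior Ω)} (h : ∃ g, IsTrace Ω u g) : IsTrace Ω u (trace Ω u) := by
  rw [trace, dif_pos h]
  exact h.choose_spec

/-- Existence corrects an H¹ lifting of `g` by an H¹₀ function, which leaves the trace unchanged.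
For uniqueness, two solutions differ by a function of trace zero, hence in H¹₀, where only zero
solves the homogeneous equation. -/
theorem IsRegular.existsUnique_isDirichletSolution (hΩ : IsRegular Ω) (hz : 0 < z.re)
    {g : L2Boundary Ω} (hg : g ∈ HHalf Ω) : ∃! v, IsDirichletSolution Ω z g v := by
  obtain ⟨u, hu⟩ := hg
  obtain ⟨w, hw, hΔ⟩ := exists_memH10_sub_solution hz hu.1
  have htr := hu.sub hw.isTrace_zero
  rw [sub_zero] at htr
  refine ⟨u - w, ⟨htr.1, hΔ, htr⟩, fun v hv => ?_⟩
  have h0 := hv.2.2.sub htr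
  rw [sub_self] at h0
  have hd := hΩ.memH10_of_isTrace_zero h0
  have hΔ0 := hv.2.1.sub hΔ
  rw [← smul_sub] at hΔ0
  have hz0 : MemH10 (0 : L2 (exterior Ω)) :=
    (IsW10.zero.congr (Lp.coeFn_zero _ _ _).symm fun _ => ae_eq_refl _).memH10
  have hl0 : HasWeakLaplacian (0 : L2 (exterior Ω)) (z ^ 2 • (0 : L2 (exterior Ω)) - 0) := by
    have := hΔ.sub hΔ
    rw [sub_self, sub_self] at this
    rwa [smul_zero, sub_zero]
  exact sub_eq_zero.1 (eq_of_dirichlet hz hd hz0 (by rwa [sub_zero]) hl0)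

theorem isDirichletSolution_dirichletSolution {g : L2Boundary Ω}
    (h : ∃ v, IsDirichletSolution Ω z g v) :
    IsDirichletSolution Ω z g (dirichletSolution Ω z g) := by
  rw [dirichletSolution, dif_pos h]
  exact h.choose_spec

theorem hasWeakLaplacian_freeResolventExt (hs : 0 < s.re) (f : L2 (exterior Ω)) :
    HasWeakLaplacian (freeResolventExt Ω s f) (s ^ 2 • freeResolventExt Ω s f - f) := by
  rw [hasWeakLaplacian_iff]
  intro φ hφ
  have hU : MeasurableSet (exterior Ω : Set E3) := (exterior Ω).isOpen.measurableSet
  have hφ' := hφ.mono (Set.subset_univ _)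
  set r := freeResolvent s (extendZero f)
  have e1 : freeResolventExt Ω s f =ᵐ[volume.restrict (exterior Ω : Set E3)] r :=
    restrictTo_ae_eq (exterior Ω) r
  have e2 : (s ^ 2 • freeResolventExt Ω s f - f : L2 (exterior Ω)) =ᵐ[volume.restrict
      (exterior Ω : Set E3)] fun x => s ^ 2 * r x - extendZero f x := by
    filter_upwards [Lp.coeFn_sub (s ^ 2 • freeResolventExt Ω s f) f,
      Lp.coeFn_smul (s ^ 2) (freeResolventExt Ω s f), e1, ae_restrict_of_ae (extendZero_ae_eq f),
      ae_restrict_mem hU] with x h1 h2 h3 h4 h5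
    rw [h1, Pi.sub_apply, h2, Pi.smul_apply, h3, h4, Set.indicator_of_mem h5, smul_eq_mul]
  have hΔ : IsTest (exterior Ω : Set E3) fun x => ∑ i, pd i (pd i φ) x :=
    IsTest.sum fun i _ => (hφ.pd i).pd i
  rw [integral_mul_congr e1, integral_mul_congr e2,
    ← setIntegral_subset_mul (Set.subset_univ (exterior Ω : Set E3)) r hΔ,
    ← setIntegral_subset_mul (Set.subset_univ (exterior Ω : Set E3)) _ hφ, Measure.restrict_univ]
  exact (isFreeResolvent_freeResolvent hs (extendZero f)).integral_mul_laplacian hφ'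

theorem HasWeakLaplacian.mulBy {U : Opens E3} {u f : L2 U} (h : HasWeakLaplacian u f) (hu : MemH1 u)
    {a : E3 → ℝ} (ha : ContDiff ℝ ∞ a) (hc : HasCompactSupport a) :
    HasWeakLaplacian (mulBy a u) (mulBy a f + commLaplacian a u) := by
  rw [hasWeakLaplacian_iff] at h ⊢
  intro φ hφ
  rw [integral_mul_congr (mulBy_ae_eq_of_hasCompactSupport ha.continuous hc u),
    integral_smul_mul_laplacian hu.isW1 (.of_hasCompactSupport ha hc) (Lp.memLp f) h hφ
      (Set.inter_subset_right.trans hφ.3)]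
  refine integral_mul_congr ?_ φ
  filter_upwards [Lp.coeFn_add (KreinFormula.mulBy a f) (commLaplacian a u),
    mulBy_ae_eq_of_hasCompactSupport ha.continuous hc f, commLaplacian_ae_eq ha hc u] with x h1 h2 h3
  rw [h1, Pi.add_apply, h2, h3, add_assoc]

theorem mulBy_smul {U : Opens E3} {a : E3 → ℝ} (ha : Continuous a) (hc : HasCompactSupport a) (c : ℂ)
    (u : L2 U) : mulBy a (c • u) = c • mulBy a u := by
  ext1
  filter_upwards [mulBy_ae_eq_of_hasCompactSupport ha hc (c • u), Lp.coeFn_smul c u,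
    mulBy_ae_eq_of_hasCompactSupport ha hc u, Lp.coeFn_smul c (mulBy a u)] with x h1 h2 h3 h4
  rw [h1, h2, h4, Pi.smul_apply, Pi.smul_apply, h3, smul_comm]

end Exterior

/-! ### Scaled cut-off functions -/

section Cutoff

variable {χ : E3 → ℝ} {a : ℝ}

theorem pd_eq_zero_of_isOpen {f : E3 → ℝ} {c : ℝ} {O : Set E3} (hO : IsOpen O)
    (h : ∀ y ∈ O, f y = c) (i : Fin 3) : ∀ x ∈ O, pd i f x = 0 := by
  intro x hx
  have : f =ᶠ[nhds x] fun _ => c := Filter.eventually_of_mem (hO.mem_nhds hx) h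
  rw [pd, this.fderiv_eq]
  simp

theorem IsCutoff.contDiff_scaled (hχ : IsCutoff χ) (a : ℝ) : ContDiff ℝ ∞ (scaled χ a) :=
  hχ.smooth.comp (contDiff_const_smul _)

theorem IsCutoff.scaled_eq_one (hχ : IsCutoff χ) (ha : 0 < a) {x : E3} (hx : ‖x‖ < a) :
    scaled χ a x = 1 := by
  refine hχ.eq_one _ ?_
  rw [norm_smul, norm_inv, Real.norm_of_nonneg ha.le, inv_mul_lt_iff₀ ha, mul_one]
  exact hx

theorem IsCutoff.scaled_eq_zero (hχ : IsCutoff χ) (ha : 0 < a) {x : E3} (hx : 2 * a ≤ ‖x‖) :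
    scaled χ a x = 0 := by
  refine hχ.eq_zero _ ?_
  rw [norm_smul, norm_inv, Real.norm_of_nonneg ha.le, le_inv_mul_iff₀ ha, mul_comm]
  exact hx

theorem IsCutoff.hasCompactSupport_scaled (hχ : IsCutoff χ) (ha : 0 < a) :
    HasCompactSupport (scaled χ a) :=
  HasCompactSupport.intro (isCompact_closedBall (0 : E3) (2 * a)) fun x hx => by
    refine hχ.scaled_eq_zero ha (not_lt.1 fun h => hx ?_)
    rw [mem_closedBall_zero_iff]
    exact h.le

theorem IsCutoff.pd_scaled_of_lt (hχ : IsCutoff χ) (ha : 0 < a) (i : Fin 3) :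
    ∀ x ∈ Metric.ball (0 : E3) a, pd i (scaled χ a) x = 0 :=
  pd_eq_zero_of_isOpen Metric.isOpen_ball (fun _ hy =>
    hχ.scaled_eq_one ha (mem_ball_zero_iff.1 hy)) i

theorem IsCutoff.pd_scaled_of_gt (hχ : IsCutoff χ) (ha : 0 < a) (i : Fin 3) :
    ∀ x ∈ (Metric.closedBall (0 : E3) (2 * a))ᶜ, pd i (scaled χ a) x = 0 :=
  pd_eq_zero_of_isOpen Metric.isClosed_closedBall.isOpen_compl (fun _ hy =>
    hχ.scaled_eq_zero ha (not_lt.1 fun h => hy (mem_closedBall_zero_iff.2 h.le))) i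

theorem IsCutoff.pd_pd_scaled_of_gt (hχ : IsCutoff χ) (ha : 0 < a) (i : Fin 3) :
    ∀ x ∈ (Metric.closedBall (0 : E3) (2 * a))ᶜ, pd i (pd i (scaled χ a)) x = 0 :=
  pd_eq_zero_of_isOpen Metric.isClosed_closedBall.isOpen_compl (hχ.pd_scaled_of_gt ha i) i

/-- Spheres are null, so derivatives of a cut-off need only be known to vanish on the open region
beyond its support radius. -/
theorem ae_norm_ne (U : Set E3) {r : ℝ} (hr : r ≠ 0) : ∀ᵐ x ∂(volume.restrict U), ‖x‖ ≠ r := by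
  refine ae_restrict_of_ae ?_
  have := Measure.addHaar_sphere_of_ne_zero (volume : Measure E3) 0 hr
  filter_upwards [compl_mem_ae_iff.2 this] with x hx h
  exact hx (mem_sphere_zero_iff_norm.2 h)

/-- `[Δ, χ_a] u` vanishes outside of the ball of radius `2a`. -/
theorem IsCutoff.commLaplacian_eq_zero (hχ : IsCutoff χ) (ha : 0 < a) {U : Opens E3} (u : L2 U) :
    ∀ᵐ x ∂(volume.restrict (U : Set E3)), 2 * a ≤ ‖x‖ → commLaplacian (scaled χ a) u x = 0 := by
  filter_upwards [commLaplacian_ae_eq (hχ.contDiff_scaled a) (hχ.hasCompactSupport_scaled ha) u,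
    ae_norm_ne (U : Set E3) (r := 2 * a) (by positivity)] with x h1 h2 h3
  have hx : x ∈ (Metric.closedBall (0 : E3) (2 * a))ᶜ := fun h =>
    h2 (le_antisymm (mem_closedBall_zero_iff.1 h) h3)
  rw [h1]
  simp [hχ.pd_pd_scaled_of_gt ha _ x hx, hχ.pd_scaled_of_gt ha _ x hx]

theorem IsCutoff.opL_eq_zero (hχ : IsCutoff χ) (ha : 0 < a) {U : Opens E3} (s z : ℂ) (u : L2 U) :
    ∀ᵐ x ∂(volume.restrict (U : Set E3)), 2 * a ≤ ‖x‖ → opL (scaled χ a) s z u x = 0 := by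
  filter_upwards [hχ.commLaplacian_eq_zero ha u,
    Lp.coeFn_sub (commLaplacian (scaled χ a) u) ((s ^ 2 - z ^ 2) • mulBy (scaled χ a) u),
    Lp.coeFn_smul (s ^ 2 - z ^ 2) (mulBy (scaled χ a) u),
    mulBy_ae_eq_of_hasCompactSupport (hχ.contDiff_scaled a).continuous
      (hχ.hasCompactSupport_scaled ha) u] with x h1 h2 h3 h4 hx
  rw [opL, h2, Pi.sub_apply, h1 hx, h3, Pi.smul_apply, h4, hχ.scaled_eq_zero ha hx, zero_smul,
    smul_zero, sub_zero]

/-- The image of L_a vanishes for |x| ≥ 2a, and χ_{2a} = 1 for |x| < 2a. The same nesting of radii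
gives `mulBy_mulBy` and `commLaplacian_mulBy`. -/
theorem IsCutoff.mulBy_opL (hχ : IsCutoff χ) (ha : 0 < a) {U : Opens E3} (s z : ℂ) (u : L2 U) :
    mulBy (scaled χ (2 * a)) (opL (scaled χ a) s z u) = opL (scaled χ a) s z u := by
  have h2a : 0 < 2 * a := by positivity
  ext1
  filter_upwards [hχ.opL_eq_zero ha s z u, mulBy_ae_eq_of_hasCompactSupport
    (hχ.contDiff_scaled (2 * a)).continuous (hχ.hasCompactSupport_scaled h2a)
    (opL (scaled χ a) s z u)] with x h1 h2
  rw [h2]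
  rcases lt_or_ge ‖x‖ (2 * a) with h | h
  · rw [hχ.scaled_eq_one h2a h, one_smul]
  · rw [h1 h, smul_zero]

theorem IsCutoff.mulBy_mulBy (hχ : IsCutoff χ) (ha : 0 < a) {U : Opens E3} (u : L2 U) :
    mulBy (scaled χ a) (mulBy (scaled χ (2 * a)) u) = mulBy (scaled χ a) u := by
  have h2a : 0 < 2 * a := by positivity
  ext1
  filter_upwards [mulBy_ae_eq_of_hasCompactSupport (hχ.contDiff_scaled (2 * a)).continuous
    (hχ.hasCompactSupport_scaled h2a) u, mulBy_ae_eq_of_hasCompactSupport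
    (hχ.contDiff_scaled a).continuous (hχ.hasCompactSupport_scaled ha) (mulBy (scaled χ (2 * a)) u),
    mulBy_ae_eq_of_hasCompactSupport (hχ.contDiff_scaled a).continuous
    (hχ.hasCompactSupport_scaled ha) u] with x h1 h2 h3
  rw [h2, h1, h3]
  rcases lt_or_ge ‖x‖ (2 * a) with h | h
  · rw [hχ.scaled_eq_one h2a h, one_smul]
  · rw [hχ.scaled_eq_zero ha h, zero_smul, zero_smul]

theorem IsCutoff.commLaplacian_mulBy (hχ : IsCutoff χ) (ha : 0 < a) {U : Opens E3} {u : L2 U}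
    (hu : MemH1 u) :
    commLaplacian (scaled χ a) (mulBy (scaled χ (2 * a)) u) = commLaplacian (scaled χ a) u := by
  have h2a : 0 < 2 * a := by positivity
  have hb := hχ.contDiff_scaled (2 * a)
  have hbc := hχ.hasCompactSupport_scaled h2a
  have hm := mulBy_ae_eq_of_hasCompactSupport hb.continuous hbc u
  have hW := (hu.isW1.smul (.of_hasCompactSupport hb hbc)).congr hm.symm fun _ => ae_eq_refl _
  ext1
  filter_upwards [hχ.commLaplacian_eq_zero ha u, hχ.commLaplacian_eq_zero ha
    (mulBy (scaled χ (2 * a)) u), commLaplacian_ae_eq (hχ.contDiff_scaled a)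
    (hχ.hasCompactSupport_scaled ha) u, commLaplacian_ae_eq (hχ.contDiff_scaled a)
    (hχ.hasCompactSupport_scaled ha) (mulBy (scaled χ (2 * a)) u), hm,
    ae_all_iff.2 fun i => hW.weakPartial_ae_eq i] with x h1 h2 h3 h4 h5 h6
  rcases lt_or_ge ‖x‖ (2 * a) with h | h
  · rw [h4, h3, h5]
    simp only [h6, hχ.scaled_eq_one h2a h,
      hχ.pd_scaled_of_lt h2a _ x (mem_ball_zero_iff.2 h), one_smul, zero_smul, add_zero]
  · rw [h1 h, h2 h]

end Cutoff

/-! ### The Krein-type formula -/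

section Krein

variable {Ω : Set E3} {χ : E3 → ℝ} {s z : ℂ} {δ : ℝ}

theorem pd_one_sub {b : E3 → ℝ} (hb : ContDiff ℝ ∞ b) (i : Fin 3) :
    pd i (fun y => 1 - b y) = fun x => -pd i b x := by
  funext x
  rw [pd_sub contDiff_const hb]
  simp [pd]

/-- Near infinity, the Dirichlet resolvent is given by the free resolvent. -/
theorem freeResolventExt_commLaplacian (hχ : IsCutoff χ) (hs : 0 < s.re) {a : ℝ} (ha : 0 < a)
    (hΩ : closure Ω ⊆ Metric.ball 0 a) {f w : L2 (exterior Ω)} (hw : IsDirichletResolvent Ω s f w)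
    (hf : ∀ᵐ x ∂(volume.restrict (exterior Ω : Set E3)), a ≤ ‖x‖ → f x = 0) :
    freeResolventExt Ω s (commLaplacian (scaled χ a) w) = w - mulBy (scaled χ a) w := by
  set b := scaled χ a
  have hb : ContDiff ℝ ∞ b := hχ.contDiff_scaled a
  have hbc : HasCompactSupport b := hχ.hasCompactSupport_scaled ha
  have hU : MeasurableSet (exterior Ω : Set E3) := (exterior Ω).isOpen.measurableSet
  have hm : IsMultiplier fun x => 1 - b x := (IsMultiplier.of_hasCompactSupport hb hbc).one_sub
  have hW := (hw.1.isW10.indicator hU).smul hm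
  -- (1 - χ_a) w extended by zero to ℝ³; the task is to show that it solves the free equation.
  set y : L2Space := MemLp.toLp _ hW.memLp_univ
  have hy : y =ᵐ[volume] fun x => (1 - b x) • (exterior Ω : Set E3).indicator w x :=
    MemLp.coeFn_toLp _
  have hyU : y =ᵐ[volume.restrict (exterior Ω : Set E3)] fun x => (1 - b x) • w x := by
    filter_upwards [ae_restrict_of_ae hy, ae_restrict_mem hU] with x h1 h2
    rw [h1, Set.indicator_of_mem h2]
  have hyW : IsW1 Set.univ y _ := hW.congr (by rw [Measure.restrict_univ]; exact hy.symm)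
    fun _ => ae_eq_refl _
  have key : y = freeResolvent s (extendZero (commLaplacian b w)) := by
    refine eq_freeResolvent hs hyW fun φ hφ => ?_
    -- 1 - χ_a vanishes on a ball containing the closure of `Ω`, so the equation in the exterior may
    -- be tested with `φ` on all of ℝ³.
    have hsub : tsupport (fun x => 1 - b x) ∩ tsupport φ ⊆ (exterior Ω : Set E3) := by
      refine Set.inter_subset_left.trans fun x hx hx' => ?_
      have h1 : tsupport (fun x => 1 - b x) ⊆ (Metric.ball (0 : E3) a)ᶜ :=
        closure_minimal (fun x hx hx' => hx (by
          change 1 - b x = 0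
          rw [show b x = 1 from hχ.scaled_eq_one ha (mem_ball_zero_iff.1 hx'), sub_self]))
          Metric.isOpen_ball.isClosed_compl
      exact h1 hx (hΩ hx')
    have h2 := integral_smul_mul_laplacian hw.1.1.isW1 hm (Lp.memLp _)
      (hasWeakLaplacian_iff.1 hw.2) hφ hsub
    have e1 : y =ᵐ[volume] (exterior Ω : Set E3).indicator fun x => (1 - b x) • w x := by
      filter_upwards [hy] with x h1
      rw [h1]
      by_cases hx : x ∈ (exterior Ω : Set E3)
      · rw [Set.indicator_of_mem hx, Set.indicator_of_mem hx]
      · rw [Set.indicator_of_notMem hx, Set.indicator_of_notMem hx, smul_zero]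
    have e2 : (fun x => s ^ 2 * y x - extendZero (commLaplacian b w) x) =ᵐ[volume]
        (exterior Ω : Set E3).indicator fun x => s ^ 2 * ((1 - b x) • w x) - commLaplacian b w x := by
      filter_upwards [e1, extendZero_ae_eq (commLaplacian b w)] with x h1 h2
      rw [h1, h2]
      by_cases hx : x ∈ (exterior Ω : Set E3)
      · simp only [Set.indicator_of_mem hx]
      · simp only [Set.indicator_of_notMem hx, mul_zero, sub_zero]
    have hi : ∀ F ψ : E3 → ℂ, ∫ x, (exterior Ω : Set E3).indicator F x * ψ x =
        ∫ x in (exterior Ω : Set E3), F x * ψ x := fun F ψ => by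
      rw [← setIntegral_univ_indicator_mul hU, Measure.restrict_univ]
    rw [integral_mul_congr e1, integral_mul_congr e2, hi, hi, h2]
    refine integral_mul_congr ?_ φ
    filter_upwards [commLaplacian_ae_eq hb hbc w, Lp.coeFn_sub (s ^ 2 • w) f,
      Lp.coeFn_smul (s ^ 2) w, hf] with x h1 h2 h3 h4
    -- The source lives where |x| < a, where the factor is zero; only the commutator remains.
    have h5 : (1 - b x) • f x = 0 := by
      rcases lt_or_ge ‖x‖ a with h | h
      · rw [show b x = 1 from hχ.scaled_eq_one ha h, sub_self, zero_smul]
      · rw [h4 h, smul_zero]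
    have h6 : ∀ i, pd i (pd i fun y => 1 - b y) x = -pd i (pd i b) x := fun i => by
      rw [pd_one_sub hb]
      simp only [pd, fderiv_fun_neg, neg_apply]
      rfl
    rw [h1, h2, Pi.sub_apply, h3, Pi.smul_apply, smul_sub, h5, sub_zero]
    simp only [h6]
    simp only [pd_one_sub hb, Finset.sum_neg_distrib, neg_smul, smul_eq_mul, Complex.real_smul]
    push_cast
    ring
  rw [freeResolventExt, ← key]
  ext1
  filter_upwards [restrictTo_ae_eq (exterior Ω) y, hyU, Lp.coeFn_sub w (mulBy b w),
    mulBy_ae_eq_of_hasCompactSupport hb.continuous hbc w] with x h1 h2 h3 h4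
  rw [h1, h2, h3, Pi.sub_apply, h4, sub_smul, one_smul]

/-- R_0(s) f - χ_δ v - R_D(s) f has trace zero and solves the Dirichlet problem with source L_δ v:
the two copies of f cancel, and χ_δ v contributes the commutator and the difference s² - z². -/
theorem IsRegular.krein (hΩ : IsRegular Ω) (hχ : IsCutoff χ) (hs : 0 < s.re) (hz : 0 < z.re)
    (hδ : 0 < δ) (hb : closure Ω ⊆ Metric.ball 0 δ) (f : L2 (exterior Ω)) :
    resolventDifference Ω s f =
      -(mulBy (scaled χ δ) (dirichletSolution Ω z (trace Ω (freeResolventExt Ω s f))) +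
        opQ Ω χ δ s z (dirichletSolution Ω z (trace Ω (freeResolventExt Ω s f)))) := by
  have htr := isTrace_trace (hΩ.existsUnique_isTrace hs f).exists
  set g := trace Ω (freeResolventExt Ω s f)
  have hv := isDirichletSolution_dirichletSolution
    (hΩ.existsUnique_isDirichletSolution hz (g := g) ⟨_, htr⟩).exists
  set v := dirichletSolution Ω z g
  have hu := isDirichletResolvent_dirichletResolvent (Ω := Ω) hs f
  have ha := hχ.contDiff_scaled δ
  have hac := hχ.hasCompactSupport_scaled hδ
  have hav : IsTrace Ω (mulBy (scaled χ δ) v) g := hv.2.2.mulBy ha hac fun x hx =>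
    hχ.scaled_eq_one hδ (mem_ball_zero_iff.1 (hb (frontier_subset_closure hx)))
  have hdiff := htr.sub hav
  rw [sub_self] at hdiff
  have hw : IsDirichletResolvent Ω s (opL (scaled χ δ) s z v)
      (freeResolventExt Ω s f - mulBy (scaled χ δ) v - dirichletResolvent Ω s f) := by
    refine ⟨(hΩ.memH10_of_isTrace_zero hdiff).sub hu.1, ?_⟩
    have h := ((hasWeakLaplacian_freeResolventExt hs f).sub (hv.2.1.mulBy hv.1 ha hac)).sub hu.2
    rw [mulBy_smul ha.continuous hac] at h
    convert h using 1
    rw [opL, smul_sub, smul_sub, sub_smul]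
    abel
  have hw' := eq_dirichletResolvent hs hw
  set w := freeResolventExt Ω s f - mulBy (scaled χ δ) v - dirichletResolvent Ω s f
  have h2δ : 0 < 2 * δ := by positivity
  -- χ_{2δ} is one where L_δ v lives and χ_{4δ} is one where χ_{2δ} is nonzero, so both drop out.
  -- What is left is R_0(s) [Δ, χ_{2δ}] w + χ_{2δ} w = w.
  have hQ : opQ Ω χ δ s z v = w := by
    rw [opQ, hχ.mulBy_opL hδ, ← hw', show 4 * δ = 2 * (2 * δ) by ring, hχ.commLaplacian_mulBy h2δ hw.1.1, hχ.mulBy_mulBy h2δ,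
      freeResolventExt_commLaplacian hχ hs h2δ
        (hb.trans (Metric.ball_subset_ball (by linarith))) hw (hχ.opL_eq_zero hδ s z v),
      sub_add_cancel]
  rw [hQ, resolventDifference]
  simp only [w]
  abel

theorem IsObstacle.isRegular_smul (hΩ : IsObstacle Ω) {ε : ℝ} (hε : 0 < ε) :
    IsRegular (ε • Ω) ∧ closure (ε • Ω) ⊆ Metric.closedBall 0 ε := by
  have hcl : closure (ε • Ω) ⊆ Metric.closedBall 0 ε := by
    refine closure_minimal ?_ Metric.isClosed_closedBall
    rintro _ ⟨x, hx, rfl⟩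
    have := mem_ball_zero_iff.1 (hΩ.subset_ball hx)
    rw [mem_closedBall_zero_iff, norm_smul, Real.norm_of_nonneg hε.le]
    nlinarith
  refine ⟨⟨hΩ.isOpen.smul₀ hε.ne', fun x hx => ?_, (isCompact_closedBall (0 : E3) ε).of_isClosed_subset
    isClosed_frontier (frontier_subset_closure.trans hcl)⟩, hcl⟩
  have hfr : ε⁻¹ • x ∈ frontier Ω := by
    have h := (Homeomorph.smulOfNeZero (α := E3) ε hε.ne').image_frontier Ω
    have hx' : x ∈ (fun y : E3 => ε • y) '' frontier Ω := by
      rw [show (fun y : E3 => ε • y) '' frontier Ω = frontier (ε • Ω) from h]; exact hx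
    obtain ⟨y, hy, rfl⟩ := hx'
    simpa [smul_smul, hε.ne'] using hy
  obtain ⟨V, ρ, hV, hxV, hρ, hd, h⟩ := hΩ.smooth _ hfr
  have hmem : ∀ {S : Set E3} {y : E3}, y ∈ ε • S ↔ ε⁻¹ • y ∈ S :=
    Set.mem_smul_set_iff_inv_smul_mem₀ hε.ne' _ _
  have hρx : DifferentiableAt ℝ ρ (ε⁻¹ • x) :=
    (hρ.contDiffAt (hV.mem_nhds hxV)).differentiableAt (by simp)
  refine ⟨ε • V, fun y => ρ (ε⁻¹ • y), hV.smul₀ hε.ne', hmem.2 hxV,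
    hρ.comp (contDiff_const_smul _).contDiffOn fun _ hy => hmem.1 hy, fun h0 => hd ?_, ?_⟩
  · have hder : HasFDerivAt (fun y : E3 => ρ (ε⁻¹ • y))
        ((fderiv ℝ ρ (ε⁻¹ • x)).comp (ε⁻¹ • ContinuousLinearMap.id ℝ E3)) x :=
      hρx.hasFDerivAt.comp x ((hasFDerivAt_id x).const_smul ε⁻¹)
    rw [hder.fderiv] at h0
    ext y
    have := congrArg (fun L : E3 →L[ℝ] ℝ => L (ε • y)) h0
    simpa [smul_smul, hε.ne'] using this
  · ext y
    have := Set.ext_iff.1 h (ε⁻¹ • y)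
    simp only [Set.mem_inter_iff, Set.mem_ofPred_eq, hmem] at this ⊢
    exact this

end Krein

end KreinFormula

end

/-! ### The theorem for the scaled obstacle -/

open KreinFormula in
theorem mainTheorem4 (Ω : Set E3) (hΩ : IsObstacle Ω) (χ : E3 → ℝ) (hχ : IsCutoff χ)
    (s z : ℂ) (hs : 0 < s.re) (hz : 0 < z.re) (ε : ℝ) (hε0 : 0 < ε) (hε1 : ε < 1)
    (m : ℕ) (hm : 2 ≤ m) :
    -- the operators in the formula are well defined
    (∀ f : L2 (exterior (ε • Ω)), ∃! u, IsDirichletResolvent (ε • Ω) s f u) ∧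
    (∀ f : L2Space, ∃! u, IsFreeResolvent s f u) ∧
    (∀ f : L2 (exterior (ε • Ω)), ∃! g, IsTrace (ε • Ω) (freeResolventExt (ε • Ω) s f) g) ∧
    (∀ g ∈ HHalf (ε • Ω), ∃! v, IsDirichletSolution (ε • Ω) z g v) ∧
    -- the Krein-type formula
    (∀ f : L2 (exterior (ε • Ω)),
      resolventDifference (ε • Ω) s f =
        -(mulBy (scaled χ (m * ε))
              (dirichletSolution (ε • Ω) z (trace (ε • Ω) (freeResolventExt (ε • Ω) s f))) +
            opQ (ε • Ω) χ (m * ε) s z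
              (dirichletSolution (ε • Ω) z (trace (ε • Ω) (freeResolventExt (ε • Ω) s f))))) := by
  obtain ⟨hR, hcl⟩ := hΩ.isRegular_smul hε0
  -- The closure of the scaled obstacle may touch the sphere of radius ε, so the strict inequality
  -- is what places it where χ_{mε} = 1.
  have hδ : ε < m * ε := by
    have : (2 : ℝ) ≤ m := by exact_mod_cast hm
    nlinarith
  refine ⟨fun f => existsUnique_dirichlet _ hs f, existsUnique_isFreeResolvent hs,
    hR.existsUnique_isTrace hs, fun g hg => hR.existsUnique_isDirichletSolution hz hg, fun f => ?_⟩
  exact hR.krein hχ hs hz (hε0.trans hδ) (hcl.trans (Metric.closedBall_subset_ball hδ)) f
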